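/- Let $n\in\mathbb{N}$ and let $\lambda$ be a partition with at most $2n$ parts. **Tableaux.** $SST_{2n}(\lambda)$ (resp. $SST_{2n}(\lambda/\mu)$) is the set of semistandard tableaux of shape $\lambda$ (resp. skew shape $\lambda/\mu$) with entries in $\{1,\dots,2n\}$, and $T[x]$ is the number of entries of $T$ equal to $x$. For $\mu\in Par_{\le n}$ (partitions with at most $n$ parts), $SpT_{2n}(\mu)$ is the set of $S\in SST_{2n}(\mu)$ with $S(k,1)\ge 2k-1$ for $1\le k\le\ell(\mu)$. $LRS_{2n}(\lambda/\mu)$ is the set of $T\in SST_{2n}(\lambda/\mu)$ whose reverse column word (columns from right to left, each from top to bottom) is a Yamanouchi word, whose weight $(T[1],\dots,T[2n])$ is a partition with $T[2i-1]=T[2i]$ for all $i$, and with $T(n+i,1)\ge 2i$ for all $i\ge 0$ such that $(n+i,1)$ is a cell of $\lambda$. The map $\lozenge$ replaces, for each $x$, the entries $x$ of $T$ by $1,2,3,\dots$ from right to left, and $Rec_{2n}(\lambda/\mu)=\lozenge\, LRS_{2n}(\lambda/\mu)$. **The quantum LR map.** For a column $\mathbf a=(a_1<\dots<a_l)$ put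 $\mathrm{rem}(\mathbf a)=\emptyset$ if $l\le 1$; if $l\ge2$, $a_l$ is even, $a_{l-1}=a_l-1$ and $a_l<2l-|\mathrm{rem}(a_1,\dots,a_{l-2})|-1$, put $\mathrm{rem}(\mathbf a)=\mathrm{rem}(a_1,\dots,a_{l-2})\cup\{a_{l-1},a_l\}$; otherwise $\mathrm{rem}(\mathbf a)=\mathrm{rem}(a_1,\dots,a_{l-1})$. Let $\mathrm{red}(\mathbf a)=\mathbf a\setminus\mathrm{rem}(\mathbf a)$. For a tableau $T$ with first column $\mathbf a$ and remaining columns $T_{\ge2}$, let $\mathrm{suc}(T)$ be obtained by column inserting the entries of $\mathrm{red}(\mathbf a)$, from the smallest to the largest, into $T_{\ge 2}$. Then $P^{AII}(T)$ is the tableau at which $T,\mathrm{suc}(T),\mathrm{suc}^2(T),\dots$ becomes stationary, and $Q^{AII}(T)$ is the filling of the shape of $T$ minus the shape of $P^{AII}(T)$ with entry $k$ in the cells of the shape of $\mathrm{suc}^{k-1}(T)$ that are not in the shape of $\mathrm{suc}^{k}(T)$. Put $LR^{AII}(T)=(P^{AII}(T),Q^{AII}(T))$. **$\mathfrak k$-weights.**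 For $1\le k\le n$ let $u_k=2k-\frac{1+(-1)^k}{2}$ and $v_k=2k-\frac{1+(-1)^{k+1}}{2}$, and let $wt_{\mathfrak k}(T)=(T[u_1]-T[v_1],\dots,T[u_n]-T[v_n])\in\mathbb{Z}^n$. For $\mu\in Par_{\le n}$ let $S^{H,\mu}$ (resp. $S_{L,-\mu}$) be the tableau of shape $\mu$ whose $k$-th row is filled with $u_k$ (resp. $v_k$). Let $SST^{\mathfrak k\text{-}hw}_{2n}(\lambda)$ (resp. $SST^{\mathfrak k\text{-}lw}_{2n}(\lambda)$) be the set of $T\in SST_{2n}(\lambda)$ such that $P^{AII}(T)=S^{H,\mu}$ (resp. $P^{AII}(T)=S_{L,-\mu}$) for some $\mu\in Par_{\le n}$. **Proposition.** The map $LR^{AII}$ is a bijection from $SST_{2n}(\lambda)$ onto $\bigsqcup_{\mu\in Par_{\le n},\,\mu\subseteq\lambda}SpT_{2n}(\mu)\times Rec_{2n}(\lambda/\mu)$. Let $(LR^{AII})^{-1}$ be its inverse. For every $\mu\in Par_{\le n}$ with $\mu\subseteq\lambda$ one has $S^{H,\mu},S_{L,-\mu}\in SpT_{2n}(\mu)$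 and 1. $(LR^{AII})^{-1}(\{S^{H,\mu}\}\times Rec_{2n}(\lambda/\mu))=\{S\in SST^{\mathfrak k\text{-}hw}_{2n}(\lambda): wt_{\mathfrak k}(S)=\mu\}$; 2. $(LR^{AII})^{-1}(\{S_{L,-\mu}\}\times Rec_{2n}(\lambda/\mu))=\{S\in SST^{\mathfrak k\text{-}lw}_{2n}(\lambda): wt_{\mathfrak k}(S)=-\mu\}$. Moreover $$SST^{\mathfrak k\text{-}hw}_{2n}(\lambda)=\bigsqcup_{\mu\in Par_{\le n},\,\mu\subseteq\lambda}(LR^{AII})^{-1}(\{S^{H,\mu}\}\times Rec_{2n}(\lambda/\mu)),$$ $$SST^{\mathfrak k\text{-}lw}_{2n}(\lambda)=\bigsqcup_{\mu\in Par_{\le n},\,\mu\subseteq\lambda}(LR^{AII})^{-1}(\{S_{L,-\mu}\}\times Rec_{2n}(\lambda/\mu)),$$ where both unions are disjoint. -/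

import Mathlib

namespace QuantumLR

/-! Partitions are Mathlib's `YoungDiagram`s: `lam.rowLen i` is the part `λ_{i+1}`, `lam.colLen 0` is
the length `ℓ(λ)`, `≤` is inclusion of diagrams, and `⊥` is the empty partition. Rows and columns
are numbered from `0`. -/

/-- A filling of the quarter plane. A tableau of shape `λ/μ` is a filling which is positive exactly
on the cells of `λ` outside `μ` (so it is `0` on `μ`, and by convention `0` outside `λ`). -/
abbrev Filling := ℕ → ℕ → ℕ

/-- Semistandard tableaux of skew shape `lam/mu` with entries in `{1, …, m}`. -/
structure IsSST (m : ℕ) (lam mu : YoungDiagram) (T : Filling) : Prop where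
  pos_iff : ∀ i j, 0 < T i j ↔ (i, j) ∈ lam ∧ (i, j) ∉ mu
  le_max : ∀ i j, T i j ≤ m
  row_weak : ∀ i j, (i, j) ∉ mu → (i, j + 1) ∈ lam → T i j ≤ T i (j + 1)
  col_strict : ∀ i j, (i, j) ∉ mu → (i + 1, j) ∈ lam → T i j < T (i + 1) j

/-- `SST_{2n}(λ)`. -/
def SST (n : ℕ) (lam : YoungDiagram) : Set Filling := {T | IsSST (2 * n) lam ⊥ T}

/-- `SpT_{2n}(μ)`: the entry of the first column in the `k`-th row (`k ≥ 1`) is at least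
`2k - 1`. -/
def SpT (n : ℕ) (mu : YoungDiagram) : Set Filling :=
  {T | T ∈ SST n mu ∧ ∀ i, (i, 0) ∈ mu → 2 * i + 1 ≤ T i 0}

/-- `T[x]`, the number of occurrences of `x` in the filling `T` of `lam`. -/
def content (lam : YoungDiagram) (T : Filling) (x : ℕ) : ℕ :=
  (lam.cells.filter (fun c => T c.1 c.2 = x)).card

/-! ### Littlewood–Richardson–Sundaram tableaux and recording tableaux -/

/-- The reverse column word: columns from right to left, each read from top to bottom, omitting the
zeros. -/
def revColWord (lam : YoungDiagram) (T : Filling) : List ℕ :=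
  (List.range (lam.rowLen 0)).reverse.flatMap fun j =>
    ((List.range (lam.colLen j)).map fun i => T i j).filter fun x => 0 < x

/-- A word is Yamanouchi if the weight of each of its prefixes is a partition. -/
def IsYamanouchi (w : List ℕ) : Prop :=
  ∀ p : List ℕ, p <+: w → ∀ x, 1 ≤ x → p.count (x + 1) ≤ p.count x

/-- `LRS_{2n}(λ/μ)`: the `n`-symplectic Littlewood–Richardson tableaux of shape `lam/mu`. -/
structure IsLRS (n : ℕ) (lam mu : YoungDiagram) (T : Filling) : Prop where
  sst : IsSST (2 * n) lam mu T
  yamanouchi : IsYamanouchi (revColWord lam T)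
  weight_partition : ∀ x, 1 ≤ x → content lam T (x + 1) ≤ content lam T x
  weight_even : ∀ x, 1 ≤ x → content lam T (2 * x - 1) = content lam T (2 * x)
  /-- `T(n + i, 1) ≥ 2i` for `i ≥ 1`, with rows and columns numbered from `1`
  (for `i = 0` this is no condition). -/
  symplectic : ∀ i, (n + i, 0) ∈ lam → 2 * (i + 1) ≤ T (n + i) 0

/-- The relabelling `◊`: for each `x ≥ 1`, the entries of `T` equal to `x` are replaced by
`1, 2, 3, …` from right to left. In other words, the `k`-th vertical strip, which is relabelled
with `k`s, consists of the `k`-th rightmost `1`, the `k`-th rightmost `2`, and so on. -/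
def diamond (lam : YoungDiagram) (T : Filling) : Filling := fun i j =>
  if T i j = 0 then 0
  else (lam.cells.filter (fun c => T c.1 c.2 = T i j ∧ j ≤ c.2)).card

/-- `Rec_{2n}(λ/μ) = ◊ LRS_{2n}(λ/μ)`. -/
def Rec (n : ℕ) (lam mu : YoungDiagram) : Set Filling :=
  diamond lam '' {T | IsLRS n lam mu T}

/-! ### The quantum Littlewood–Richardson map of type AII

For the algorithm, a tableau is the list of its columns from left to right, each column being listed
from top to bottom. -/

/-- The columns of a filling of `lam`. -/
def toCols (lam : YoungDiagram) (T : Filling) : List (List ℕ) :=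
  (List.range (lam.rowLen 0)).map fun j => (List.range (lam.colLen j)).map fun i => T i j

/-- The filling with given columns. -/
def ofCols (C : List (List ℕ)) : Filling := fun i j => (C.getD j []).getD i 0

/-- The cell `(i, j)` belongs to the shape of the tableau with columns `C`. -/
def IsCell (C : List (List ℕ)) (i j : ℕ) : Prop := i < (C.getD j []).length

/-- `rem` for a column listed from bottom to top. -/
def remRev : List ℕ → List ℕ
  | [] => []
  | [_] => []
  | y :: x :: t =>
    if Even y ∧ x + 1 = y ∧ y + (remRev t).length + 1 < 2 * (t.length + 2) then
      y :: x :: remRev t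
    else remRev (x :: t)

/-- The removable entries of a column `a = (a₁ < ⋯ < a_l)`. If `a_l` is even, `a_{l-1} = a_l - 1`
and `a_l < 2l - |rem(a₁, …, a_{l-2})| - 1`, then
`rem(a) = rem(a₁, …, a_{l-2}) ∪ {a_{l-1}, a_l}`; otherwise `rem(a) = rem(a₁, …, a_{l-1})`;
moreover `rem(a) = ∅` if `l ≤ 1`. -/
def rem (a : List ℕ) : List ℕ := (remRev a.reverse).reverse

/-- The reduction `red(a) = a ∖ rem(a)` of a column. -/
def red (a : List ℕ) : List ℕ := a.filter fun x => x ∉ rem a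

/-- Schensted column insertion `x → C`: in the first column, `x` replaces the smallest entry `≥ x`,
which is then inserted into the next column; if there is no such entry, `x` is put at the bottom. -/
def colInsert : ℕ → List (List ℕ) → List (List ℕ)
  | x, [] => [[x]]
  | x, c :: C =>
    match c.dropWhile (fun y => y < x) with
    | [] => (c ++ [x]) :: C
    | y :: r => (c.takeWhile (fun z => z < x) ++ x :: r) :: colInsert y C

/-- The product `a • C = a_k → (⋯ → (a₂ → (a₁ → C)))` of a column `a` with a tableau. -/
def colMul (a : List ℕ) (C : List (List ℕ)) : List (List ℕ) :=
  a.foldl (fun D x => colInsert x D) C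

/-- One step of the algorithm: the first column is reduced and multiplied with the rest. -/
def suc : List (List ℕ) → List (List ℕ)
  | [] => []
  | a :: C => colMul (red a) C

/-- `P^{AII}(T)`: the tableau at which the iteration of `suc` becomes stationary. A step that
changes the tableau removes at least two cells, so `|λ|` steps suffice. -/
def PAII (lam : YoungDiagram) (T : Filling) : Filling :=
  ofCols (suc^[lam.card] (toCols lam T))

/-- `Q^{AII}(T)`: the entry of a cell is the number `k ≥ 1` of the step that removes it from the
shape, and `0` if there is no such step. -/
noncomputable def QAII (lam : YoungDiagram) (T : Filling) : Filling := fun i j =>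
  sInf {k | 1 ≤ k ∧ IsCell (suc^[k - 1] (toCols lam T)) i j ∧
    ¬ IsCell (suc^[k] (toCols lam T)) i j}

/-- The quantum Littlewood–Richardson map `T ↦ (P^{AII}(T), Q^{AII}(T))`. -/
noncomputable def LRAII (lam : YoungDiagram) (T : Filling) : Filling × Filling :=
  (PAII lam T, QAII lam T)

/-- The index set `{μ ∈ Par_{≤ n} : μ ⊆ λ}`. -/
def subPar (n : ℕ) (lam : YoungDiagram) : Set YoungDiagram := {mu | mu.colLen 0 ≤ n ∧ mu ≤ lam}

/-- The union of the sets `SpT_{2n}(μ) × Rec_{2n}(λ/μ)` over `μ ∈ Par_{≤ n}`, `μ ⊆ λ`. It is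
disjoint, as the shape `μ` of a tableau is the support of its filling. -/
def LRPairs (n : ℕ) (lam : YoungDiagram) : Set (Filling × Filling) :=
  ⋃ mu ∈ subPar n lam, SpT n mu ×ˢ Rec n lam mu

/-- The inverse of the quantum Littlewood–Richardson map on `SST_{2n}(λ)`. -/
noncomputable def LRAIIInv (n : ℕ) (lam : YoungDiagram) : Filling × Filling → Filling :=
  Function.invFunOn (LRAII lam) (SST n lam)

/-! ### `𝔨`-weights, `𝔨`-highest and `𝔨`-lowest weight tableaux -/

/-- `u_k = 2k - (1 + (-1)^k)/2`. -/
def u (k : ℕ) : ℕ := if Even k then 2 * k - 1 else 2 * k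

/-- `v_k = 2k - (1 + (-1)^(k+1))/2`. -/
def v (k : ℕ) : ℕ := if Even k then 2 * k else 2 * k - 1

/-- The `𝔨`-weight `(T[u₁] - T[v₁], …, T[u_n] - T[v_n])`. -/
def kWeight (n : ℕ) (lam : YoungDiagram) (T : Filling) : Fin n → ℤ := fun k =>
  (content lam T (u (k + 1)) : ℤ) - content lam T (v (k + 1))

/-- A partition as a vector in `ℤ^n`. -/
def parVec (n : ℕ) (mu : YoungDiagram) : Fin n → ℤ := fun k => mu.rowLen k

/-- `S^{H,μ}`: the tableau of shape `μ` whose `k`-th row is filled with `u_k`. -/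
def SH (mu : YoungDiagram) : Filling := fun i j => if (i, j) ∈ mu then u (i + 1) else 0

/-- `S_{L,-μ}`: the tableau of shape `μ` whose `k`-th row is filled with `v_k`. -/
def SL (mu : YoungDiagram) : Filling := fun i j => if (i, j) ∈ mu then v (i + 1) else 0

/-- The `𝔨`-highest weight tableaux of shape `lam`. -/
def SSThw (n : ℕ) (lam : YoungDiagram) : Set Filling :=
  {T | T ∈ SST n lam ∧ ∃ mu : YoungDiagram, mu.colLen 0 ≤ n ∧ PAII lam T = SH mu}

/-- The `𝔨`-lowest weight tableaux of shape `lam`. -/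
def SSTlw (n : ℕ) (lam : YoungDiagram) : Set Filling :=
  {T | T ∈ SST n lam ∧ ∃ mu : YoungDiagram, mu.colLen 0 ≤ n ∧ PAII lam T = SL mu}

end QuantumLR

/-!
A column is encoded by its counting function `y ↦ #{x ≤ y}`, a tableau by the sequence of the
counting functions of its columns. In this encoding one step of the algorithm is given by
max-formulas. Inserting a column `b` into a column `t` gives the column `S` with
`S y = b y + max_{z ≤ y} (t z - b z)` and bumps the column `b + t - S` (`IsBump`, `isBump_insCol`).
The reduction of a column `D` removes pairs `{2y + 1, 2y + 2}`, one for each jump of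
`defect D y = max_{z ≤ y} (D (2z) - z)` (`IsRed`, `isRed_red`). In both cases the running maximum is
a function that increases only where it touches a function computable from the output; such a
function (`IsFloor`) is determined by its last value and can be constructed with any admissible last
value. Hence a step can be undone as soon as the shape of the original tableau is known
(`IsSuc.left_eq`).

The image of a step on the successors is described by shapes alone. Let `β j` and `ε j` be the
columns that enter column `j` in two consecutive steps. Then `β j ≤ ε j` for all `j`: this holds for
`j = 0` by `le_red_of_red_bump`, and passes from `j` to `j + 1` by `le_bumped_iff`. Comparing only
the lengths, it says that `h' j ≤ h (j + 1)`, where `h j` and `h' j` are the numbers of cells in the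
columns `≥ j` of the strips removed by the first and the second of the two steps.
Conversely, if a vertical strip of even size satisfies this lattice condition and a lower bound on
its size, then reverse insertion (`exists_reverse_bump`) yields columns `β j` which lie below `ε j`
by downward induction on `j` (`le_of_bumped_le`), and `β 0 ≤ ε 0` is exactly what is needed to
complete the result by a first column (`exists_red_bump`); this gives `exists_pred`. Therefore the
algorithm is a bijection between tableaux and pairs of a symplectic tableau and a chain of strips
subject to these conditions (`IsStripChain`, `exists_chain`, `eq_of_chain_eq`).

It remains to identify the chains with the recording tableaux. The Yamanouchi condition may be
checked on entire columns (`isYamanouchi_iff`), and then it says that for every `j` the numbers of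
entries `x` in the columns `≥ j` form a partition. The conjugates of these partitions are the sizes
`h k j` of the parts of the strips in the columns `≥ j`. Under this conjugation, the conditions on
a Littlewood–Richardson tableau become the conditions on a chain (`stepFilling_mem_Rec`,
`exists_chain_of_mem_Rec`).

Finally, the `𝔨`-weight only involves the differences of the numbers of entries `2k + 1` and
`2k + 2`. A step removes equally many of both (`IsSuc.total_eq`), so `P^{AII}` preserves the
`𝔨`-weight, and the fibres of `P^{AII}` over `S^{H,μ}` and `S_{L,-μ}` are as described.
-/

namespace QuantumLR

/-! ### Columns as counting functions -/

/-- The counting function `y ↦ #{x ∈ a | x ≤ y}` of a column `a` with entries in `{1, …, N}`. -/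
structure IsCount (N : ℕ) (f : ℕ → ℕ) : Prop where
  zero : f 0 = 0
  le_succ : ∀ y, f y ≤ f (y + 1)
  succ_le : ∀ y, f (y + 1) ≤ f y + 1
  const : ∀ y, N ≤ y → f y = f N

theorem IsCount.monotone {N : ℕ} {f : ℕ → ℕ} (h : IsCount N f) : Monotone f :=
  monotone_nat_of_le_succ h.le_succ

theorem IsCount.le_last {N : ℕ} {f : ℕ → ℕ} (h : IsCount N f) (y : ℕ) : f y ≤ f N := by
  rcases le_total y N with h1 | h1
  · exact h.monotone h1
  · exact (h.const y h1).le

theorem isCount_zero (N : ℕ) : IsCount N 0 :=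
  ⟨rfl, fun _ => le_rfl, fun _ => by simp, fun _ _ => rfl⟩

/-- A monotone function which still increases after `z` is constant from `z` up to some jump. -/
theorem exists_jump {V : ℕ → ℕ} (hV : Monotone V) {z n : ℕ} (hzn : z ≤ n) (h : V z < V n) :
    ∃ y, z ≤ y ∧ y < n ∧ V y = V z ∧ V y < V (y + 1) := by
  induction n with
  | zero => obtain rfl : z = 0 := by omega
            omega
  | succ n ih =>
    have hz : z ≤ n := by
      by_contra hc
      obtain rfl : z = n + 1 := by omega
      omega
    have h1 := hV hz
    rcases h1.lt_or_eq with h2 | h2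
    · obtain ⟨y, a, b, c, d⟩ := ih hz h2
      exact ⟨y, a, by omega, c, d⟩
    · exact ⟨n, hz, by omega, h2.symm, by omega⟩

/-- `V` is a floor of `g` on `{0, …, n}`: it is monotone, lies below `g`, and increases only where
it touches `g`. This is the behaviour of `y ↦ min (r, min_{z ≥ y} g z)`. -/
structure IsFloor (n : ℕ) (g V : ℕ → ℕ) : Prop where
  monotone : Monotone V
  le : ∀ y ≤ n, V y ≤ g y
  eq_of_lt : ∀ y < n, V y < V (y + 1) → V y = g y

theorem IsFloor.le_of_last_eq {n : ℕ} {g V V' : ℕ → ℕ} (h : IsFloor n g V) (h' : IsFloor n g V')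
    (hn : V n = V' n) {y : ℕ} (hy : y ≤ n) : V' y ≤ V y := by
  by_contra hc
  have h1 := h'.monotone hy
  obtain ⟨w, hyw, hwn, hw, hlt⟩ := exists_jump h.monotone hy (by omega)
  have h2 := h.eq_of_lt w hwn hlt
  have h3 := h'.le w hwn.le
  have h4 := h'.monotone hyw
  omega

/-- A floor is determined by its last value. -/
theorem IsFloor.unique {n : ℕ} {g V V' : ℕ → ℕ} (h : IsFloor n g V) (h' : IsFloor n g V')
    (hn : V n = V' n) {y : ℕ} (hy : y ≤ n) : V y = V' y :=
  le_antisymm (h'.le_of_last_eq h hn.symm hy) (h.le_of_last_eq h' hn hy)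

open Classical in
/-- The greedy floor: it increases whenever it may without exceeding `r` or a later value of `g`. -/
noncomputable def floorFun (n r : ℕ) (g : ℕ → ℕ) : ℕ → ℕ
  | 0 => 0
  | y + 1 =>
    if floorFun n r g y < r ∧ ∀ z, y < z → z ≤ n → floorFun n r g y + 1 ≤ g z then
      floorFun n r g y + 1
    else floorFun n r g y

theorem floorFun_succ_le (n r : ℕ) (g : ℕ → ℕ) (y : ℕ) :
    floorFun n r g (y + 1) ≤ floorFun n r g y + 1 := by
  rw [floorFun]; split_ifs <;> omega

theorem floorFun_mono (n r : ℕ) (g : ℕ → ℕ) : Monotone (floorFun n r g) :=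
  monotone_nat_of_le_succ fun y => by
    conv_rhs => rw [floorFun]
    split_ifs <;> omega

theorem floorFun_le_bound (n r : ℕ) (g : ℕ → ℕ) (y : ℕ) : floorFun n r g y ≤ r := by
  induction y with
  | zero => simp [floorFun]
  | succ y ih => rw [floorFun]; split_ifs <;> omega

theorem floorFun_le (n r : ℕ) (g : ℕ → ℕ) (y : ℕ) :
    ∀ z, y ≤ z → z ≤ n → floorFun n r g y ≤ g z := by
  induction y with
  | zero => simp [floorFun]
  | succ y ih =>
    intro z hz hzn
    rw [floorFun]
    split_ifs with h
    · exact h.2 z (by omega) hzn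
    · exact ih z (by omega) hzn

/-- The greedy floor is the largest function below `r` and all later values of `g`. -/
theorem le_floorFun {n r : ℕ} {g : ℕ → ℕ} (g0 : g 0 = 0) (gs : ∀ y < n, g (y + 1) ≤ g y + 1)
    (y : ℕ) (hy : y ≤ n) (m : ℕ) (hm : m ≤ r) (h : ∀ z, y ≤ z → z ≤ n → m ≤ g z) :
    m ≤ floorFun n r g y := by
  induction y generalizing m with
  | zero => have := h 0 le_rfl hy; omega
  | succ y ih =>
    by_contra hc
    have h1 := floorFun_mono n r g (Nat.le_succ y)
    have h2 : floorFun n r g (y + 1) = floorFun n r g y + 1 := by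
      rw [floorFun, if_pos]
      refine ⟨by simp only [Nat.succ_eq_add_one] at h1; omega, fun z hz hzn => ?_⟩
      have := h z hz hzn
      simp only [Nat.succ_eq_add_one] at h1; omega
    have h3 : m - 1 ≤ floorFun n r g y := by
      refine ih (by omega) (m - 1) (by omega) fun z hz hzn => ?_
      rcases hz.lt_or_eq with h4 | h4
      · have := h z h4 hzn; omega
      · subst h4
        have := h (y + 1) le_rfl hy
        have := gs y (by omega)
        omega
    omega

theorem isFloor_floorFun {n r : ℕ} {g : ℕ → ℕ} (g0 : g 0 = 0)
    (gs : ∀ y < n, g (y + 1) ≤ g y + 1) : IsFloor n g (floorFun n r g) := by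
  refine ⟨floorFun_mono n r g, fun y hy => floorFun_le n r g y y le_rfl hy, fun y hy hlt => ?_⟩
  by_contra hc
  have h1 := floorFun_succ_le n r g y
  have h2 := floorFun_le n r g y y le_rfl hy.le
  have h3 : floorFun n r g y + 1 ≤ floorFun n r g y := by
    refine le_floorFun g0 gs y hy.le _ ?_ fun z hz hzn => ?_
    · have := floorFun_le_bound n r g (y + 1); omega
    · rcases hz.lt_or_eq with h4 | h4
      · have := floorFun_le n r g (y + 1) z h4 hzn; omega
      · subst h4; omega
  omega

theorem floorFun_last {n r : ℕ} {g : ℕ → ℕ} (g0 : g 0 = 0)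
    (gs : ∀ y < n, g (y + 1) ≤ g y + 1) (hr : r ≤ g n) {y : ℕ} (hy : n ≤ y) :
    floorFun n r g y = r := by
  have h1 : r ≤ floorFun n r g n := by
    refine le_floorFun g0 gs n le_rfl r le_rfl fun z hz hzn => ?_
    obtain rfl : z = n := by omega
    exact hr
  have h2 := floorFun_mono n r g hy
  have h3 := floorFun_le_bound n r g y
  omega

/-! ### Insertion of a column into a column -/

/-- The column insertion of a column `b` into a column `t` gives the column `S` and bumps the column
`b'`, all columns being given by their counting functions. In other words,
`S y = b y + max_{z ≤ y} (t z - b z)` and `S + b' = b + t`. -/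
structure IsBump (b t S b' : ℕ → ℕ) : Prop where
  sum : ∀ y, S y + b' y = b y + t y
  ge : ∀ z y, z ≤ y → b y + t z ≤ S y + b z
  attain : ∀ y, ∃ z ≤ y, S y + b z = b y + t z

namespace IsBump

variable {N : ℕ} {b t S b' : ℕ → ℕ}

theorem le_left (h : IsBump b t S b') (hb : IsCount N b) (ht : IsCount N t) (y : ℕ) :
    b y ≤ S y := by
  have := h.ge 0 y (Nat.zero_le y)
  rw [hb.zero, ht.zero] at this
  omega

theorem le_right (h : IsBump b t S b') (y : ℕ) : t y ≤ S y := by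
  have := h.ge y y le_rfl
  omega

theorem bumped_le (h : IsBump b t S b') (y : ℕ) : b' y ≤ b y := by
  have := h.le_right y
  have := h.sum y
  omega

theorem diff_le (h : IsBump b t S b') {x y : ℕ} (hxy : x ≤ y) : S x + b y ≤ S y + b x := by
  obtain ⟨z, hz, e⟩ := h.attain x
  have := h.ge z y (hz.trans hxy)
  omega

theorem isCount_fst (h : IsBump b t S b') (hb : IsCount N b) (ht : IsCount N t) :
    IsCount N S where
  zero := by
    obtain ⟨z, hz, e⟩ := h.attain 0
    obtain rfl : z = 0 := by omega
    have := hb.zero; have := ht.zero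
    omega
  le_succ y := by
    have := h.diff_le (Nat.le_succ y)
    have := hb.le_succ y
    simp only [Nat.succ_eq_add_one] at *
    omega
  succ_le y := by
    obtain ⟨z, hz, e⟩ := h.attain (y + 1)
    rcases Nat.lt_or_ge z (y + 1) with h1 | h1
    · have := h.ge z y (by omega)
      have := hb.succ_le y
      omega
    · obtain rfl : z = y + 1 := by omega
      have := h.le_right y
      have := ht.succ_le y
      omega
  const y hy := by
    have h1 := h.diff_le hy
    have h2 := hb.const y hy
    obtain ⟨z, hz, e⟩ := h.attain y
    rcases le_total z N with h3 | h3
    · have := h.ge z N h3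
      omega
    · have := h.ge N N le_rfl
      have := hb.const z h3
      have := ht.const z h3
      omega

/-- Where the maximum `S - b` increases, it is attained at the last argument. -/
theorem bumped_eq_of_jump (h : IsBump b t S b') (hb : IsCount N b) (ht : IsCount N t) {y : ℕ}
    (hy : S y + b (y + 1) < S (y + 1) + b y) : b' y = b y := by
  obtain ⟨z, hz, e⟩ := h.attain (y + 1)
  rcases Nat.lt_or_ge z (y + 1) with h3 | h3
  · have := h.ge z y (by omega)
    omega
  · obtain rfl : z = y + 1 := by omega
    have := h.le_right y
    have := ht.succ_le y
    have := hb.le_succ y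
    have := h.sum y
    omega

/-- The function `S - b = max_{z ≤ y} (t z - b z)` is a floor of `S - b'`, so it can be recovered
from `S`, `b'` and its last value. No subtraction is truncated, as `b'` and `b` lie below `S`. -/
theorem isFloor (h : IsBump b t S b') (hb : IsCount N b) (ht : IsCount N t) (n : ℕ) :
    IsFloor n (fun y => S y - b' y) (fun y => S y - b y) where
  monotone := fun x y hxy => by
    have := h.diff_le hxy
    have := h.le_left hb ht x
    have := h.le_left hb ht y
    change S x - b x ≤ S y - b y
    omega
  le y _ := by
    have := h.bumped_le y
    omega
  eq_of_lt y _ hlt := by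
    have := h.le_left hb ht y
    have := h.le_left hb ht (y + 1)
    have := h.bumped_eq_of_jump hb ht (y := y) (by omega)
    simp only [this]

theorem fst_eq {S₂ b₂ : ℕ → ℕ} (h : IsBump b t S b') (h₂ : IsBump b t S₂ b₂) : S = S₂ := by
  funext y
  obtain ⟨z, hz, e⟩ := h.attain y
  obtain ⟨z₂, hz₂, e₂⟩ := h₂.attain y
  have := h.ge z₂ y hz₂
  have := h₂.ge z y hz
  omega

theorem snd_eq {S₂ b₂ : ℕ → ℕ} (h : IsBump b t S b') (h₂ : IsBump b t S₂ b₂) : b' = b₂ := by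
  funext y
  have := congrFun (h.fst_eq h₂) y
  have := h.sum y
  have := h₂.sum y
  omega

/-- Column insertion is invertible once the length of the inserted column is known. -/
theorem left_eq {b₂ t₂ : ℕ → ℕ} (h : IsBump b t S b') (h₂ : IsBump b₂ t₂ S b')
    (hb : IsCount N b) (ht : IsCount N t) (hb₂ : IsCount N b₂) (ht₂ : IsCount N t₂)
    (hN : b N = b₂ N) : b = b₂ := by
  have key : ∀ y ≤ N, b y = b₂ y := fun y hy => by
    have := (h.isFloor hb ht N).unique (h₂.isFloor hb₂ ht₂ N) (by simp [hN]) hy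
    have := h.le_left hb ht y
    have := h₂.le_left hb₂ ht₂ y
    omega
  funext y
  rcases le_total y N with hy | hy
  · exact key y hy
  · rw [hb.const y hy, hb₂.const y hy, hN]

theorem right_eq {t₂ : ℕ → ℕ} (h : IsBump b t S b') (h₂ : IsBump b t₂ S b') : t = t₂ := by
  funext y
  have := h.sum y
  have := h₂.sum y
  omega

end IsBump

/-- Reverse column insertion: `S` and `b'` are split up again, with a column `b` of prescribed
length. The last clause says that `S - b`, and hence `t`, is as large as possible. -/
theorem exists_reverse_bump {N : ℕ} {S b' : ℕ → ℕ} (hS : IsCount N S) (hb' : IsCount N b')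
    (hle : ∀ y, b' y ≤ S y) {k : ℕ} (hk : b' N ≤ k) (hkS : k ≤ S N) :
    ∃ b t, IsCount N b ∧ IsCount N t ∧ IsBump b t S b' ∧ b N = k ∧
      ∀ y ≤ N, ∀ m, m + k ≤ S N → (∀ z, y ≤ z → z ≤ N → m + b' z ≤ S z) → m + b y ≤ S y := by
  -- The floor `V` of `S - b'` becomes `S - b = t - b'`.
  set g : ℕ → ℕ := fun y => S y - b' y with hg
  have g0 : g 0 = 0 := by simp [hg, hS.zero]
  have gs : ∀ y < N, g (y + 1) ≤ g y + 1 := fun y _ => by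
    have := hS.succ_le y; have := hb'.le_succ y; have := hle y
    simp only [hg]; omega
  have hF := isFloor_floorFun (r := S N - k) g0 gs
  have hlast : ∀ y, N ≤ y → floorFun N (S N - k) g y = S N - k :=
    fun y hy => floorFun_last g0 gs (by simp only [hg]; omega) hy
  have hmax := fun y hy m hm h => le_floorFun (r := S N - k) g0 gs y hy m hm h
  have hs := floorFun_succ_le N (S N - k) g
  have hV0 : floorFun N (S N - k) g 0 = 0 := rfl
  set V := floorFun N (S N - k) g with hV
  have hVm : ∀ y, V y ≤ V (y + 1) := fun y => hF.monotone (Nat.le_succ y)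
  have hVg : ∀ y, V y + b' y ≤ S y := fun y => by
    rcases le_total y N with hy | hy
    · have : V y ≤ S y - b' y := hF.le y hy; have := hle y
      omega
    · have := hlast y hy; have := hb'.const y hy; have := hS.const y hy
      omega
  have hjump : ∀ y, V y < V (y + 1) →
      V y + b' y = S y ∧ S (y + 1) = S y + 1 ∧ b' (y + 1) = b' y := fun y hlt => by
    rcases lt_or_ge y N with hy | hy
    · have h1 := hF.eq_of_lt y hy hlt
      have h2 := hVg (y + 1)
      have := hle y; have := hS.succ_le y; have := hb'.le_succ y; have := hs y
      simp only [hg] at h1; omega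
    · have := hlast y hy; have := hlast (y + 1) (by omega)
      omega
  refine ⟨fun y => S y - V y, fun y => b' y + V y, ⟨?_, ?_, ?_, ?_⟩, ⟨?_, ?_, ?_, ?_⟩,
    ⟨?_, ?_, ?_⟩, ?_, ?_⟩
  · simp [hS.zero]
  · intro y
    have := hVg y; have := hVg (y + 1); have := hS.le_succ y; have := hs y
    by_cases hlt : V y < V (y + 1)
    · have := hjump y hlt; omega
    · omega
  · intro y
    have := hVg y; have := hS.succ_le y; have := hVm y
    omega
  · intro y hy
    simp only [hlast y hy, hlast N le_rfl, hS.const y hy]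
  · simp [hV0, hb'.zero]
  · intro y; have := hb'.le_succ y; have := hVm y; omega
  · intro y
    have := hb'.succ_le y; have := hs y
    by_cases hlt : V y < V (y + 1)
    · have := hjump y hlt; omega
    · omega
  · intro y hy
    simp only [hlast y hy, hlast N le_rfl, hb'.const y hy]
  · intro y; have := hVg y; omega
  · intro z y hzy
    have := hVg y; have := hVg z; have := hF.monotone hzy
    omega
  · intro y
    induction y with
    | zero => exact ⟨0, le_rfl, by simp [hV0, hS.zero, hb'.zero]⟩
    | succ y ih =>
      by_cases hlt : V y < V (y + 1)
      · have h1 := hjump y hlt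
        have := hs y
        refine ⟨y + 1, le_rfl, ?_⟩
        have := hVg (y + 1)
        omega
      · obtain ⟨z, hz, e⟩ := ih
        have := hVg y; have := hVg z; have := hVg (y + 1); have := hVm y
        refine ⟨z, by omega, ?_⟩
        omega
  · simp only [hlast N le_rfl]; omega
  · intro y hy m hm h
    have := hmax y hy m (by omega) (fun z hz hzN => by
      have := h z hz hzN; simp only [hg]; omega)
    have := hVg y
    change m + (S y - V y) ≤ S y
    omega

/-- If `b` is inserted with result `S`, and then `E` is inserted into `S` and bumps `e`, then `b`
lies below `E` if and only if it lies below `e`. -/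
theorem le_bumped_iff {b t S b' E U e : ℕ → ℕ} (h : IsBump b t S b') (h₂ : IsBump E S U e) :
    (∀ y, b y ≤ E y) ↔ ∀ y, b y ≤ e y := by
  constructor
  · intro hE y
    obtain ⟨z, hz, e1⟩ := h₂.attain y
    have := h₂.sum y
    have := h.diff_le hz
    have := hE z
    omega
  · intro he y
    exact (he y).trans (h₂.bumped_le y)

/-- To compare the inserted column `b` with a subcolumn `E` of the resulting column `S`, it suffices
to compare their lengths and to compare the bumped column with `E`. -/
theorem le_of_bumped_le {N : ℕ} {b t S b' E : ℕ → ℕ} (hb : IsCount N b) (ht : IsCount N t)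
    (hE : IsCount N E) (h : IsBump b t S b') (hK : ∀ x y, x ≤ y → S x + E y ≤ S y + E x)
    (hN : b N ≤ E N) (hb' : ∀ y, b' y ≤ E y) (y : ℕ) : b y ≤ E y := by
  have key : ∀ y ≤ N, b y ≤ E y := fun z hz => by
    have hF := h.isFloor hb ht N
    have h0 := hF.monotone hz
    have l1 := h.le_left hb ht z
    have l2 := h.le_left hb ht N
    rcases h0.lt_or_eq with h1 | h1
    · obtain ⟨y, hzy, hyN, hy, hlt⟩ := exists_jump hF.monotone hz h1
      have l3 := h.le_left hb ht y
      have l4 := h.le_left hb ht (y + 1)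
      have h5 := h.bumped_eq_of_jump hb ht (y := y) (by omega)
      have := hK z y hzy
      have := hb' y
      omega
    · have := hK z N hz
      omega
  rcases le_total y N with hy | hy
  · exact key y hy
  · rw [hb.const y hy, hE.const y hy]; exact hN

/-! ### The reduction of a column -/

/-- `defect D y = max_{0 ≤ z ≤ y} (D (2z) - z)`: half the number of removable entries `≤ 2y` of the
column with counting function `D`. -/
def defect (D : ℕ → ℕ) : ℕ → ℕ
  | 0 => 0
  | y + 1 => max (defect D y) (D (2 * (y + 1)) - (y + 1))

/-- `e` is the counting function of the reduction of the column with counting function `D`: the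
removable entries come in pairs `{2y + 1, 2y + 2}`, one for each jump of the defect. -/
def IsRed (D e : ℕ → ℕ) : Prop :=
  ∀ y, e (2 * y) + 2 * defect D y = D (2 * y) ∧
    e (2 * y + 1) + defect D y + defect D (y + 1) = D (2 * y + 1)

theorem defect_monotone (D : ℕ → ℕ) : Monotone (defect D) :=
  monotone_nat_of_le_succ fun y => by rw [defect]; exact le_max_left _ _

theorem le_defect_of_zero {D : ℕ → ℕ} (h0 : D 0 = 0) (y : ℕ) :
    D (2 * y) ≤ y + defect D y := by
  cases y with
  | zero => simp [h0]
  | succ y => rw [defect]; omega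

theorem le_defect {N : ℕ} {D : ℕ → ℕ} (hD : IsCount N D) (y : ℕ) :
    D (2 * y) ≤ y + defect D y :=
  le_defect_of_zero hD.zero y

theorem defect_succ_le {N : ℕ} {D : ℕ → ℕ} (hD : IsCount N D) (y : ℕ) :
    defect D (y + 1) ≤ defect D y + 1 := by
  have h1 := le_defect hD y
  have h2 := hD.succ_le (2 * y)
  have h3 := hD.succ_le (2 * y + 1)
  rw [defect]
  rw [show 2 * (y + 1) = 2 * y + 1 + 1 by ring]
  omega

theorem defect_jump {N : ℕ} {D : ℕ → ℕ} (hD : IsCount N D) {y : ℕ}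
    (h : defect D y < defect D (y + 1)) :
    D (2 * y) = y + defect D y ∧ D (2 * y + 1) = D (2 * y) + 1 ∧
      D (2 * y + 2) = D (2 * y) + 2 ∧ defect D (y + 1) = defect D y + 1 := by
  have h1 := le_defect hD y
  have h2 := hD.succ_le (2 * y)
  have h3 := hD.succ_le (2 * y + 1)
  have h4 := defect_succ_le hD y
  have h5 : defect D (y + 1) = max (defect D y) (D (2 * y + 1 + 1) - (y + 1)) := rfl
  have h6 : D (2 * y + 2) = D (2 * y + 1 + 1) := rfl
  omega

theorem defect_const {n : ℕ} {D : ℕ → ℕ} (hD : IsCount (2 * n) D) {y : ℕ} (hy : n ≤ y) :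
    defect D y = defect D n := by
  induction y, hy using Nat.le_induction with
  | base => rfl
  | succ y hy ih =>
    by_contra hc
    have h0 := defect_monotone D (Nat.le_succ y)
    have h1 := defect_jump hD (y := y) (by simp only [Nat.succ_eq_add_one] at h0; omega)
    have h2 := hD.const (2 * y) (by omega)
    have h3 := hD.const (2 * y + 1) (by omega)
    omega

namespace IsRed

variable {n : ℕ} {D e : ℕ → ℕ}

theorem even_le (h : IsRed D e) (hD : IsCount (2 * n) D) (y : ℕ) : e (2 * y) + defect D y ≤ y := by
  have := (h y).1
  have := le_defect hD y
  omega

theorem isCount (h : IsRed D e) (hD : IsCount (2 * n) D) : IsCount (2 * n) e := by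
  have key : ∀ y, e (2 * y) ≤ e (2 * y + 1) ∧ e (2 * y + 1) ≤ e (2 * y) + 1 ∧
      e (2 * y + 1) ≤ e (2 * y + 1 + 1) ∧ e (2 * y + 1 + 1) ≤ e (2 * y + 1) + 1 := fun y => by
    obtain ⟨h1, h2⟩ := h y
    obtain ⟨h3, -⟩ := h (y + 1)
    rw [show 2 * (y + 1) = 2 * y + 1 + 1 by ring] at h3
    have m := defect_monotone D (Nat.le_succ y)
    have a1 := hD.le_succ (2 * y)
    have a2 := hD.le_succ (2 * y + 1)
    have a3 := hD.succ_le (2 * y)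
    have a4 := hD.succ_le (2 * y + 1)
    simp only [Nat.succ_eq_add_one] at m
    by_cases hlt : defect D y < defect D (y + 1)
    · have := defect_jump hD hlt
      have h6 : D (2 * y + 2) = D (2 * y + 1 + 1) := rfl
      omega
    · omega
  refine ⟨?_, ?_, ?_, ?_⟩
  · have := (h 0).1
    simp only [Nat.mul_zero, hD.zero] at this
    omega
  · intro y
    obtain ⟨k, rfl | rfl⟩ := Nat.even_or_odd' y
    · exact (key k).1
    · exact (key k).2.2.1
  · intro y
    obtain ⟨k, rfl | rfl⟩ := Nat.even_or_odd' y
    · exact (key k).2.1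
    · exact (key k).2.2.2
  · intro y hy
    have hn := (h n).1
    obtain ⟨k, rfl | rfl⟩ := Nat.even_or_odd' y
    · have h1 := (h k).1
      rw [defect_const hD (y := k) (by omega), hD.const _ hy] at h1
      omega
    · have h1 := (h k).2
      rw [defect_const hD (y := k) (by omega), defect_const hD (y := k + 1) (by omega),
        hD.const _ hy] at h1
      omega

theorem diff_le (h : IsRed D e) {x y : ℕ} (hxy : x ≤ y) : D x + e y ≤ D y + e x := by
  have m := defect_monotone D
  obtain ⟨k, rfl | rfl⟩ := Nat.even_or_odd' x <;> obtain ⟨l, rfl | rfl⟩ := Nat.even_or_odd' y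
  · have := (h k).1; have := (h l).1; have := m (show k ≤ l by omega); omega
  · have := (h k).1; have := (h l).2; have := m (show k ≤ l by omega)
    have := m (show k ≤ l + 1 by omega); omega
  · have := (h k).2; have := (h l).1; have := m (show k ≤ l by omega)
    have := m (show k + 1 ≤ l by omega); omega
  · have := (h k).2; have := (h l).2; have := m (show k ≤ l by omega)
    have := m (show k + 1 ≤ l + 1 by omega); omega

theorem le (h : IsRed D e) (y : ℕ) : e y ≤ D y := by
  obtain ⟨k, rfl | rfl⟩ := Nat.even_or_odd' y
  · have := (h k).1; omega
  · have := (h k).2; omega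

theorem unique {e₂ : ℕ → ℕ} (h : IsRed D e) (h₂ : IsRed D e₂) : e = e₂ := by
  funext y
  obtain ⟨k, rfl | rfl⟩ := Nat.even_or_odd' y
  · have := (h k).1; have := (h₂ k).1; omega
  · have := (h k).2; have := (h₂ k).2; omega

/-- The defect of `D` can be recovered from the reduction `e` and its last value. -/
theorem isFloor (h : IsRed D e) (hD : IsCount (2 * n) D) :
    IsFloor n (fun y => y - e (2 * y)) (defect D) where
  monotone := defect_monotone D
  le y _ := by have := h.even_le hD y; omega
  eq_of_lt y _ hlt := by
    have h1 := defect_jump hD hlt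
    have h2 := (h y).1
    have h3 := (h (y + 1)).1
    have h4 := h.even_le hD (y + 1)
    have h5 := (h.isCount hD).le_succ (2 * y)
    have h6 := (h.isCount hD).le_succ (2 * y + 1)
    rw [show 2 * (y + 1) = 2 * y + 2 by ring] at *
    omega

/-- A column is determined by its reduction and its length. -/
theorem left_eq {D₂ : ℕ → ℕ} (h : IsRed D e) (h₂ : IsRed D₂ e) (hD : IsCount (2 * n) D)
    (hD₂ : IsCount (2 * n) D₂) (hN : D (2 * n) = D₂ (2 * n)) : D = D₂ := by
  have hl : defect D n = defect D₂ n := by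
    have := (h n).1; have := (h₂ n).1; omega
  have key : ∀ y, defect D y = defect D₂ y := fun y => by
    rcases le_total y n with hy | hy
    · exact (h.isFloor hD).unique (h₂.isFloor hD₂) hl hy
    · rw [defect_const hD hy, defect_const hD₂ hy, hl]
  funext y
  obtain ⟨k, rfl | rfl⟩ := Nat.even_or_odd' y
  · have := (h k).1; have := (h₂ k).1; have := key k; omega
  · have := (h k).2; have := (h₂ k).2; have := key k; have := key (k + 1); omega

end IsRed

/-- Every symplectic column is the reduction of a column with `2r` additional entries, as long as
`r` is not too large. The last clause says that the additional entries are as small as possible. -/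
theorem exists_reverse_red {n : ℕ} {b : ℕ → ℕ} (hb : IsCount (2 * n) b)
    (hsp : ∀ y, b (2 * y) ≤ y) {r : ℕ} (hr : b (2 * n) + r ≤ n) :
    ∃ D, IsCount (2 * n) D ∧ IsRed D b ∧ D (2 * n) = b (2 * n) + 2 * r ∧
      ∀ y ≤ n, ∀ m ≤ r, (∀ z, y ≤ z → z ≤ n → m + b (2 * z) ≤ z) →
        b (2 * y) + 2 * m ≤ D (2 * y) := by
  -- The floor `V` of `y - b (2y)` becomes the defect of `D`.
  set g : ℕ → ℕ := fun y => y - b (2 * y) with hg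
  have g0 : g 0 = 0 := by simp [hg]
  have b1 : ∀ y, b (2 * y) ≤ b (2 * y + 1) := fun y => hb.le_succ _
  have b2 : ∀ y, b (2 * y + 1) ≤ b (2 * (y + 1)) := fun y => hb.le_succ _
  have gs : ∀ y < n, g (y + 1) ≤ g y + 1 := fun y _ => by
    have := b1 y; have := b2 y; have := hsp y; have := hsp (y + 1)
    simp only [hg]; omega
  have hF := isFloor_floorFun (r := r) g0 gs
  have hlast : ∀ y, n ≤ y → floorFun n r g y = r :=
    fun y hy => floorFun_last g0 gs (by simp only [hg]; omega) hy
  have hmax := fun y hy m hm h => le_floorFun (r := r) g0 gs y hy m hm h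
  have hs := floorFun_succ_le n r g
  have hV0 : floorFun n r g 0 = 0 := rfl
  set V := floorFun n r g with hV
  have hVm : ∀ y, V y ≤ V (y + 1) := fun y => hF.monotone (Nat.le_succ y)
  have hVg : ∀ y, V y + b (2 * y) ≤ y := fun y => by
    rcases le_total y n with hy | hy
    · have : V y ≤ y - b (2 * y) := hF.le y hy; have := hsp y
      omega
    · have := hlast y hy; have := hb.const (2 * y) (by omega)
      omega
  have hjump : ∀ y, V y < V (y + 1) →
      V y + b (2 * y) = y ∧ b (2 * (y + 1)) = b (2 * y) ∧ b (2 * y + 1) = b (2 * y) :=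
    fun y hlt => by
      rcases lt_or_ge y n with hy | hy
      · have h1 := hF.eq_of_lt y hy hlt
        have h2 := hVg (y + 1)
        have := hsp y; have := b1 y; have := b2 y
        simp only [hg] at h1; omega
      · have := hlast y hy; have := hlast (y + 1) (by omega)
        omega
  set D : ℕ → ℕ := fun y => b y + V (y / 2) + V ((y + 1) / 2) with hD
  have D0 : ∀ y, D (2 * y) = b (2 * y) + 2 * V y := fun y => by
    simp only [hD]
    rw [show 2 * y / 2 = y by omega, show (2 * y + 1) / 2 = y by omega]; ring
  have D1 : ∀ y, D (2 * y + 1) = b (2 * y + 1) + V y + V (y + 1) := fun y => by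
    simp only [hD]
    rw [show (2 * y + 1) / 2 = y by omega, show (2 * y + 1 + 1) / 2 = y + 1 by omega]
  have hdef : ∀ y, defect D y = V y := fun y => by
    induction y with
    | zero => rfl
    | succ y ih =>
      rw [defect, ih, D0]
      have := hVg (y + 1); have := hVm y; have := hs y
      by_cases hlt : V y < V (y + 1)
      · have := hjump y hlt; omega
      · omega
  refine ⟨D, ⟨?_, ?_, ?_, ?_⟩, ?_, ?_, ?_⟩
  · have := D0 0; simpa [hb.zero, hV0] using this
  · intro y
    obtain ⟨k, rfl | rfl⟩ := Nat.even_or_odd' y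
    · rw [D0, D1]; have := b1 k; have := hVm k; omega
    · rw [show 2 * k + 1 + 1 = 2 * (k + 1) by ring, D0, D1]
      have := b2 k; have := hVm k; omega
  · intro y
    obtain ⟨k, rfl | rfl⟩ := Nat.even_or_odd' y
    · rw [D0, D1]; have := hb.succ_le (2 * k); have := hs k
      by_cases hlt : V k < V (k + 1)
      · have := hjump k hlt; omega
      · omega
    · rw [show 2 * k + 1 + 1 = 2 * (k + 1) by ring, D0, D1]
      have h2 := hb.succ_le (2 * k + 1); have := hs k
      rw [show 2 * k + 1 + 1 = 2 * (k + 1) by ring] at h2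
      by_cases hlt : V k < V (k + 1)
      · have := hjump k hlt; omega
      · omega
  · intro y hy
    rw [D0 n]
    simp only [hD]
    rw [hb.const y hy, hlast (y / 2) (by omega), hlast ((y + 1) / 2) (by omega),
      hlast n le_rfl]; ring
  · intro y
    rw [hdef, hdef, D0, D1]
    exact ⟨rfl, rfl⟩
  · rw [D0, hlast n le_rfl]
  · intro y hy m hm h
    have := hmax y hy m hm fun z hz hzn => by
      have := h z hz hzn; simp only [hg]; omega
    rw [D0]; omega

/-- If a two-column tableau `C₀ | C₁` is turned into the column `D` by reducing `C₀` to `b` and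
inserting `b` into `C₁`, then `D` lies below `C₀`, and the reduction of `D` lies above `b`. -/
theorem le_red_of_red_bump {n : ℕ} {C₀ C₁ b D b' e : ℕ → ℕ} (hC₀ : IsCount (2 * n) C₀)
    (hC₁ : IsCount (2 * n) C₁) (hle : ∀ y, C₁ y ≤ C₀ y) (hb : IsRed C₀ b)
    (hD : IsBump b C₁ D b') (he : IsRed D e) : (∀ y, D y ≤ C₀ y) ∧ ∀ y, b y ≤ e y := by
  have hbc := hb.isCount hC₀
  have hDc := hD.isCount_fst hbc hC₁
  have h1 : ∀ y, D y ≤ C₀ y := fun y => by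
    obtain ⟨z, hz, e1⟩ := hD.attain y
    have := hb.diff_le hz
    have := hle z
    omega
  -- This follows from `D (2y) + b (2y) ≤ C₀ (2y) + b (2y) ≤ 2y`, as `D - b` is monotone.
  have h2 : ∀ y, 2 * defect D y + b (2 * y) ≤ D (2 * y) := fun y => by
    induction y with
    | zero => simp [defect, hbc.zero]
    | succ y ih =>
      have a1 := hD.diff_le (show 2 * y ≤ 2 * (y + 1) by omega)
      have a2 := (hb (y + 1)).1
      have a3 := hb.even_le hC₀ (y + 1)
      have a4 := h1 (2 * (y + 1))
      have a5 := hD.le_left hbc hC₁ (2 * (y + 1))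
      rw [defect]
      omega
  refine ⟨h1, fun y => ?_⟩
  obtain ⟨k, rfl | rfl⟩ := Nat.even_or_odd' y
  · have := h2 k; have := (he k).1; omega
  · have a1 := (he k).2
    have a2 := h2 k
    have a3 := h2 (k + 1)
    have a4 := defect_monotone D (Nat.le_succ k)
    have a5 := hD.diff_le (show 2 * k ≤ 2 * k + 1 by omega)
    have a6 := hbc.le_succ (2 * k + 1)
    have a7 := (he k).1
    simp only [Nat.succ_eq_add_one, show 2 * (k + 1) = 2 * k + 1 + 1 by ring] at *
    by_cases hlt : defect D k < defect D (k + 1)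
    · have := defect_jump hDc hlt
      simp only [show 2 * k + 2 = 2 * k + 1 + 1 by ring] at *
      omega
    · omega

/-- The converse of `le_red_of_red_bump`. -/
theorem exists_red_bump {n : ℕ} {b t D b' e : ℕ → ℕ} (hb : IsCount (2 * n) b)
    (ht : IsCount (2 * n) t) (hD : IsBump b t D b') (he : IsRed D e) (hbe : ∀ y, b y ≤ e y)
    {r : ℕ} (hr : b (2 * n) + r ≤ n) (hDr : D (2 * n) ≤ b (2 * n) + 2 * r) :
    ∃ C, IsCount (2 * n) C ∧ IsRed C b ∧ C (2 * n) = b (2 * n) + 2 * r ∧ ∀ y, t y ≤ C y := by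
  have hDc := hD.isCount_fst hb ht
  have hbD := hD.le_left hb ht
  have hM : ∀ y, D (2 * y) + b (2 * y) ≤ 2 * y := fun y => by
    have := (he y).1; have := hbe (2 * y); have := le_defect hDc y
    omega
  have hsp : ∀ y, b (2 * y) ≤ y := fun y => by
    have := hM y; have := hbD (2 * y); omega
  obtain ⟨C, hC, hCb, hCn, hmax⟩ := exists_reverse_red hb hsp hr
  refine ⟨C, hC, hCb, hCn, ?_⟩
  have hCbd : ∀ y, b y ≤ C y := hCb.le
  -- The maximality of `C` is applied to half of `D - b`, rounded up.
  have heven : ∀ y ≤ n, D (2 * y) + (D (2 * y) - b (2 * y)) % 2 ≤ C (2 * y) := fun y hy => by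
    have := hmax y hy ((D (2 * y) - b (2 * y) + 1) / 2) (by
        have := hD.diff_le (show 2 * y ≤ 2 * n by omega)
        have := hbD (2 * y)
        omega) (fun z hz hzn => by
        have := hD.diff_le (show 2 * y ≤ 2 * z by omega)
        have := hbD (2 * y)
        have := hM z
        omega)
    have := hbD (2 * y)
    omega
  have key : ∀ y ≤ 2 * n, t y ≤ C y := fun y hy => by
    have hty := hD.le_right y
    obtain ⟨k, rfl | rfl⟩ := Nat.even_or_odd' y
    · have := heven k (by omega); omega
    · have a1 := heven k (by omega)
      have a2 := heven (k + 1) (by omega)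
      have a3 := hCb k
      have a4 := hCb (k + 1)
      have a5 := defect_monotone C (Nat.le_succ k)
      have a6 := hDc.succ_le (2 * k)
      have a7 := hD.diff_le (show 2 * k + 1 ≤ 2 * (k + 1) by omega)
      have a8 := hbD (2 * k + 1)
      have a9 := hb.le_succ (2 * k)
      have a10 := hD.diff_le (show 2 * k ≤ 2 * k + 1 by omega)
      simp only [Nat.succ_eq_add_one] at *
      by_cases hlt : defect C k < defect C (k + 1)
      · have := defect_jump hC hlt
        have := hb.le_succ (2 * k + 1)
        simp only [show 2 * (k + 1) = 2 * k + 1 + 1 by ring] at *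
        omega
      · omega
  intro y
  rcases le_total y (2 * n) with hy | hy
  · exact key y hy
  · rw [ht.const y hy, hC.const y hy]; exact key _ le_rfl

/-! ### Insertion of a column into a tableau -/

/-- A semistandard tableau with entries in `{1, …, N}`, given by the counting functions of its
columns: `C j y` is the number of entries `≤ y` in column `j`. Row-weakness means that these numbers
decrease with `j`. -/
structure IsTableau (N : ℕ) (C : ℕ → ℕ → ℕ) : Prop where
  count : ∀ j, IsCount N (C j)
  anti : ∀ j y, C (j + 1) y ≤ C j y
  fin : ∃ m, ∀ j ≥ m, C j = 0

/-- The product of the column `β 0` with the columns `C` is `S`; here `β (j + 1)` is the column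
bumped from column `j` to column `j + 1`. -/
structure IsMul (N : ℕ) (β C S : ℕ → ℕ → ℕ) : Prop where
  count : ∀ j, IsCount N (β j)
  bump : ∀ j, IsBump (β j) (C j) (S j) (β (j + 1))
  fin : ∃ m, ∀ j ≥ m, β j = 0

/-- `S` is the successor of `C`, and `β j` is the column that enters column `j` of `S` when the
reduction `β 0` of the first column of `C` is multiplied with the other columns. -/
structure IsSuc (n : ℕ) (C S β : ℕ → ℕ → ℕ) : Prop where
  red : IsRed (C 0) (β 0)
  mul : IsMul (2 * n) β (fun j => C (j + 1)) S

namespace IsSuc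

variable {n : ℕ} {C S β U ε : ℕ → ℕ → ℕ}

theorem isTableau (h : IsSuc n C S β) (hC : IsTableau (2 * n) C) : IsTableau (2 * n) S where
  count j := (h.mul.bump j).isCount_fst (h.mul.count j) (hC.count (j + 1))
  anti j y := by
    obtain ⟨z, hz, e⟩ := (h.mul.bump (j + 1)).attain y
    have := hC.anti (j + 1) z
    have := (h.mul.bump j).sum z
    have := (h.mul.bump j).diff_le hz
    have := (h.mul.bump j).bumped_le y
    omega
  fin := by
    obtain ⟨m₁, h₁⟩ := h.mul.fin
    obtain ⟨m₂, h₂⟩ := hC.fin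
    refine ⟨max m₁ m₂, fun j hj => ?_⟩
    funext y
    obtain ⟨z, hz, e⟩ := (h.mul.bump j).attain y
    rw [h₁ j (by omega), h₂ (j + 1) (by omega)] at e
    simpa using e

/-- The successor is contained in the original tableau. -/
theorem le (h : IsSuc n C S β) (hC : IsTableau (2 * n) C) (j y : ℕ) : S j y ≤ C j y := by
  cases j with
  | zero =>
    obtain ⟨z, hz, e⟩ := (h.mul.bump 0).attain y
    have := h.red.diff_le hz
    have := hC.anti 0 z
    omega
  | succ j =>
    obtain ⟨z, hz, e⟩ := (h.mul.bump (j + 1)).attain y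
    have := hC.anti (j + 1) z
    have := (h.mul.bump j).sum z
    have := (h.mul.bump j).sum y
    have := (h.mul.bump j).diff_le hz
    omega

theorem succ_le (h : IsSuc n C S β) (j y : ℕ) : C (j + 1) y ≤ S j y :=
  (h.mul.bump j).le_right y

theorem unique {S₂ β₂ : ℕ → ℕ → ℕ} (h : IsSuc n C S β) (h₂ : IsSuc n C S₂ β₂) : S = S₂ := by
  have hβ : ∀ j, β j = β₂ j := fun j => by
    induction j with
    | zero => exact h.red.unique h₂.red
    | succ j ih =>
      have a := h.mul.bump j
      rw [ih] at a
      exact a.snd_eq (h₂.mul.bump j)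
  funext j
  have a := h.mul.bump j
  rw [hβ j] at a
  exact a.fst_eq (h₂.mul.bump j)

/-- A tableau is determined by its successor and its shape. -/
theorem left_eq {C₂ β₂ : ℕ → ℕ → ℕ} (h : IsSuc n C S β) (h₂ : IsSuc n C₂ S β₂)
    (hC : IsTableau (2 * n) C) (hC₂ : IsTableau (2 * n) C₂)
    (hN : ∀ j, C j (2 * n) = C₂ j (2 * n)) : C = C₂ := by
  obtain ⟨m, hm⟩ := h.mul.fin
  obtain ⟨m₂, hm₂⟩ := h₂.mul.fin
  have hβ : ∀ d j, max m m₂ ≤ j + d → β j = β₂ j := fun d => by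
    induction d with
    | zero => intro j hj; rw [hm j (by omega), hm₂ j (by omega)]
    | succ d ih =>
      intro j hj
      have a := h.mul.bump j
      have b := h₂.mul.bump j
      rw [ih (j + 1) (by omega)] at a
      refine a.left_eq b (h.mul.count j) (hC.count _) (h₂.mul.count j) (hC₂.count _) ?_
      have := a.sum (2 * n)
      have := b.sum (2 * n)
      have := hN (j + 1)
      omega
  have hβ' : ∀ j, β j = β₂ j := fun j => hβ (max m m₂) j (by omega)
  funext j
  cases j with
  | zero =>
    have a := h.red
    rw [hβ' 0] at a
    exact a.left_eq h₂.red (hC.count 0) (hC₂.count 0) (hN 0)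
  | succ j =>
    have a := h.mul.bump j
    rw [hβ' j, hβ' (j + 1)] at a
    exact a.right_eq (h₂.mul.bump j)

/-- The columns bumped in one step lie below those bumped in the next step. -/
theorem le_next (h : IsSuc n C S β) (h₂ : IsSuc n S U ε) (hC : IsTableau (2 * n) C) (j y : ℕ) :
    β j y ≤ ε j y := by
  induction j generalizing y with
  | zero =>
    exact (le_red_of_red_bump (hC.count 0) (hC.count 1) (hC.anti 0) h.red (h.mul.bump 0)
      h₂.red).2 y
  | succ j ih =>
    exact (le_bumped_iff (h.mul.bump (j + 1)) (h₂.mul.bump j)).1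
      (fun y => ((h.mul.bump j).bumped_le y).trans (ih y)) y

end IsSuc

/-- Conservation of lengths: if `h j` counts the cells of `L / S` in the columns `≥ j`, then the
column entering column `j` has length `L j - h j`. -/
theorem length_add_tail {β h S L : ℕ → ℕ} {m : ℕ}
    (h0 : ∀ j ≥ m, β j = 0 ∧ h j = 0 ∧ L j = 0)
    (hβ : ∀ j, S j + β (j + 1) = β j + L (j + 1)) (hh : ∀ j, h j + S j = h (j + 1) + L j)
    (j : ℕ) : β j + h j = L j := by
  have key : ∀ d j, m ≤ j + d → β j + h j = L j := fun d => by
    induction d with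
    | zero => intro j hj; have := h0 j hj; omega
    | succ d ih =>
      intro j hj
      have := ih (j + 1) (by omega)
      have := hβ j
      have := hh j
      omega
  exact key m j (by omega)

/-- `h j` is the number of cells of the skew shape `L / S` in the columns `≥ j`, the shapes being
given by their column lengths. -/
structure IsTail (L S h : ℕ → ℕ) : Prop where
  step : ∀ j, h j + S j = h (j + 1) + L j
  fin : ∃ m, ∀ j ≥ m, h j = 0

theorem IsSuc.length_add_tail {n : ℕ} {C S β : ℕ → ℕ → ℕ} {h : ℕ → ℕ} (hs : IsSuc n C S β)
    (hC : IsTableau (2 * n) C)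
    (hh : IsTail (fun j => C j (2 * n)) (fun j => S j (2 * n)) h) (j : ℕ) :
    β j (2 * n) + h j = C j (2 * n) := by
  obtain ⟨m₁, h₁⟩ := hs.mul.fin
  obtain ⟨m₂, h₂⟩ := hC.fin
  obtain ⟨m₃, h₃⟩ := hh.fin
  refine QuantumLR.length_add_tail (β := fun j => β j (2 * n)) (S := fun j => S j (2 * n))
    (L := fun j => C j (2 * n)) (m := max m₁ (max m₂ m₃)) (fun j hj => ?_)
    (fun j => (hs.mul.bump j).sum (2 * n)) hh.step j
  rw [h₁ j (by omega), h₂ j (by omega), h₃ j (by omega)]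
  simp

/-- The size of the strip removed by one step is even, and it is large if the first column is
long. -/
theorem IsSuc.tail_zero {n : ℕ} {C S β : ℕ → ℕ → ℕ} {h : ℕ → ℕ} (hs : IsSuc n C S β)
    (hC : IsTableau (2 * n) C)
    (hh : IsTail (fun j => C j (2 * n)) (fun j => S j (2 * n)) h) :
    h 0 = 2 * defect (C 0) n ∧ 2 * C 0 (2 * n) ≤ 2 * n + h 0 := by
  have a1 := hs.length_add_tail hC hh 0
  have a2 := (hs.red n).1
  have a3 := hs.red.even_le (hC.count 0) n
  omega

/-- The strips removed by two consecutive steps satisfy the lattice condition. -/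
theorem IsSuc.tail_le {n : ℕ} {C S β U ε : ℕ → ℕ → ℕ} {h h' : ℕ → ℕ} (hs : IsSuc n C S β)
    (hs' : IsSuc n S U ε) (hC : IsTableau (2 * n) C)
    (hh : IsTail (fun j => C j (2 * n)) (fun j => S j (2 * n)) h)
    (hh' : IsTail (fun j => S j (2 * n)) (fun j => U j (2 * n)) h') (j : ℕ) :
    h' j ≤ h (j + 1) := by
  have a1 := hs.length_add_tail hC hh j
  have a2 := hs'.length_add_tail (hs.isTableau hC) hh' j
  have a3 := hs.le_next hs' hC j (2 * n)
  have a4 := hh.step j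
  omega

/-! ### Construction of a tableau from its successor -/

/-- Every vertical strip can be removed from a tableau by reverse insertion. -/
theorem exists_reverse_mul {N : ℕ} (m : ℕ) : ∀ (S : ℕ → ℕ → ℕ) (L : ℕ → ℕ),
    (∀ j, IsCount N (S j)) → (∀ j y, S (j + 1) y ≤ S j y) → (∀ j ≥ m, S j = 0) →
    (∀ j, L j ≤ S j N) → (∀ j, S (j + 1) N ≤ L j) →
    ∃ β C, IsMul N β C S ∧ (∀ j, IsCount N (C j)) ∧ (∀ j y, C (j + 1) y ≤ C j y) ∧
      (∀ j, C j N = L j) ∧ ∀ j ≥ m, C j = 0 := by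
  induction m with
  | zero =>
    intro S L _ _ hS hL _
    refine ⟨0, 0, ⟨fun _ => isCount_zero N, fun j => ?_, 0, fun _ _ => rfl⟩,
      fun _ => isCount_zero N, fun _ _ => le_rfl, fun j => ?_, fun _ _ => rfl⟩
    · rw [hS j (Nat.zero_le j)]
      exact ⟨fun _ => rfl, fun _ _ _ => le_rfl, fun y => ⟨y, le_rfl, rfl⟩⟩
    · have := hL j
      rw [hS j (Nat.zero_le j)] at this
      simp only [Pi.zero_apply] at this ⊢
      omega
  | succ m ih =>
    intro S L hS hanti hfin hL hL'
    obtain ⟨β, C, hM, hC, hCa, hCL, hC0⟩ := ih (fun j => S (j + 1)) (fun j => L (j + 1))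
      (fun j => hS _) (fun j => hanti _) (fun j hj => hfin _ (by omega)) (fun j => hL _)
      (fun j => hL' _)
    have hβS : ∀ y, β 0 y ≤ S 1 y := (hM.bump 0).le_left (hM.count 0) (hC 0)
    have s1 := hβS N
    have s2 := hL 0
    have s3 := hL' 0
    simp only [Nat.zero_add] at s3
    -- The length of the column to be inserted into column `0`, which must have length `L 0`.
    have s4 : β 0 N ≤ S 0 N + β 0 N - L 0 := by omega
    have s5 : S 0 N + β 0 N - L 0 ≤ S 0 N := by omega
    obtain ⟨b, t, hb, ht, hbt, hbk, hmax⟩ := exists_reverse_bump (hS 0) (hM.count 0)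
      (fun y => (hβS y).trans (hanti 0 y)) s4 s5
    have htN : t N = L 0 := by have := hbt.sum N; omega
    refine ⟨fun j => Nat.casesOn j b β, fun j => Nat.casesOn j t C, ⟨?_, ?_, ?_⟩, ?_, ?_, ?_, ?_⟩
    · rintro (_ | j)
      · exact hb
      · exact hM.count j
    · rintro (_ | j)
      · exact hbt
      · exact hM.bump j
    · obtain ⟨k, hk⟩ := hM.fin
      refine ⟨k + 1, ?_⟩
      rintro (_ | j) hj
      · omega
      · exact hk j (by omega)
    · rintro (_ | j)
      · exact ht
      · exact hC j
    · rintro (_ | j) y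
      · change C 0 y ≤ t y
        -- It suffices to see that `t` lies above the second column of `S`.
        refine ((hM.bump 0).le_right y).trans ?_
        -- By maximality of `S 0 - b = t - β 0`, as the column `S 1` has `S 1 y - β 0 y` entries
        -- `≤ y` in excess of `β 0`.
        have key : ∀ y ≤ N, S 1 y ≤ t y := fun y hy => by
          have hd := fun z (hz : y ≤ z) => (hM.bump 0).diff_le hz
          simp only [Nat.zero_add] at hd
          have := hmax y hy (S 1 y - β 0 y) (by
            have := hd N hy
            have := hβS y
            omega) (fun z hz _ => by
            have := hd z hz
            have := hanti 0 z
            have := hβS y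
            simp only [Nat.zero_add] at *
            omega)
          have := hbt.sum y
          have := hβS y
          omega
        rcases le_total y N with hy | hy
        · exact key y hy
        · simp only [Nat.zero_add]
          rw [(hS 1).const y hy, ht.const y hy]
          exact key N le_rfl
      · exact hCa j y
    · rintro (_ | j)
      · exact htN
      · exact hCL j
    · rintro (_ | j) hj
      · omega
      · exact hC0 j (by omega)

/-- A tableau `S` is the successor of a tableau of shape `L` as soon as `L / S` is a vertical strip
of even size which is large enough and satisfies the lattice condition with respect to the strip
removed by the next step. -/
theorem exists_pred {n : ℕ} {S U ε : ℕ → ℕ → ℕ} (hS : IsTableau (2 * n) S) (hs : IsSuc n S U ε)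
    {L h h' : ℕ → ℕ} (hLS : ∀ j, S j (2 * n) ≤ L j) (hSL : ∀ j, L (j + 1) ≤ S j (2 * n))
    (hh : IsTail L (fun j => S j (2 * n)) h)
    (hh' : IsTail (fun j => S j (2 * n)) (fun j => U j (2 * n)) h') (hle : ∀ j, h' j ≤ h (j + 1))
    (heven : Even (h 0)) (hlen : 2 * L 0 ≤ 2 * n + h 0) :
    ∃ C β, IsTableau (2 * n) C ∧ IsSuc n C S β ∧ ∀ j, C j (2 * n) = L j := by
  obtain ⟨m, hm⟩ := hS.fin
  obtain ⟨β, C, hM, hC, hCa, hCL, hC0⟩ := exists_reverse_mul m S (fun j => L (j + 1)) hS.count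
    hS.anti hm hSL (fun j => hLS _)
  have hβh : ∀ j, β j (2 * n) + h j = L j := by
    obtain ⟨m₁, h₁⟩ := hM.fin
    obtain ⟨m₃, h₃⟩ := hh.fin
    refine length_add_tail (β := fun j => β j (2 * n)) (S := fun j => S j (2 * n))
      (L := L) (m := max m₁ (max (m + 1) m₃)) (fun j hj => ?_)
      (fun j => ?_) hh.step
    · rw [h₁ j (by omega), h₃ j (by omega)]
      have := hSL (j - 1)
      rw [hm (j - 1) (by omega), show j - 1 + 1 = j by omega] at this
      exact ⟨rfl, rfl, by simpa using this⟩
    · have := (hM.bump j).sum (2 * n)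
      rwa [hCL] at this
  -- The lattice condition compares the lengths of the inserted columns.
  have hβε : ∀ j, β j (2 * n) ≤ ε j (2 * n) := fun j => by
    have := hs.length_add_tail hS hh' j
    have := hβh j
    have := hle j
    have := hh.step j
    omega
  obtain ⟨m₁, h₁⟩ := hM.fin
  -- The columns themselves are compared from right to left.
  have hdom : ∀ d j, m₁ ≤ j + d → ∀ y, β j y ≤ ε j y := fun d => by
    induction d with
    | zero => intro j hj y; rw [h₁ j hj]; exact Nat.zero_le _
    | succ d ih =>
      intro j hj
      have h1 := (le_bumped_iff (hM.bump (j + 1)) (hs.mul.bump j)).2 (ih (j + 1) (by omega))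
      refine le_of_bumped_le (hM.count j) (hC j) (hs.mul.count j) (hM.bump j) ?_ (hβε j) h1
      · -- The entries of `ε j` belong to the column `S j`.
        intro x y hxy
        cases j with
        | zero => exact hs.red.diff_le hxy
        | succ j =>
          have := (hs.mul.bump j).sum x
          have := (hs.mul.bump j).sum y
          have := (hs.mul.bump j).diff_le hxy
          omega
  obtain ⟨r, hr⟩ := heven
  have b0 := hβh 0
  have l0 := hLS 0
  obtain ⟨C₀, hC₀, hred, hlen₀, htC⟩ := exists_red_bump (hM.count 0) (hC 0) (hM.bump 0) hs.red
    (hdom m₁ 0 (by omega)) (r := r) (by omega) (by omega)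
  refine ⟨fun j => Nat.casesOn j C₀ C, β, ⟨?_, ?_, ?_⟩, ⟨hred, hM⟩, ?_⟩
  · rintro (_ | j)
    · exact hC₀
    · exact hC j
  · rintro (_ | j)
    · exact htC
    · exact hCa j
  · refine ⟨m + 1, ?_⟩
    rintro (_ | j) hj
    · omega
    · exact hC0 j (by omega)
  · rintro (_ | j)
    · change C₀ (2 * n) = _
      omega
    · exact hCL j

/-! ### Stationary tableaux -/

theorem defect_eq_zero {D : ℕ → ℕ} (h : ∀ y, D (2 * y) ≤ y) (y : ℕ) : defect D y = 0 := by
  induction y with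
  | zero => rfl
  | succ y ih => rw [defect, ih]; have := h (y + 1); omega

/-- A tableau whose first column is symplectic is its own successor. -/
theorem isSuc_self {n : ℕ} {S : ℕ → ℕ → ℕ} (hS : IsTableau (2 * n) S)
    (h : ∀ y, S 0 (2 * y) ≤ y) : IsSuc n S S S where
  red y := by simp [defect_eq_zero h]
  mul := ⟨hS.count, fun j => ⟨fun _ => rfl, fun z y _ => by have := hS.anti j z; omega,
    fun y => ⟨0, Nat.zero_le y, by
      simp [(hS.count j).zero, (hS.count (j + 1)).zero]⟩⟩, hS.fin⟩

/-- If a step does not change the length of any column, the first column is symplectic. -/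
theorem IsSuc.symplectic {n : ℕ} {C S β : ℕ → ℕ → ℕ} (hs : IsSuc n C S β)
    (hC : IsTableau (2 * n) C) (h : ∀ j, S j (2 * n) = C j (2 * n)) (y : ℕ) :
    C 0 (2 * y) ≤ y := by
  have h1 := (hs.tail_zero hC (h := 0) ⟨fun j => by simp [h], 0, fun _ _ => rfl⟩).1
  have h2 := le_defect (hC.count 0) y
  have h3 : defect (C 0) y ≤ defect (C 0) n := by
    rcases le_total y n with hy | hy
    · exact defect_monotone _ hy
    · exact (defect_const (hC.count 0) hy).le
  simp only [Pi.zero_apply] at h1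
  omega

/-! ### Columns as lists -/

/-- A column with entries in `{1, …, N}`: a strictly increasing list. -/
def IsCol (N : ℕ) (a : List ℕ) : Prop := a.Pairwise (· < ·) ∧ ∀ x ∈ a, 1 ≤ x ∧ x ≤ N

/-- The counting function of a list. -/
def cnt (a : List ℕ) (y : ℕ) : ℕ := a.countP fun x => x ≤ y

@[simp] theorem cnt_nil : cnt [] = 0 := rfl

theorem cnt_cons (x : ℕ) (a : List ℕ) (y : ℕ) :
    cnt (x :: a) y = cnt a y + if x ≤ y then 1 else 0 := by
  simp [cnt, List.countP_cons]

theorem cnt_append (a b : List ℕ) (y : ℕ) : cnt (a ++ b) y = cnt a y + cnt b y := by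
  simp [cnt]

theorem cnt_eq_zero {a : List ℕ} {y : ℕ} (h : ∀ x ∈ a, y < x) : cnt a y = 0 := by
  simpa [cnt, List.countP_eq_zero] using h

theorem cnt_eq_length {a : List ℕ} {y : ℕ} (h : ∀ x ∈ a, x ≤ y) : cnt a y = a.length := by
  simpa [cnt, List.countP_eq_length] using h

theorem cnt_succ (a : List ℕ) (y : ℕ) : cnt a (y + 1) = cnt a y + a.count (y + 1) := by
  induction a with
  | nil => simp
  | cons x a ih =>
    rw [cnt_cons, cnt_cons, ih, List.count_cons]
    by_cases h : x = y + 1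
    · subst h; simp; omega
    · by_cases h2 : x ≤ y
      · rw [if_pos h2, if_pos (by omega)]; simp [h]; omega
      · rw [if_neg h2, if_neg (by omega)]; simp [h]

theorem IsCol.nodup {N : ℕ} {a : List ℕ} (h : IsCol N a) : a.Nodup :=
  h.1.imp fun h => h.ne

theorem IsCol.sublist {N : ℕ} {a b : List ℕ} (h : IsCol N a) (hb : b.Sublist a) : IsCol N b :=
  ⟨h.1.sublist hb, fun x hx => h.2 x (hb.subset hx)⟩

theorem IsCol.cnt_last {N : ℕ} {a : List ℕ} (h : IsCol N a) : cnt a N = a.length :=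
  cnt_eq_length fun x hx => (h.2 x hx).2

theorem IsCol.isCount {N : ℕ} {a : List ℕ} (h : IsCol N a) : IsCount N (cnt a) where
  zero := cnt_eq_zero fun x hx => (h.2 x hx).1
  le_succ y := by rw [cnt_succ]; omega
  succ_le y := by
    rw [cnt_succ]
    have := List.nodup_iff_count_le_one.1 h.nodup (y + 1)
    omega
  const y hy := by
    rw [h.cnt_last]
    exact cnt_eq_length fun x hx => (h.2 x hx).2.trans hy

theorem IsCol.ext {N : ℕ} {a b : List ℕ} (ha : IsCol N a) (hb : IsCol N b) (h : cnt a = cnt b) :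
    a = b := by
  have hmem : ∀ x, x ∈ a ↔ x ∈ b := fun x => by
    cases x with
    | zero =>
      exact ⟨fun h => absurd (ha.2 0 h).1 (by omega), fun h => absurd (hb.2 0 h).1 (by omega)⟩
    | succ x =>
      have h1 := cnt_succ a x
      rw [h, cnt_succ b x] at h1
      rw [← List.count_pos_iff, ← List.count_pos_iff]
      omega
  refine List.Perm.eq_of_pairwise (le := (· < ·)) (fun x y _ _ h1 h2 => ?_) ha.1 hb.1
    ((List.perm_ext_iff_of_nodup ha.nodup hb.nodup).2 hmem)
  omega

/-- The `i`-th entry of a column is at most `y` if and only if the column has more than `i` entries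
`≤ y`. -/
theorem IsCol.getD_le_iff {N : ℕ} {a : List ℕ} (h : IsCol N a) {i : ℕ} (hi : i < a.length) (y : ℕ) :
    a.getD i 0 ≤ y ↔ i < cnt a y := by
  induction a generalizing i with
  | nil => simp at hi
  | cons x a ih =>
    have ha : IsCol N a := h.sublist (List.sublist_cons_self x a)
    have hx : ∀ z ∈ a, x < z := fun z hz => List.rel_of_pairwise_cons h.1 hz
    rw [cnt_cons]
    cases i with
    | zero =>
      simp only [List.getD_cons_zero]
      by_cases hxy : x ≤ y
      · simp [hxy]
      · have : cnt a y = 0 := cnt_eq_zero fun z hz => by have := hx z hz; omega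
        simp [hxy, this]
    | succ i =>
      simp only [List.length_cons] at hi
      have hi' : i < a.length := by omega
      rw [List.getD_cons_succ, ih ha hi']
      by_cases hxy : x ≤ y
      · simp [hxy]
      · have : cnt a y = 0 := cnt_eq_zero fun z hz => by have := hx z hz; omega
        simp [this, hxy]

/-- The column with a given counting function. -/
def ofCount (N : ℕ) (f : ℕ → ℕ) : List ℕ := (List.range' 1 N).filter fun x => f (x - 1) < f x

theorem isCol_ofCount (N : ℕ) (f : ℕ → ℕ) : IsCol N (ofCount N f) := by
  refine ⟨List.Pairwise.sublist List.filter_sublist (List.pairwise_lt_range' ..), fun x hx => ?_⟩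
  have := List.mem_of_mem_filter hx
  rw [List.mem_range'_1] at this
  omega

theorem cnt_ofCount {N : ℕ} {f : ℕ → ℕ} (hf : IsCount N f) : cnt (ofCount N f) = f := by
  have hc := (isCol_ofCount N f)
  have key : ∀ y ≤ N, cnt (ofCount N f) y = f y := fun y => by
    induction y with
    | zero => intro _; rw [hc.isCount.zero, hf.zero]
    | succ y ih =>
      intro hy
      rw [cnt_succ, ih (by omega)]
      have h1 := hf.le_succ y
      have h2 := hf.succ_le y
      by_cases h : f y < f (y + 1)
      · have : y + 1 ∈ ofCount N f := by
          rw [ofCount, List.mem_filter, List.mem_range'_1]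
          simpa using ⟨by omega, h⟩
        rw [List.count_eq_one_of_mem hc.nodup this]
        omega
      · have : y + 1 ∉ ofCount N f := by
          rw [ofCount, List.mem_filter]
          simpa using fun _ => by omega
        rw [List.count_eq_zero_of_not_mem this]
        omega
  funext y
  rcases le_total y N with hy | hy
  · exact key y hy
  · rw [hc.isCount.const y hy, hf.const y hy, key N le_rfl]

/-! ### The list algorithm for column insertion -/

/-- The insertion of the entries of `a`, one after the other, into the column `c`: the resulting
column and the list of the bumped entries. -/
def insCol : List ℕ → List ℕ → List ℕ × List ℕ
  | [], c => (c, [])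
  | x :: a, c =>
    match c.dropWhile (fun y => y < x) with
    | [] => insCol a (c ++ [x])
    | y :: r =>
      ((insCol a (c.takeWhile (fun z => z < x) ++ x :: r)).1,
        y :: (insCol a (c.takeWhile (fun z => z < x) ++ x :: r)).2)

theorem colMul_cons (a c : List ℕ) (C : List (List ℕ)) :
    colMul a (c :: C) = (insCol a c).1 :: colMul (insCol a c).2 C := by
  induction a generalizing c C with
  | nil => rfl
  | cons x a ih =>
    have h : colMul (x :: a) (c :: C) = colMul a (colInsert x (c :: C)) := rfl
    rw [h, colInsert, insCol]
    rcases hd : c.dropWhile (fun y => y < x) with _ | ⟨y, r⟩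
    · exact ih _ _
    · exact ih _ _

theorem insCol_append {a c : List ℕ} (h : (c ++ a).Pairwise (· < ·)) :
    insCol a c = (c ++ a, []) := by
  induction a generalizing c with
  | nil => simp [insCol]
  | cons x a ih =>
    have hx : c.dropWhile (fun y => y < x) = [] := by
      rw [List.dropWhile_eq_nil_iff]
      intro y hy
      have := (List.pairwise_append.1 h).2.2 y hy x (by simp)
      simpa using this
    rw [insCol, hx]
    simp only
    rw [ih (by simpa using h)]
    simp

theorem colMul_nil {a : List ℕ} (h : a.Pairwise (· < ·)) (ha : a ≠ []) : colMul a [] = [a] := by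
  obtain _ | ⟨x, a⟩ := a
  · exact absurd rfl ha
  · have h1 : colMul (x :: a) [] = colMul a [[x]] := rfl
    rw [h1, colMul_cons, insCol_append (by simpa using h)]
    rfl

theorem dropWhile_nil {c : List ℕ} {x : ℕ} (h : c.dropWhile (fun y => y < x) = []) :
    ∀ z ∈ c, z < x := by
  rw [List.dropWhile_eq_nil_iff] at h
  simpa using h

/-- Splitting a column at the entry bumped by `x`. -/
theorem dropWhile_cons {N : ℕ} {c : List ℕ} (hc : IsCol N c) {x y : ℕ} {r : List ℕ}
    (h : c.dropWhile (fun y => y < x) = y :: r) :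
    c = c.takeWhile (fun z => z < x) ++ y :: r ∧ (∀ z ∈ c.takeWhile (fun z => z < x), z < x) ∧
      x ≤ y ∧ ∀ z ∈ r, y < z := by
  have h1 : c = c.takeWhile (fun z => z < x) ++ y :: r := by
    rw [← h, List.takeWhile_append_dropWhile]
  refine ⟨h1, fun z hz => ?_, ?_, ?_⟩
  · simpa using List.mem_takeWhile_imp hz
  · have h2 := List.head_dropWhile_not (p := fun y => decide (y < x)) (l := c) (by rw [h]; simp)
    simp only [h, List.head_cons] at h2
    simpa using h2
  · have h2 := hc.1
    rw [h1] at h2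
    have h3 := (List.pairwise_append.1 h2).2.1
    exact fun z hz => List.rel_of_pairwise_cons h3 hz

/-- The effect of a single insertion on counting functions, from which `IsBump` is proved by
induction on the inserted column: `c₁` arises from `c` by adding `x` and removing the smallest
entry `≥ x`, and `δ` is the indicator function of the numbers above the removed entry. -/
theorem isBump_cons {N : ℕ} {a c c₁ S a' δ : ℕ → ℕ} {x : ℕ} (hx : 1 ≤ x)
    (ha : ∀ y ≤ x, a y = 0)
    (hc : IsCount N c) (h : IsBump a c₁ S a') (hlt : ∀ y < x, δ y = 0) (hδ : ∀ y, δ y ≤ 1)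
    (hc₁ : ∀ y, c₁ y + δ y = c y + if x ≤ y then 1 else 0)
    (hcδ : ∀ y, x ≤ y → c (x - 1) + δ y ≤ c y)
    (hconst : ∀ y, x ≤ y → δ y = 0 → c y = c (x - 1)) :
    IsBump (fun y => a y + if x ≤ y then 1 else 0) c S (fun y => a' y + δ y) where
  sum y := by
    have := h.sum y; have := hc₁ y
    omega
  ge z y hzy := by
    have h1 := h.ge z y hzy
    have h2 := hc₁ z
    have h3 := hδ z
    by_cases hz : x ≤ z
    · rw [if_pos hz, if_pos (hz.trans hzy)]
      rw [if_pos hz] at h2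
      omega
    · rw [if_neg hz]
      rw [if_neg hz] at h2
      have h4 := hlt z (by omega)
      by_cases hy : x ≤ y
      · rw [if_pos hy]
        have h5 := h.ge x y hy
        have h6 := hc₁ x
        rw [if_pos le_rfl] at h6
        have h7 := ha x le_rfl
        have h8 := ha z (by omega)
        have h9 := hcδ x le_rfl
        have h10 := hc.monotone (show z ≤ x - 1 by omega)
        omega
      · rw [if_neg hy]
        omega
  attain y := by
    obtain ⟨z, hz, e⟩ := h.attain y
    have h2 := hc₁ z
    by_cases hy : x ≤ y
    · rw [if_pos hy]
      have h5 := h.ge x y hy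
      have h6 := hc₁ x
      rw [if_pos le_rfl] at h6
      have h7 := ha x le_rfl
      have h8 := hcδ x le_rfl
      by_cases hzx : x ≤ z
      · rw [if_pos hzx] at h2
        rcases Nat.eq_zero_or_pos (δ z) with h0 | h0
        · have h9 := hconst z hzx h0
          refine ⟨x - 1, by omega, ?_⟩
          rw [if_neg (by omega), ha (x - 1) (by omega)]
          omega
        · have := hδ z
          refine ⟨z, hz, ?_⟩
          rw [if_pos hzx]
          omega
      · rw [if_neg hzx] at h2
        have := ha z (by omega)
        have := hlt z (by omega)
        have := hc.monotone (show z ≤ x - 1 by omega)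
        omega
    · refine ⟨z, hz, ?_⟩
      rw [if_neg hy, if_neg (by omega)]
      rw [if_neg (by omega)] at h2
      have := hlt z (by omega)
      omega

theorem isCol_append_singleton {N : ℕ} {c : List ℕ} {x : ℕ} (hc : IsCol N c) (hx : 1 ≤ x)
    (hxN : x ≤ N) (h : ∀ z ∈ c, z < x) : IsCol N (c ++ [x]) := by
  refine ⟨List.pairwise_append.2 ⟨hc.1, by simp, by simpa using h⟩, fun z hz => ?_⟩
  rcases List.mem_append.1 hz with h1 | h1
  · exact hc.2 z h1
  · obtain rfl : z = x := by simpa using h1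
    exact ⟨hx, hxN⟩

/-- The list algorithm for the insertion of a column into a column. -/
theorem isBump_insCol {N : ℕ} {a c : List ℕ} (ha : IsCol N a) (hc : IsCol N c) :
    IsCol N (insCol a c).1 ∧ IsCol N (insCol a c).2 ∧
      IsBump (cnt a) (cnt c) (cnt (insCol a c).1) (cnt (insCol a c).2) ∧
      ∀ y ∈ (insCol a c).2, y ∈ c ∧ ∃ z ∈ a, z ≤ y := by
  induction a generalizing c with
  | nil =>
    have h0 := hc.isCount
    refine ⟨hc, ⟨by simp [insCol], by simp [insCol]⟩, ⟨fun y => ?_, fun z y hzy => ?_, fun y => ?_⟩,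
      by simp [insCol]⟩
    · simp [insCol]
    · simpa [insCol] using h0.monotone hzy
    · exact ⟨y, le_rfl, by simp [insCol]⟩
  | cons x a ih =>
    have ha' : IsCol N a := ha.sublist (List.sublist_cons_self x a)
    have hxa : ∀ z ∈ a, x < z := fun z hz => List.rel_of_pairwise_cons ha.1 hz
    have hx := ha.2 x (by simp)
    have hcx : ∀ y ≤ x, cnt a y = 0 := fun y hy => cnt_eq_zero fun z hz => by
      have := hxa z hz; omega
    have hcons : cnt (x :: a) = fun y => cnt a y + if x ≤ y then 1 else 0 :=
      funext fun y => cnt_cons x a y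
    rw [insCol]
    rcases hd : c.dropWhile (fun y => y < x) with _ | ⟨y, r⟩
    · have hlt := dropWhile_nil hd
      have hc₁ := isCol_append_singleton hc hx.1 hx.2 hlt
      obtain ⟨h1, h2, h3, h4⟩ := ih ha' hc₁
      refine ⟨h1, h2, ?_, fun y hy => ?_⟩
      · rw [hcons]
        have hcc : ∀ y, x - 1 ≤ y → cnt c y = c.length := fun y hy =>
          cnt_eq_length fun z hz => by have := hlt z hz; omega
        refine isBump_cons (δ := fun _ => 0) hx.1 hcx hc.isCount h3 (fun _ _ => rfl)
          (fun _ => by simp) (fun y => ?_) (fun y hy => ?_) (fun y hy _ => ?_)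
        · rw [cnt_append, cnt_cons]; simp
        · rw [hcc _ le_rfl, hcc y (by omega)]; simp
        · rw [hcc _ le_rfl, hcc y (by omega)]
      · obtain ⟨h5, z, hz, hzy⟩ := h4 y hy
        have := hxa z hz
        refine ⟨?_, z, by simp [hz], hzy⟩
        rcases List.mem_append.1 h5 with h6 | h6
        · exact h6
        · have : y = x := by simpa using h6
          omega
    · obtain ⟨he, htw, hxy, hyr⟩ := dropWhile_cons hc hd
      generalize hw : c.takeWhile (fun z => z < x) = w at he htw
      have hwr : IsCol N (w ++ y :: r) := he ▸ hc
      have hp := List.pairwise_append.1 hwr.1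
      have hc₁ : IsCol N (w ++ x :: r) := by
        refine ⟨List.pairwise_append.2 ⟨hp.1, List.pairwise_cons.2
          ⟨fun z hz => lt_of_le_of_lt hxy (hyr z hz), (List.pairwise_cons.1 hp.2.1).2⟩, ?_⟩, ?_⟩
        · intro z hz z' hz'
          rcases List.mem_cons.1 hz' with rfl | h
          · exact htw z hz
          · exact hp.2.2 z hz z' (List.mem_cons_of_mem _ h)
        · intro z hz
          rcases List.mem_append.1 hz with h | h
          · exact hwr.2 z (List.mem_append_left _ h)
          · rcases List.mem_cons.1 h with rfl | h
            · exact hx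
            · exact hwr.2 z (List.mem_append_right _ (List.mem_cons_of_mem _ h))
      obtain ⟨h1, h2, h3, h4⟩ := ih ha' hc₁
      have hbump : ∀ z ∈ (insCol a (w ++ x :: r)).2, z ∈ r ∧ ∃ z' ∈ a, z' ≤ z := fun z hz => by
        obtain ⟨h5, z', hz', hzz⟩ := h4 z hz
        refine ⟨?_, z', hz', hzz⟩
        have := hxa z' hz'
        rcases List.mem_append.1 h5 with h | h
        · have := htw z h; omega
        · rcases List.mem_cons.1 h with rfl | h
          · omega
          · exact h
      have hmemc : ∀ z ∈ r, z ∈ c := fun z hz => by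
        rw [he]; exact List.mem_append_right _ (List.mem_cons_of_mem _ hz)
      have hyc : y ∈ c := by rw [he]; simp
      refine ⟨h1, ⟨List.pairwise_cons.2 ⟨fun z hz => hyr z (hbump z hz).1, h2.1⟩, ?_⟩, ?_, ?_⟩
      · intro z hz
        rcases List.mem_cons.1 hz with rfl | h
        · exact hc.2 z hyc
        · exact h2.2 z h
      · have hsnd : cnt (y :: (insCol a (w ++ x :: r)).2) =
            fun v => cnt (insCol a (w ++ x :: r)).2 v + if y ≤ v then 1 else 0 :=
          funext fun v => cnt_cons _ _ v
        rw [hcons]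
        simp only [hsnd]
        have hw1 : ∀ v, x - 1 ≤ v → cnt w v = w.length := fun v hv =>
          cnt_eq_length fun z hz => by have := htw z hz; omega
        have hr0 : ∀ v ≤ y, cnt r v = 0 := fun v hv =>
          cnt_eq_zero fun z hz => by have := hyr z hz; omega
        have hcv : ∀ v, cnt c v = cnt w v + (cnt r v + if y ≤ v then 1 else 0) := fun v => by
          conv_lhs => rw [he]
          rw [cnt_append, cnt_cons]
        refine isBump_cons (δ := fun v => if y ≤ v then 1 else 0) hx.1 hcx hc.isCount h3
          (fun v hv => by rw [if_neg (by omega)]) (fun v => by split_ifs <;> omega)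
          (fun v => ?_) (fun v hv => ?_) (fun v hv h0 => ?_)
        · rw [hcv, cnt_append, cnt_cons]; omega
        · rw [hcv, hcv, hw1 _ le_rfl, hw1 v (by omega), hr0 (x - 1) (by omega)]
          rw [if_neg (show ¬ y ≤ x - 1 by omega)]
          omega
        · have hv' : ¬ y ≤ v := fun h => by simp [h] at h0
          rw [hcv, hcv, hw1 _ le_rfl, hw1 v (by omega), hr0 (x - 1) (by omega), hr0 v (by omega),
            if_neg hv', if_neg (by omega)]
      · intro z hz
        rcases List.mem_cons.1 hz with rfl | h
        · exact ⟨hyc, x, by simp, hxy⟩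
        · obtain ⟨h5, z', hz', h6⟩ := hbump z h
          exact ⟨hmemc z h5, z', by simp [hz'], h6⟩

/-! ### The list algorithm for the reduction -/

theorem remRev_sublist (l : List ℕ) : (remRev l).Sublist l := by
  induction l using remRev.induct with
  | case1 => simp [remRev]
  | case2 => simp [remRev]
  | case3 y x t h ih => rw [remRev, if_pos h]; exact (ih.cons_cons x).cons_cons y
  | case4 y x t h _ ih => rw [remRev, if_neg h]; exact ih.cons y

theorem defect_congr {D D' : ℕ → ℕ} {y : ℕ} (h : ∀ z ≤ y, D (2 * z) = D' (2 * z)) :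
    defect D y = defect D' y := by
  induction y with
  | zero => rfl
  | succ y ih => rw [defect, defect, ih fun z hz => h z (by omega), h (y + 1) le_rfl]

/-- The effect on the defect of a new largest entry `Y ∈ {2j - 1, 2j}`. -/
theorem defect_cons {l : List ℕ} {Y j y : ℕ} (hY : ∀ x ∈ l, x < Y) (hj : 1 ≤ j)
    (hYj : Y = 2 * j ∨ Y + 1 = 2 * j) (hy : j ≤ y) :
    defect (cnt (Y :: l)) y = max (defect (cnt l) (j - 1)) (l.length + 1 - j) := by
  have hlen : ∀ w, Y ≤ w → cnt (Y :: l) w = l.length + 1 := fun w hw =>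
    cnt_eq_length fun x hx => by
      rcases List.mem_cons.1 hx with rfl | h
      · exact hw
      · exact (hY x h).le.trans hw
  induction y, hy using Nat.le_induction with
  | base =>
    obtain ⟨k, rfl⟩ : ∃ k, j = k + 1 := ⟨j - 1, by omega⟩
    rw [defect, hlen _ (by omega)]
    congr 1
    refine defect_congr fun z hz => ?_
    rw [cnt_cons, if_neg (by omega)]
    rfl
  | succ y hy ih => rw [defect, ih, hlen _ (by omega)]; omega

theorem defect_cons_of_lt {l : List ℕ} {Y j y : ℕ} (hYj : Y = 2 * j ∨ Y + 1 = 2 * j) (hy : y < j) :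
    defect (cnt (Y :: l)) y = defect (cnt l) y :=
  defect_congr fun z hz => by rw [cnt_cons, if_neg (by omega)]; rfl

theorem defect_last {l : List ℕ} {j y : ℕ} (hl : ∀ x ∈ l, x < 2 * j) (hj : 1 ≤ j)
    (h : l.length ≤ j + defect (cnt l) (j - 1)) (hy : j ≤ y) :
    defect (cnt l) y = defect (cnt l) (j - 1) := by
  have hlen : ∀ w, 2 * j ≤ w → cnt l w = l.length := fun w hw =>
    cnt_eq_length fun x hx => (hl x hx).le.trans hw
  induction y, hy using Nat.le_induction with
  | base =>
    obtain ⟨k, rfl⟩ : ∃ k, j = k + 1 := ⟨j - 1, by omega⟩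
    rw [defect, hlen _ le_rfl]
    simp only [Nat.add_sub_cancel] at h ⊢
    omega
  | succ y hy ih => rw [defect, ih, hlen _ (by omega)]; omega

/-- The recursion for the removable entries computes the defect. -/
theorem cnt_remRev (l : List ℕ) (hl : l.Pairwise (· > ·)) (hpos : ∀ x ∈ l, 1 ≤ x)
    (y : ℕ) : cnt (remRev l) (2 * y) = 2 * defect (cnt l) y ∧
      cnt (remRev l) (2 * y + 1) = defect (cnt l) y + defect (cnt l) (y + 1) := by
  induction l using remRev.induct generalizing y with
  | case1 =>
    have h : ∀ y, defect (cnt []) y = 0 := defect_eq_zero fun y => Nat.zero_le y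
    rw [h, h]
    simp [remRev]
  | case2 x =>
    have hx := hpos x (by simp)
    have h : ∀ y, defect (cnt [x]) y = 0 := defect_eq_zero fun y => by
      rw [cnt_cons]
      split_ifs
      · simp; omega
      · simp
    rw [h, h]
    simp [remRev]
  | case3 Y x t h ih =>
    rw [remRev, if_pos h]
    obtain ⟨hev, hxY, hlt⟩ := h
    obtain ⟨j, hj⟩ := hev
    have hl2 := List.pairwise_cons.1 hl
    have hl3 := List.pairwise_cons.1 hl2.2
    have ih := ih hl3.2 fun z hz => hpos z (by simp [hz])
    have hx := hpos x (by simp)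
    have hYt : ∀ z ∈ x :: t, z < Y := hl2.1
    have htx : ∀ z ∈ t, z < x := hl3.1
    have hrem : ∀ w, 2 * (j - 1) ≤ w → cnt (remRev t) w = (remRev t).length := fun w hw =>
      cnt_eq_length fun z hz => by have := htx z ((remRev_sublist t).subset hz); omega
    have hcnt : ∀ w, cnt (Y :: x :: remRev t) w =
        cnt (remRev t) w + (if x ≤ w then 1 else 0) + if Y ≤ w then 1 else 0 := fun w => by
      rw [cnt_cons, cnt_cons]
    have hw := (ih (j - 1)).1
    rw [hrem _ le_rfl] at hw
    have hd1 : ∀ y < j, defect (cnt (Y :: x :: t)) y = defect (cnt t) y := fun y hy => by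
      rw [defect_cons_of_lt (j := j) (by omega) hy, defect_cons_of_lt (j := j) (by omega) hy]
    have hd2 : ∀ y, j ≤ y → defect (cnt (Y :: x :: t)) y = defect (cnt t) (j - 1) + 1 :=
      fun y hy => by
        rw [defect_cons (j := j) hYt (by omega) (by omega) hy,
          defect_cons_of_lt (j := j) (by omega) (by omega)]
        have hle : t.length ≤ j - 1 + defect (cnt t) (j - 1) := by
          have : cnt t (2 * (j - 1)) = t.length :=
            cnt_eq_length fun z hz => by have := htx z hz; omega
          rw [← this]
          exact le_defect_of_zero (cnt_eq_zero fun z hz => hpos z (by simp [hz])) (j - 1)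
        simp only [List.length_cons] at *
        omega
    rw [hcnt, hcnt]
    rcases Nat.lt_trichotomy (y + 1) j with hy | hy | hy
    · rw [hd1 y (by omega), hd1 (y + 1) hy, if_neg (by omega), if_neg (by omega),
        if_neg (by omega), if_neg (by omega)]
      exact ih y
    · rw [hd1 y (by omega), hd2 (y + 1) hy.ge, if_neg (by omega), if_neg (by omega),
        if_pos (by omega), if_neg (by omega), hrem _ (by omega), hrem _ (by omega)]
      obtain rfl : y = j - 1 := by omega
      omega
    · rw [hd2 y (by omega), hd2 (y + 1) (by omega), if_pos (by omega), if_pos (by omega),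
        if_pos (by omega), if_pos (by omega), hrem _ (by omega), hrem _ (by omega)]
      omega
  | case4 Y x t h ih' ih =>
    rw [remRev, if_neg h]
    have hl2 := List.pairwise_cons.1 hl
    have hl3 := List.pairwise_cons.1 hl2.2
    have ih := ih hl2.2 (fun z hz => hpos z (List.mem_cons_of_mem _ hz))
    have hY := hpos Y (by simp)
    have hYt : ∀ z ∈ x :: t, z < Y := hl2.1
    have htx : ∀ z ∈ t, z < x := hl3.1
    obtain ⟨j, hj⟩ : ∃ j, Y = 2 * j ∨ Y + 1 = 2 * j := by
      obtain ⟨k, hk | hk⟩ := Nat.even_or_odd' Y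
      · exact ⟨k, Or.inl hk⟩
      · exact ⟨k + 1, Or.inr (by omega)⟩
    have hle := le_defect_of_zero (D := cnt (x :: t))
      (cnt_eq_zero fun z hz => hpos z (List.mem_cons_of_mem _ hz)) (j - 1)
    have key : (x :: t).length + 1 ≤ j + defect (cnt (x :: t)) (j - 1) := by
      by_cases hcase : Y = 2 * j ∧ x + 1 = Y
      · have h1 : ¬ (Y + (remRev t).length + 1 < 2 * (t.length + 2)) := fun hlt =>
          h ⟨⟨j, by omega⟩, hcase.2, hlt⟩
        have hih := (ih' hl3.2 (fun z hz => hpos z (by simp [hz])) (j - 1)).1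
        have : cnt (remRev t) (2 * (j - 1)) = (remRev t).length :=
          cnt_eq_length fun z hz => by have := htx z ((remRev_sublist t).subset hz); omega
        rw [defect_cons_of_lt (j := j) (by omega) (by omega), List.length_cons]
        omega
      · have : cnt (x :: t) (2 * (j - 1)) = (x :: t).length :=
          cnt_eq_length fun z hz => by
            rcases List.mem_cons.1 hz with rfl | hz'
            · have := hYt z (by simp); omega
            · have := hYt x (by simp); have := htx z hz'; omega
        omega
    have hd : ∀ y, defect (cnt (Y :: x :: t)) y = defect (cnt (x :: t)) y := fun y => by
      rcases lt_or_ge y j with hy | hy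
      · exact defect_cons_of_lt hj hy
      · rw [defect_cons hYt (by omega) hj hy,
          defect_last (j := j) (fun z hz => by have := hYt z hz; omega) (by omega) (by omega) hy]
        omega
    rw [hd, hd]
    exact ih y

theorem red_sublist (a : List ℕ) : (red a).Sublist a := List.filter_sublist

theorem isRed_red {N : ℕ} {a : List ℕ} (ha : IsCol N a) : IsRed (cnt a) (cnt (red a)) := by
  have hrev : ∀ l : List ℕ, cnt l.reverse = cnt l := fun l => by
    funext y; simp [cnt]
  have hsub : (rem a).Sublist a := by
    have := (remRev_sublist a.reverse).reverse
    rwa [List.reverse_reverse] at this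
  have hsum : ∀ y, cnt (red a) y + cnt (rem a) y = cnt a y := fun y => by
    have hperm : (rem a).Perm (a.filter fun x => x ∈ rem a) := by
      rw [List.perm_ext_iff_of_nodup (ha.sublist hsub).nodup (ha.nodup.sublist List.filter_sublist)]
      intro x
      simpa using fun hx => hsub.subset hx
    have h1 : cnt (rem a) y = cnt (a.filter fun x => x ∈ rem a) y := hperm.countP_eq _
    rw [h1, red, cnt, cnt, cnt, List.countP_filter, List.countP_filter,
      List.countP_eq_countP_filter_add a (fun x => decide (x ≤ y)) (fun x => x ∉ rem a),
      List.countP_filter, List.countP_filter]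
    simp
  intro y
  have h := cnt_remRev a.reverse (by rw [List.pairwise_reverse]; exact ha.1)
    (fun x hx => (ha.2 x (List.mem_reverse.1 hx)).1) y
  rw [hrev] at h
  have h2 : cnt (rem a) = cnt (remRev a.reverse) := hrev _
  have := hsum (2 * y)
  have := hsum (2 * y + 1)
  rw [h2] at *
  omega

/-! ### Tableaux as lists of columns -/

/-- The counting functions of the columns of a tableau given as a list. -/
def counts (C : List (List ℕ)) (j : ℕ) : ℕ → ℕ := cnt (C.getD j [])

/-- A semistandard tableau given as the list of its columns. -/
structure IsTab (N : ℕ) (C : List (List ℕ)) : Prop where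
  col : ∀ c ∈ C, IsCol N c
  ne_nil : ∀ c ∈ C, c ≠ []
  anti : ∀ j y, counts C (j + 1) y ≤ counts C j y

theorem counts_eq_zero {C : List (List ℕ)} {j : ℕ} (h : C.length ≤ j) : counts C j = 0 := by
  rw [counts, List.getD_eq_default _ _ h]; rfl

theorem isCol_nil (N : ℕ) : IsCol N [] := ⟨List.Pairwise.nil, by simp⟩

theorem isCol_getD {N : ℕ} {C : List (List ℕ)} (h : ∀ c ∈ C, IsCol N c) (j : ℕ) :
    IsCol N (C.getD j []) := by
  rcases lt_or_ge j C.length with hj | hj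
  · rw [List.getD_eq_getElem _ _ hj]
    exact h _ (List.getElem_mem hj)
  · rw [List.getD_eq_default _ _ hj]; exact isCol_nil N

theorem counts_last {N : ℕ} {C : List (List ℕ)} (h : ∀ c ∈ C, IsCol N c) (j : ℕ) :
    counts C j N = (C.getD j []).length :=
  (isCol_getD h j).cnt_last

theorem IsTab.isTableau {N : ℕ} {C : List (List ℕ)} (h : IsTab N C) : IsTableau N (counts C) where
  count j := (isCol_getD h.col j).isCount
  anti := h.anti
  fin := ⟨C.length, fun _ hj => counts_eq_zero hj⟩

theorem IsTab.ext {N : ℕ} {C C' : List (List ℕ)} (h : IsTab N C) (h' : IsTab N C')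
    (he : counts C = counts C') : C = C' := by
  have hcol : ∀ j, C.getD j [] = C'.getD j [] := fun j =>
    (isCol_getD h.col j).ext (isCol_getD h'.col j) (congrFun he j)
  have hlen : ∀ {C C' : List (List ℕ)}, IsTab N C → IsTab N C' →
      (∀ j, C.getD j [] = C'.getD j []) → C.length ≤ C'.length := by
    intro C C' h h' hcol
    by_contra hc
    have h1 := hcol C'.length
    rw [List.getD_eq_default C' _ le_rfl, List.getD_eq_getElem _ _ (by omega)] at h1
    exact h.ne_nil _ (List.getElem_mem _) h1
  have hl := le_antisymm (hlen h h' hcol) (hlen h' h fun j => (hcol j).symm)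
  refine List.ext_getElem hl fun j h1 h2 => ?_
  have := hcol j
  rwa [List.getD_eq_getElem _ _ h1, List.getD_eq_getElem _ _ h2] at this

/-- The list algorithm for the product of a column with a tableau. -/
theorem isMul_colMul {N : ℕ} {C : List (List ℕ)} : ∀ {a : List ℕ}, IsCol N a →
    (∀ c ∈ C, IsCol N c) → (∀ c ∈ C, c ≠ []) →
    (∀ c ∈ colMul a C, IsCol N c) ∧ (∀ c ∈ colMul a C, c ≠ []) ∧
      ∃ β, β 0 = cnt a ∧ IsMul N β (counts C) (counts (colMul a C)) := by
  induction C with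
  | nil =>
    intro a ha _ _
    have hb : IsBump (cnt a) 0 (cnt a) 0 :=
      ⟨fun _ => rfl, fun z y _ => by simp,
        fun y => ⟨0, Nat.zero_le y, by simp [ha.isCount.zero]⟩⟩
    have hβ : ∃ β : ℕ → ℕ → ℕ, β 0 = cnt a ∧ (∀ j, β (j + 1) = 0) :=
      ⟨fun j => Nat.casesOn j (cnt a) 0, rfl, fun _ => rfl⟩
    obtain ⟨β, hβ0, hβ1⟩ := hβ
    have hS : counts (colMul a []) = β := by
      funext j
      rcases List.eq_nil_or_concat a with h | h
      · subst h
        cases j with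
        | zero => rw [hβ0]; rfl
        | succ j => rw [hβ1]; rfl
      · have hne : a ≠ [] := by obtain ⟨_, _, rfl⟩ := h; simp
        rw [colMul_nil ha.1 hne]
        cases j with
        | zero => rw [hβ0]; rfl
        | succ j => rw [hβ1]; rfl
    refine ⟨?_, ?_, β, hβ0, ⟨?_, ?_, 1, ?_⟩⟩
    · intro c hc
      by_cases hne : a = []
      · subst hne; simp [colMul] at hc
      · rw [colMul_nil ha.1 hne] at hc
        obtain rfl : c = a := by simpa using hc
        exact ha
    · intro c hc
      by_cases hne : a = []
      · subst hne; simp [colMul] at hc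
      · rw [colMul_nil ha.1 hne] at hc
        obtain rfl : c = a := by simpa using hc
        exact hne
    · rintro (_ | j)
      · rw [hβ0]; exact ha.isCount
      · rw [hβ1]; exact isCount_zero N
    · rw [hS]
      rintro (_ | j)
      · rw [hβ0, hβ1]; exact hb
      · rw [hβ1, hβ1]; exact ⟨fun _ => rfl, fun _ _ _ => le_rfl, fun y => ⟨y, le_rfl, rfl⟩⟩
    · rintro (_ | j) hj
      · omega
      · exact hβ1 j
  | cons c C ih =>
    intro a ha hC hne
    have hc := hC c (by simp)
    obtain ⟨h1, h2, h3, -⟩ := isBump_insCol ha hc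
    obtain ⟨i1, i2, β, hβ0, hM⟩ := ih h2 (fun c hc => hC c (by simp [hc]))
      (fun c hc => hne c (by simp [hc]))
    rw [colMul_cons]
    refine ⟨?_, ?_, fun j => Nat.casesOn j (cnt a) β, rfl, ⟨?_, ?_, ?_⟩⟩
    · intro d hd
      rcases List.mem_cons.1 hd with rfl | hd
      · exact h1
      · exact i1 d hd
    · intro d hd
      rcases List.mem_cons.1 hd with rfl | hd
      · intro h0
        have := h3.le_right N
        rw [h0, hc.cnt_last] at this
        exact hne c (by simp) (List.eq_nil_of_length_eq_zero (by simpa using this))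
      · exact i2 d hd
    · rintro (_ | j)
      · exact ha.isCount
      · exact hM.count j
    · rintro (_ | j)
      · change IsBump (cnt a) (cnt c) (cnt (insCol a c).1) (β 0)
        rw [hβ0]; exact h3
      · exact hM.bump j
    · obtain ⟨m, hm⟩ := hM.fin
      refine ⟨m + 1, ?_⟩
      rintro (_ | j) hj
      · omega
      · exact hm j (by omega)

/-- One step of the list algorithm. -/
theorem isSuc_suc {n : ℕ} {C : List (List ℕ)} (h : IsTab (2 * n) C) :
    IsTab (2 * n) (suc C) ∧ ∃ β, IsSuc n (counts C) (counts (suc C)) β := by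
  cases C with
  | nil => exact ⟨h, _, isSuc_self h.isTableau fun y => Nat.zero_le y⟩
  | cons a C =>
    have ha := h.col a (by simp)
    obtain ⟨h1, h2, β, hβ, hM⟩ := isMul_colMul (ha.sublist (red_sublist a))
      (fun c hc => h.col c (List.mem_cons_of_mem _ hc))
      (fun c hc => h.ne_nil c (List.mem_cons_of_mem _ hc))
    have hs : IsSuc n (counts (a :: C)) (counts (suc (a :: C))) β :=
      ⟨by rw [hβ]; exact isRed_red ha, hM⟩
    exact ⟨⟨h1, h2, (hs.isTableau h.isTableau).anti⟩, β, hs⟩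

theorem isTab_iterate {n : ℕ} {C : List (List ℕ)} (h : IsTab (2 * n) C) (k : ℕ) :
    IsTab (2 * n) (suc^[k] C) := by
  induction k with
  | zero => exact h
  | succ k ih => rw [Function.iterate_succ_apply']; exact (isSuc_suc ih).1

/-- The list of the columns of a tableau. -/
noncomputable def colList (N m : ℕ) (T : ℕ → ℕ → ℕ) : List (List ℕ) :=
  (List.range m).map fun j => ofCount N (T j)

/-- Every tableau is given by a list of columns. -/
theorem exists_isTab {N : ℕ} {T : ℕ → ℕ → ℕ} (hT : IsTableau N T) :
    ∃ C, IsTab N C ∧ counts C = T := by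
  classical
  obtain ⟨m₀, hm₀⟩ := hT.fin
  have hex : ∃ m, ∀ j ≥ m, T j = 0 := ⟨m₀, hm₀⟩
  have hm := Nat.find_spec hex
  set m := Nat.find hex with hmdef
  have hcounts : counts (colList N m T) = T := by
    funext j
    rcases lt_or_ge j m with hj | hj
    · rw [counts, colList, List.getD_eq_getElem _ _ (by simpa using hj)]
      simp only [List.getElem_map, List.getElem_range]
      exact cnt_ofCount (hT.count j)
    · rw [hm j hj, counts_eq_zero (by simpa [colList] using hj)]
  refine ⟨colList N m T, ⟨fun c hc => ?_, fun c hc h0 => ?_, ?_⟩, hcounts⟩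
  · obtain ⟨j, -, rfl⟩ := List.mem_map.1 hc
    exact isCol_ofCount N _
  · obtain ⟨j, hj, rfl⟩ := List.mem_map.1 hc
    rw [List.mem_range] at hj
    refine Nat.find_min hex hj fun i hi => ?_
    have hj0 : T j = 0 := by rw [← cnt_ofCount (hT.count j), h0]; rfl
    induction i, hi using Nat.le_induction with
    | base => exact hj0
    | succ i _ ih =>
      funext y
      have := hT.anti i y
      rw [ih] at this
      simpa using this
  · rw [hcounts]; exact hT.anti

/-! ### Fillings and lists of columns -/

theorem colLen_eq_zero {lam : YoungDiagram} {j : ℕ} (h : lam.rowLen 0 ≤ j) : lam.colLen j = 0 := by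
  by_contra hc
  have h1 : (0, j) ∈ lam := YoungDiagram.mem_iff_lt_colLen.2 (by omega)
  rw [YoungDiagram.mem_iff_lt_rowLen] at h1
  omega

theorem le_iff_colLen {mu lam : YoungDiagram} : mu ≤ lam ↔ ∀ j, mu.colLen j ≤ lam.colLen j := by
  rw [← YoungDiagram.cells_subset_iff]
  constructor
  · intro h j
    by_contra hc
    have h1 : (lam.colLen j, j) ∈ mu := YoungDiagram.mem_iff_lt_colLen.2 (by omega)
    have h2 := h ((YoungDiagram.mem_cells _).2 h1)
    rw [YoungDiagram.mem_cells, YoungDiagram.mem_iff_lt_colLen] at h2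
    omega
  · rintro h ⟨i, j⟩ hc
    rw [YoungDiagram.mem_cells, YoungDiagram.mem_iff_lt_colLen] at hc ⊢
    exact hc.trans_le (h j)

/-- A decreasing sequence which is eventually zero is the sequence of column lengths of a
diagram. -/
theorem exists_diagram {L : ℕ → ℕ} (hL : ∀ j, L (j + 1) ≤ L j) (hfin : ∃ m, ∀ j ≥ m, L j = 0) :
    ∃ mu : YoungDiagram, ∀ j, mu.colLen j = L j := by
  obtain ⟨m, hm⟩ := hfin
  have hanti : Antitone L := antitone_nat_of_succ_le hL
  have hmem : ∀ i j, (i, j) ∈ ((Finset.range (L 0)) ×ˢ (Finset.range m)).filter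
      (fun c : ℕ × ℕ => c.1 < L c.2) ↔ i < L j := fun i j => by
    simp only [Finset.mem_filter, Finset.mem_product, Finset.mem_range]
    refine ⟨fun h => h.2, fun h => ⟨⟨h.trans_le (hanti (Nat.zero_le j)), ?_⟩, h⟩⟩
    by_contra hc
    rw [hm j (by omega)] at h
    omega
  obtain ⟨mu, hmu⟩ : ∃ mu : YoungDiagram, ∀ i j, (i, j) ∈ mu ↔ i < L j := by
    refine ⟨⟨((Finset.range (L 0)) ×ˢ (Finset.range m)).filter
      (fun c : ℕ × ℕ => c.1 < L c.2), ?_⟩, fun i j => hmem i j⟩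
    rintro ⟨i, j⟩ ⟨i', j'⟩ ⟨hi, hj⟩ h
    rw [Finset.mem_coe, hmem] at h ⊢
    exact lt_of_le_of_lt hi (h.trans_le (hanti hj))
  exact ⟨mu, fun j => eq_of_forall_lt_iff fun i => by
    rw [← YoungDiagram.mem_iff_lt_colLen, hmu]⟩

theorem getD_toCols (lam : YoungDiagram) (T : Filling) (j : ℕ) :
    (toCols lam T).getD j [] = (List.range (lam.colLen j)).map fun i => T i j := by
  rcases lt_or_ge j (lam.rowLen 0) with hj | hj
  · rw [toCols, List.getD_eq_getElem _ _ (by simpa using hj)]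
    simp
  · rw [List.getD_eq_default _ _ (by simpa [toCols] using hj), colLen_eq_zero hj]
    rfl

theorem length_toCols (lam : YoungDiagram) (T : Filling) (j : ℕ) :
    ((toCols lam T).getD j []).length = lam.colLen j := by
  rw [getD_toCols, List.length_map, List.length_range]

theorem getD_toCols_getD {lam : YoungDiagram} (T : Filling) {i j : ℕ} (h : i < lam.colLen j) :
    ((toCols lam T).getD j []).getD i 0 = T i j := by
  rw [getD_toCols, List.getD_eq_getElem _ _ (by simpa using h)]
  simp

theorem lt_of_col_strict {N : ℕ} {lam : YoungDiagram} {T : Filling} (h : IsSST N lam ⊥ T)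
    {i i' j : ℕ} (hi : i < i') (hi' : i' < lam.colLen j) : T i j < T i' j := by
  induction i', hi using Nat.le_induction with
  | base =>
    exact h.col_strict i j (YoungDiagram.notMem_bot _) (YoungDiagram.mem_iff_lt_colLen.2 hi')
  | succ i' _ ih =>
    exact (ih (by omega)).trans
      (h.col_strict i' j (YoungDiagram.notMem_bot _) (YoungDiagram.mem_iff_lt_colLen.2 hi'))

theorem isCol_toCols {N : ℕ} {lam : YoungDiagram} {T : Filling} (h : IsSST N lam ⊥ T) (j : ℕ) :
    IsCol N ((List.range (lam.colLen j)).map fun i => T i j) := by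
  constructor
  · rw [List.pairwise_iff_getElem]
    intro i i' hi hi' hlt
    simp only [List.getElem_map, List.getElem_range]
    simp only [List.length_map, List.length_range] at hi'
    exact lt_of_col_strict h hlt hi'
  · intro x hx
    obtain ⟨i, hi, rfl⟩ := List.mem_map.1 hx
    rw [List.mem_range] at hi
    exact ⟨(h.pos_iff i j).2 ⟨YoungDiagram.mem_iff_lt_colLen.2 hi, YoungDiagram.notMem_bot _⟩,
      h.le_max i j⟩

theorem isTab_toCols {N : ℕ} {lam : YoungDiagram} {T : Filling} (h : IsSST N lam ⊥ T) :
    IsTab N (toCols lam T) where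
  col c hc := by
    obtain ⟨j, -, rfl⟩ := List.mem_map.1 hc
    exact isCol_toCols h j
  ne_nil c hc := by
    obtain ⟨j, hj, rfl⟩ := List.mem_map.1 hc
    rw [List.mem_range, ← YoungDiagram.mem_iff_lt_rowLen, YoungDiagram.mem_iff_lt_colLen] at hj
    intro h0
    have := congrArg List.length h0
    simp at this
    omega
  anti j y := by
    by_contra hc
    have hlen : ∀ j, ((toCols lam T).getD j []).length = lam.colLen j := length_toCols lam T
    have hcol : ∀ j, IsCol N ((toCols lam T).getD j []) := fun j => by
      rw [getD_toCols]; exact isCol_toCols h j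
    set i := counts (toCols lam T) j y with hi
    have h1 : i < counts (toCols lam T) (j + 1) y := by omega
    have h2 : counts (toCols lam T) (j + 1) y ≤ lam.colLen (j + 1) := by
      rw [← hlen]; exact List.countP_le_length
    have h3 : lam.colLen (j + 1) ≤ lam.colLen j := lam.colLen_anti _ _ (Nat.le_succ j)
    have h4 := ((hcol (j + 1)).getD_le_iff (i := i) (by rw [hlen]; omega) y).2 h1
    rw [getD_toCols_getD T (by omega)] at h4
    have h5 := h.row_weak i j (YoungDiagram.notMem_bot _)
      (YoungDiagram.mem_iff_lt_colLen.2 (by omega))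
    have h6 := ((hcol j).getD_le_iff (i := i) (by rw [hlen]; omega) y).1
      (by rw [getD_toCols_getD T (by omega)]; omega)
    exact absurd h6 (lt_irrefl _)

/-- A list of columns of shape `lam` is the list of the columns of a semistandard tableau. -/
theorem toCols_ofCols {N : ℕ} {lam : YoungDiagram} {C : List (List ℕ)} (hC : IsTab N C)
    (hlen : ∀ j, (C.getD j []).length = lam.colLen j) :
    IsSST N lam ⊥ (ofCols C) ∧ toCols lam (ofCols C) = C := by
  have hcol := isCol_getD hC.col
  have hsst : IsSST N lam ⊥ (ofCols C) := by
    have hzero : ∀ i j, lam.colLen j ≤ i → ofCols C i j = 0 := fun i j h => by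
      rw [ofCols, List.getD_eq_default]
      rwa [hlen]
    have hmem : ∀ i j, i < lam.colLen j → ofCols C i j ∈ C.getD j [] := fun i j h => by
      rw [ofCols, List.getD_eq_getElem (C.getD j []) _ (by rwa [hlen])]
      exact List.getElem_mem _
    refine ⟨fun i j => ?_, fun i j => ?_, fun i j _ h => ?_, fun i j _ h => ?_⟩
    · rw [YoungDiagram.mem_iff_lt_colLen]
      constructor
      · intro h
        refine ⟨?_, YoungDiagram.notMem_bot _⟩
        by_contra hc
        rw [hzero i j (by omega)] at h
        omega
      · exact fun h => ((hcol j).2 _ (hmem i j h.1)).1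
    · rcases lt_or_ge i (lam.colLen j) with h | h
      · exact ((hcol j).2 _ (hmem i j h)).2
      · rw [hzero i j h]; exact Nat.zero_le N
    · rw [YoungDiagram.mem_iff_lt_colLen] at h
      have h1 := lam.colLen_anti _ _ (Nat.le_succ j)
      have h2 := ((hcol (j + 1)).getD_le_iff (i := i) (by rwa [hlen])
        (ofCols C i (j + 1))).1 le_rfl
      exact ((hcol j).getD_le_iff (i := i) (by rw [hlen]; exact h.trans_le h1)
        (ofCols C i (j + 1))).2 (h2.trans_le (hC.anti j _))
    · rw [YoungDiagram.mem_iff_lt_colLen] at h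
      have h1 := (hcol j).1
      rw [List.pairwise_iff_getElem] at h1
      have h2 := h1 i (i + 1) (by rw [hlen]; omega) (by rw [hlen]; omega) (Nat.lt_succ_self i)
      rwa [ofCols, ofCols, List.getD_eq_getElem (C.getD j []) _ (by rw [hlen]; omega),
        List.getD_eq_getElem (C.getD j []) _ (by rw [hlen]; omega)]
  refine ⟨hsst, (isTab_toCols hsst).ext hC ?_⟩
  funext j
  rw [counts, counts, getD_toCols, ← hlen]
  congr 1
  refine List.ext_getElem (by simp) fun i h1 h2 => ?_
  simp only [List.getElem_map, List.getElem_range]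
  rw [ofCols, List.getD_eq_getElem _ _ h2]

theorem ofCols_toCols {N : ℕ} {lam : YoungDiagram} {T : Filling} (h : IsSST N lam ⊥ T) :
    ofCols (toCols lam T) = T := by
  funext i j
  rcases lt_or_ge i (lam.colLen j) with hi | hi
  · exact getD_toCols_getD T hi
  · rw [ofCols, List.getD_eq_default _ _ (by rwa [length_toCols])]
    have h1 := mt (h.pos_iff i j).1 (by
      rw [YoungDiagram.mem_iff_lt_colLen]
      omega)
    omega

/-! ### The iteration of the successor map -/

theorem suc_eq_self {n : ℕ} {C : List (List ℕ)} (hC : IsTab (2 * n) C)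
    (h : ∀ y, counts C 0 (2 * y) ≤ y) : suc C = C := by
  obtain ⟨h1, β, hβ⟩ := isSuc_suc hC
  exact h1.ext hC (hβ.unique (isSuc_self hC.isTableau h))

/-- Each step makes the tableau smaller, unless the first column is symplectic. -/
theorem suc_eq_self_or_size_lt {n m : ℕ} {C : List (List ℕ)} (hC : IsTab (2 * n) C)
    (hm : ∀ j ≥ m, counts C j = 0) :
    (∀ y, counts C 0 (2 * y) ≤ y) ∨ ∑ j ∈ Finset.range m, counts (suc C) j (2 * n) <
      ∑ j ∈ Finset.range m, counts C j (2 * n) := by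
  obtain ⟨h1, β, hβ⟩ := isSuc_suc hC
  have hle := fun j => hβ.le hC.isTableau j (2 * n)
  by_cases h : ∀ j, counts (suc C) j (2 * n) = counts C j (2 * n)
  · exact Or.inl (hβ.symplectic hC.isTableau h)
  · right
    obtain ⟨j, hj⟩ := not_forall.1 h
    refine Finset.sum_lt_sum (fun j _ => hle j) ⟨j, ?_, lt_of_le_of_ne (hle j) hj⟩
    rw [Finset.mem_range]
    by_contra hc
    have := hle j
    rw [hm j (by omega)] at this hj
    simp only [Pi.zero_apply] at this hj
    omega

theorem card_eq_sum_colLen (lam : YoungDiagram) :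
    lam.card = ∑ j ∈ Finset.range (lam.rowLen 0), lam.colLen j := by
  rw [YoungDiagram.card, Finset.card_eq_sum_card_fiberwise (f := Prod.snd)
    (t := Finset.range (lam.rowLen 0))]
  · refine Finset.sum_congr rfl fun j _ => ?_
    rw [YoungDiagram.colLen_eq_card]
    rfl
  · rintro ⟨i, j⟩ h
    simp only [Finset.coe_range, Set.mem_Iio]
    rw [← YoungDiagram.mem_iff_lt_rowLen]
    exact lam.up_left_mem (Nat.zero_le i) le_rfl h

/-- After `|λ|` steps the first column is symplectic. -/
theorem symplectic_iterate {n : ℕ} {lam : YoungDiagram} {T : Filling} (hT : T ∈ SST n lam) (y : ℕ) :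
    counts (suc^[lam.card] (toCols lam T)) 0 (2 * y) ≤ y := by
  set C := toCols lam T with hCdef
  have hC : IsTab (2 * n) C := isTab_toCols hT
  have hzero : ∀ k, ∀ j ≥ lam.rowLen 0, counts (suc^[k] C) j = 0 := fun k => by
    induction k with
    | zero => exact fun j hj => counts_eq_zero (by simpa [hCdef, toCols] using hj)
    | succ k ih =>
      intro j hj
      rw [Function.iterate_succ_apply']
      obtain ⟨-, β, hβ⟩ := isSuc_suc (isTab_iterate hC k)
      funext y
      have := hβ.le (isTab_iterate hC k).isTableau j y
      rw [ih j hj] at this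
      simpa using this
  have key : ∀ k, (∀ y, counts (suc^[k] C) 0 (2 * y) ≤ y) ∨
      ∑ j ∈ Finset.range (lam.rowLen 0), counts (suc^[k] C) j (2 * n) + k ≤ lam.card := fun k => by
    induction k with
    | zero =>
      right
      rw [card_eq_sum_colLen, Nat.add_zero]
      refine Finset.sum_le_sum fun j _ => ?_
      rw [Function.iterate_zero_apply, counts_last hC.col, length_toCols]
    | succ k ih =>
      rw [Function.iterate_succ_apply']
      have hk := isTab_iterate hC k
      rcases suc_eq_self_or_size_lt hk (hzero k) with h | h
      · left
        rwa [suc_eq_self hk h]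
      · rcases ih with h' | h'
        · left
          rwa [suc_eq_self hk h']
        · right
          omega
  rcases key lam.card with h | h
  · exact h y
  · have h0 : counts (suc^[lam.card] C) 0 (2 * n) = 0 := by
      rcases lt_or_ge 0 (lam.rowLen 0) with h1 | h1
      · have := Finset.single_le_sum (f := fun j => counts (suc^[lam.card] C) j (2 * n))
          (fun _ _ => Nat.zero_le _) (Finset.mem_range.2 h1)
        omega
      · rw [hzero _ 0 h1]; rfl
    have := ((isTab_iterate hC lam.card).isTableau.count 0).le_last (2 * y)
    omega

theorem suc_iterate_of_ge {n : ℕ} {lam : YoungDiagram} {T : Filling} (hT : T ∈ SST n lam) {k : ℕ}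
    (hk : lam.card ≤ k) : suc^[k] (toCols lam T) = suc^[lam.card] (toCols lam T) := by
  induction k, hk using Nat.le_induction with
  | base => rfl
  | succ k _ ih =>
    rw [Function.iterate_succ_apply', ih]
    exact suc_eq_self (isTab_iterate (isTab_toCols hT) _) (symplectic_iterate hT)

/-- A chain of vertical strips satisfying the conditions that characterise the recording tableaux.
The number `L k j` is the length of column `j` of the `k`-th shape, and `h k j` is the number of
cells in the columns `≥ j` of the strip between the shapes `k` and `k + 1`. -/
structure IsStripChain (n : ℕ) (L h : ℕ → ℕ → ℕ) : Prop where
  le : ∀ k j, L (k + 1) j ≤ L k j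
  vert : ∀ k j, L k (j + 1) ≤ L (k + 1) j
  tail : ∀ k, IsTail (L k) (L (k + 1)) (h k)
  lattice : ∀ k j, h (k + 1) j ≤ h k (j + 1)
  even : ∀ k, Even (h k 0)
  len : ∀ k, 2 * L k 0 ≤ 2 * n + h k 0

theorem exists_tail {L S : ℕ → ℕ} (hle : ∀ j, S j ≤ L j) (hfin : ∃ m, ∀ j ≥ m, L j = 0) :
    ∃ h, IsTail L S h := by
  obtain ⟨m, hm⟩ := hfin
  refine ⟨fun j => ∑ i ∈ Finset.Ico j m, (L i - S i), fun j => ?_, m, fun j hj => ?_⟩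
  · have := hle j
    rcases lt_or_ge j m with hj | hj
    · rw [Finset.sum_eq_sum_Ico_succ_bot hj]
      omega
    · have := hm j hj
      rw [Finset.Ico_eq_empty (by omega), Finset.Ico_eq_empty (by omega), Finset.sum_empty]
      omega
  · rw [Finset.Ico_eq_empty (by omega), Finset.sum_empty]

/-- The lengths of the columns of the tableaux obtained by iterating the successor map. -/
def chain (n : ℕ) (C : List (List ℕ)) (k j : ℕ) : ℕ := counts (suc^[k] C) j (2 * n)

theorem chain_isStripChain {n : ℕ} {C : List (List ℕ)} (hC : IsTab (2 * n) C) :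
    ∃ h, IsStripChain n (chain n C) h := by
  have hs : ∀ k, ∃ β, IsSuc n (counts (suc^[k] C)) (counts (suc^[k + 1] C)) β := fun k => by
    rw [Function.iterate_succ_apply']
    exact (isSuc_suc (isTab_iterate hC k)).2
  have ht := fun k => (isTab_iterate hC k).isTableau
  have hle : ∀ k j, chain n C (k + 1) j ≤ chain n C k j := fun k j => by
    obtain ⟨β, hβ⟩ := hs k
    exact hβ.le (ht k) j _
  have hfin : ∀ k, ∃ m, ∀ j ≥ m, chain n C k j = 0 := fun k => by
    obtain ⟨m, hm⟩ := (ht k).fin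
    exact ⟨m, fun j hj => by rw [chain, hm j hj]; rfl⟩
  choose h hh using fun k => exists_tail (hle k) (hfin k)
  refine ⟨h, hle, fun k j => ?_, hh, fun k j => ?_, fun k => ?_, fun k => ?_⟩
  · obtain ⟨β, hβ⟩ := hs k
    exact hβ.succ_le j _
  · obtain ⟨β, hβ⟩ := hs k
    obtain ⟨ε, hε⟩ := hs (k + 1)
    exact hβ.tail_le hε (ht k) (hh k) (hh (k + 1)) j
  · obtain ⟨β, hβ⟩ := hs k
    rw [(hβ.tail_zero (ht k) (hh k)).1]
    exact even_two_mul _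
  · obtain ⟨β, hβ⟩ := hs k
    exact (hβ.tail_zero (ht k) (hh k)).2

/-- Every chain of strips ending with the shape of a symplectic tableau arises from iterating the
successor map. -/
theorem exists_chain {n K : ℕ} {L h : ℕ → ℕ → ℕ} {S : List (List ℕ)} (hL : IsStripChain n L h)
    (hS : IsTab (2 * n) S) (hsp : ∀ y, counts S 0 (2 * y) ≤ y)
    (hSL : ∀ k ≥ K, ∀ j, counts S j (2 * n) = L k j) :
    ∃ C, IsTab (2 * n) C ∧ suc^[K] C = S ∧ ∀ k j, chain n C k j = L k j := by
  have hfix : suc S = S := suc_eq_self hS hsp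
  -- The steps are undone one after the other; the chain starting at `k` needs `K - k` steps.
  have key : ∀ d k, k + d = K → ∃ C, IsTab (2 * n) C ∧ suc^[d] C = S ∧
      ∀ i j, chain n C i j = L (k + i) j := fun d => by
    induction d with
    | zero =>
      intro k hk
      refine ⟨S, hS, rfl, fun i j => ?_⟩
      rw [chain, Function.iterate_fixed hfix, hSL (k + i) (by omega)]
    | succ d ih =>
      intro k hk
      obtain ⟨C', hC', hd, hch⟩ := ih (k + 1) (by omega)
      obtain ⟨h1, ε, hε⟩ := isSuc_suc hC'
      have e0 : ∀ j, counts C' j (2 * n) = L (k + 1) j := fun j => hch 0 j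
      have e1 : ∀ j, counts (suc C') j (2 * n) = L (k + 1 + 1) j := fun j => hch 1 j
      obtain ⟨T, β, hT, hTβ, hTL⟩ := exists_pred hC'.isTableau hε (L := L k) (h := h k)
        (h' := h (k + 1)) (fun j => by rw [e0]; exact hL.le k j)
        (fun j => by rw [e0]; exact hL.vert k j)
        (by simp only [e0]; exact hL.tail k) (by simp only [e0, e1]; exact hL.tail (k + 1))
        (hL.lattice k) (hL.even k) (hL.len k)
      obtain ⟨C, hC, hCT⟩ := exists_isTab hT
      obtain ⟨h2, β', hβ'⟩ := isSuc_suc hC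
      have hsuc : suc C = C' := by
        refine h2.ext hC' ?_
        rw [hCT] at hβ'
        exact hβ'.unique hTβ
      refine ⟨C, hC, by rw [Function.iterate_succ_apply, hsuc, hd], fun i j => ?_⟩
      cases i with
      | zero => rw [chain, Function.iterate_zero_apply, hCT]; exact hTL j
      | succ i =>
        rw [chain, Function.iterate_succ_apply, hsuc, show k + (i + 1) = k + 1 + i by ring]
        exact hch i j
  obtain ⟨C, hC, hK, hch⟩ := key K 0 (by omega)
  exact ⟨C, hC, hK, fun k j => by rw [hch, Nat.zero_add]⟩

/-- A tableau is determined by its chain of shapes and its final tableau. -/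
theorem eq_of_chain_eq {n K : ℕ} {C C' : List (List ℕ)} (hC : IsTab (2 * n) C)
    (hC' : IsTab (2 * n) C') (hch : chain n C = chain n C') (hK : suc^[K] C = suc^[K] C') :
    C = C' := by
  have key : ∀ d k, k + d = K → suc^[k] C = suc^[k] C' := fun d => by
    induction d with
    | zero => intro k hk; obtain rfl : k = K := by omega
              exact hK
    | succ d ih =>
      intro k hk
      have h1 := ih (k + 1) (by omega)
      obtain ⟨-, β, hβ⟩ := isSuc_suc (isTab_iterate hC k)
      obtain ⟨-, β', hβ'⟩ := isSuc_suc (isTab_iterate hC' k)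
      rw [← Function.iterate_succ_apply' suc] at hβ hβ'
      rw [← h1] at hβ'
      exact (isTab_iterate hC k).ext (isTab_iterate hC' k)
        (hβ.left_eq hβ' (isTab_iterate hC k).isTableau (isTab_iterate hC' k).isTableau
          fun j => congrFun (congrFun hch k) j)
  exact key K 0 (by omega)

/-! ### The filling of a chain of shapes -/

/-- The filling of a decreasing chain of shapes (given by their column lengths): a cell is filled
with the number `k ≥ 1` of the step that removes it, and with `0` if there is no such step. -/
noncomputable def stepFilling (L : ℕ → ℕ → ℕ) : Filling := fun i j =>
  sInf {k | 1 ≤ k ∧ i < L (k - 1) j ∧ ¬ i < L k j}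

theorem antitone_of_le {L : ℕ → ℕ → ℕ} (hL : ∀ k j, L (k + 1) j ≤ L k j) {k l : ℕ} (h : k ≤ l)
    (j : ℕ) : L l j ≤ L k j :=
  antitone_nat_of_succ_le (f := fun k => L k j) (fun k => hL k j) h

theorem stepFilling_eq {L : ℕ → ℕ → ℕ} (hL : ∀ k j, L (k + 1) j ≤ L k j) {i j k : ℕ}
    (h1 : i < L k j) (h2 : L (k + 1) j ≤ i) : stepFilling L i j = k + 1 := by
  have hset : {k | 1 ≤ k ∧ i < L (k - 1) j ∧ ¬ i < L k j} = {k + 1} := by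
    ext l
    simp only [Set.mem_ofPred_eq, Set.mem_singleton_iff]
    constructor
    · rintro ⟨h3, h4, h5⟩
      by_contra hc
      rcases lt_or_gt_of_ne hc with h | h
      · have := antitone_of_le hL (show l ≤ k by omega) j
        omega
      · have := antitone_of_le hL (show k + 1 ≤ l - 1 by omega) j
        omega
    · rintro rfl
      exact ⟨by omega, by simpa using h1, by omega⟩
  rw [stepFilling, hset, csInf_singleton]

theorem stepFilling_eq_zero {L : ℕ → ℕ → ℕ} {i j : ℕ}
    (h : ∀ k, i < L k j → i < L (k + 1) j) : stepFilling L i j = 0 := by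
  have hset : {k | 1 ≤ k ∧ i < L (k - 1) j ∧ ¬ i < L k j} = ∅ := by
    ext l
    simp only [Set.mem_ofPred_eq, Set.mem_empty_iff_false, iff_false]
    rintro ⟨h3, h4, h5⟩
    have := h (l - 1) h4
    rw [Nat.sub_add_cancel h3] at this
    exact h5 this
  rw [stepFilling, hset, Nat.sInf_empty]

/-- A chain of shapes is determined by its first shape and its filling. -/
theorem lt_chain_iff {L : ℕ → ℕ → ℕ} (hL : ∀ k j, L (k + 1) j ≤ L k j) {i j k : ℕ} :
    i < L k j ↔ i < L 0 j ∧ (stepFilling L i j = 0 ∨ k < stepFilling L i j) := by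
  by_cases h : ∃ l, i < L l j ∧ L (l + 1) j ≤ i
  · obtain ⟨l, h1, h2⟩ := h
    rw [stepFilling_eq hL h1 h2]
    have h0 := antitone_of_le hL (Nat.zero_le l) j
    constructor
    · intro h
      refine ⟨by omega, Or.inr ?_⟩
      by_contra hc
      have := antitone_of_le hL (show l + 1 ≤ k by omega) j
      omega
    · rintro ⟨_, h | h⟩
      · omega
      · have := antitone_of_le hL (show k ≤ l by omega) j
        omega
  · have h1 : ∀ l, i < L l j → i < L (l + 1) j := fun l hl => by
      by_contra hc
      exact h ⟨l, hl, by omega⟩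
    rw [stepFilling_eq_zero h1]
    constructor
    · intro hk
      have := antitone_of_le hL (Nat.zero_le k) j
      exact ⟨by omega, Or.inl rfl⟩
    · rintro ⟨h2, -⟩
      induction k with
      | zero => exact h2
      | succ k ih => exact h1 k ih

theorem exists_step {L : ℕ → ℕ → ℕ} {i j K : ℕ} (h0 : i < L 0 j) (hK : L K j ≤ i) :
    ∃ k, i < L k j ∧ L (k + 1) j ≤ i := by
  by_contra hc
  have : ∀ k, i < L k j := fun k => by
    induction k with
    | zero => exact h0
    | succ k ih =>
      by_contra h
      exact hc ⟨k, ih, by omega⟩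
  have := this K
  omega

/-! ### Multiplicities and the Yamanouchi property -/

/-- The number of entries `x` of a filling in the columns `≥ j`. -/
def mult (lam : YoungDiagram) (T : Filling) (x j : ℕ) : ℕ :=
  (lam.cells.filter (fun c => T c.1 c.2 = x ∧ j ≤ c.2)).card

/-- The number of entries `x` of a filling in column `j`. -/
def colMult (lam : YoungDiagram) (T : Filling) (x j : ℕ) : ℕ :=
  ((Finset.range (lam.colLen j)).filter fun i => T i j = x).card

theorem mult_succ (lam : YoungDiagram) (T : Filling) (x j : ℕ) :
    mult lam T x j = mult lam T x (j + 1) + colMult lam T x j := by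
  have h : colMult lam T x j =
      (lam.cells.filter (fun c => T c.1 c.2 = x ∧ c.2 = j)).card := by
    refine Finset.card_bij (fun i _ => (i, j)) (fun i hi => ?_) (fun i _ i' _ h => ?_)
      (fun c hc => ?_)
    · simp only [Finset.mem_filter, Finset.mem_range] at hi ⊢
      exact ⟨YoungDiagram.mem_iff_lt_colLen.2 hi.1, hi.2, trivial⟩
    · exact congrArg Prod.fst h
    · obtain ⟨i, j'⟩ := c
      simp only [Finset.mem_filter] at hc
      obtain ⟨h1, h2, rfl⟩ := hc
      exact ⟨i, by simpa using ⟨YoungDiagram.mem_iff_lt_colLen.1 h1, h2⟩, rfl⟩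
  rw [h, mult, mult, ← Finset.card_union_of_disjoint]
  · congr 1
    ext c
    simp only [Finset.mem_filter, Finset.mem_union]
    constructor
    · rintro ⟨h1, h2, h3⟩
      rcases h3.lt_or_eq with h | h
      · exact Or.inl ⟨h1, h2, h⟩
      · exact Or.inr ⟨h1, h2, h.symm⟩
    · rintro (⟨h1, h2, h3⟩ | ⟨h1, h2, h3⟩)
      · exact ⟨h1, h2, by omega⟩
      · exact ⟨h1, h2, h3.ge⟩
  · rw [Finset.disjoint_left]
    intro c h1 h2
    simp only [Finset.mem_filter] at h1 h2
    omega

theorem mult_zero (lam : YoungDiagram) (T : Filling) (x : ℕ) :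
    mult lam T x 0 = content lam T x := by
  simp [mult, content]

theorem mult_eq_zero {lam : YoungDiagram} (T : Filling) (x : ℕ) {j : ℕ} (h : lam.rowLen 0 ≤ j) :
    mult lam T x j = 0 := by
  rw [mult, Finset.card_eq_zero, Finset.filter_eq_empty_iff]
  rintro ⟨i, j'⟩ hc ⟨-, hj⟩
  have := YoungDiagram.mem_iff_lt_rowLen.1 (lam.up_left_mem (Nat.zero_le i) le_rfl hc)
  simp only at hj
  omega

theorem mult_anti (lam : YoungDiagram) (T : Filling) (x : ℕ) {j j' : ℕ} (h : j ≤ j') :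
    mult lam T x j' ≤ mult lam T x j :=
  antitone_nat_of_succ_le (f := fun j => mult lam T x j)
    (fun j => by rw [mult_succ lam T x j]; omega) h

/-- The reading word of column `j`. -/
def colWord (lam : YoungDiagram) (T : Filling) (j : ℕ) : List ℕ :=
  ((List.range (lam.colLen j)).map fun i => T i j).filter fun x => 0 < x

theorem count_colWord (lam : YoungDiagram) (T : Filling) {x : ℕ} (hx : 1 ≤ x) (j : ℕ) :
    (colWord lam T j).count x = colMult lam T x j := by
  rw [colWord, List.count_filter (by simpa using Nat.pos_of_ne_zero (by omega)), List.count,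
    List.countP_map, List.countP_eq_length_filter, colMult]
  rfl

theorem IsSST.lt_of_lt {N : ℕ} {lam mu : YoungDiagram} {T : Filling} (h : IsSST N lam mu T)
    {i i' j : ℕ} (hi : i < i') (hmu : mu.colLen j ≤ i) (hi' : i' < lam.colLen j) :
    T i j < T i' j := by
  have hm : ∀ i, mu.colLen j ≤ i → (i, j) ∉ mu := fun i hi => by
    rw [YoungDiagram.mem_iff_lt_colLen]; omega
  induction i', hi using Nat.le_induction with
  | base => exact h.col_strict i j (hm i hmu) (YoungDiagram.mem_iff_lt_colLen.2 hi')
  | succ i' h1 ih =>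
    exact (ih (by omega)).trans
      (h.col_strict i' j (hm i' (by omega)) (YoungDiagram.mem_iff_lt_colLen.2 hi'))

theorem IsSST.pos_iff_colLen {N : ℕ} {lam mu : YoungDiagram} {T : Filling} (h : IsSST N lam mu T)
    {i j : ℕ} : 0 < T i j ↔ i < lam.colLen j ∧ mu.colLen j ≤ i := by
  rw [h.pos_iff, YoungDiagram.mem_iff_lt_colLen, YoungDiagram.mem_iff_lt_colLen, not_lt]

theorem IsSST.colWord_pairwise {N : ℕ} {lam mu : YoungDiagram} {T : Filling}
    (h : IsSST N lam mu T) (j : ℕ) : (colWord lam T j).Pairwise (· < ·) := by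
  rw [colWord, List.pairwise_filter, List.pairwise_iff_getElem]
  intro i i' hi hi' hlt
  simp only [List.getElem_map, List.getElem_range, decide_eq_true_eq]
  simp only [List.length_map, List.length_range] at hi'
  intro h1 _
  exact h.lt_of_lt hlt (h.pos_iff_colLen.1 h1).2 hi'

theorem IsSST.colMult_le_one {N : ℕ} {lam mu : YoungDiagram} {T : Filling} (h : IsSST N lam mu T)
    {x : ℕ} (hx : 1 ≤ x) (j : ℕ) : colMult lam T x j ≤ 1 := by
  rw [← count_colWord lam T hx]
  exact List.nodup_iff_count_le_one.1 ((h.colWord_pairwise j).imp fun h => h.ne) x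

/-- The reading word of the columns `j, …, j + k - 1`. -/
def partialWord (lam : YoungDiagram) (T : Filling) (j k : ℕ) : List ℕ :=
  (List.range' j k).reverse.flatMap (colWord lam T)

theorem partialWord_succ (lam : YoungDiagram) (T : Filling) (j k : ℕ) :
    partialWord lam T j (k + 1) = partialWord lam T (j + 1) k ++ colWord lam T j := by
  simp [partialWord, List.range'_succ]

theorem revColWord_eq (lam : YoungDiagram) (T : Filling) :
    revColWord lam T = partialWord lam T 0 (lam.rowLen 0) := by
  rw [revColWord, partialWord, List.range_eq_range']
  rfl

theorem count_partialWord (lam : YoungDiagram) (T : Filling) {x : ℕ} (hx : 1 ≤ x) (k : ℕ) :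
    ∀ j, j + k = lam.rowLen 0 → (partialWord lam T j k).count x = mult lam T x j := by
  induction k with
  | zero =>
    intro j hj
    rw [mult_eq_zero T x (by omega)]
    rfl
  | succ k ih =>
    intro j hj
    rw [partialWord_succ, List.count_append, ih (j + 1) (by omega), count_colWord lam T hx,
      mult_succ lam T x j]

theorem partialWord_prefix (lam : YoungDiagram) (T : Filling) (k : ℕ) :
    ∀ j l, partialWord lam T (j + l) k <+: partialWord lam T j (k + l) := by
  intro j l
  induction l generalizing j with
  | zero => exact List.prefix_rfl
  | succ l ih =>
    rw [← Nat.add_assoc k, partialWord_succ, show j + (l + 1) = j + 1 + l by ring]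
    exact (ih (j + 1)).trans (List.prefix_append _ _)

/-- The Yamanouchi property only has to be checked for the prefixes consisting of entire columns. -/
theorem isYamanouchi_iff {N : ℕ} {lam mu : YoungDiagram} {T : Filling} (h : IsSST N lam mu T) :
    IsYamanouchi (revColWord lam T) ↔
      ∀ x, 1 ≤ x → ∀ j, mult lam T (x + 1) j ≤ mult lam T x j := by
  rw [revColWord_eq]
  constructor
  · intro hY x hx j
    rcases le_total (lam.rowLen 0) j with hj | hj
    · rw [mult_eq_zero T _ hj]; exact Nat.zero_le _
    · obtain ⟨k, hk⟩ := Nat.exists_eq_add_of_le hj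
      have h1 := partialWord_prefix lam T k 0 j
      rw [Nat.zero_add, Nat.add_comm k, ← hk] at h1
      have h2 := hY _ h1 x hx
      rwa [count_partialWord lam T hx k j hk.symm,
        count_partialWord lam T (by omega) k j hk.symm] at h2
  · intro hm
    have key : ∀ k j, j + k = lam.rowLen 0 → IsYamanouchi (partialWord lam T j k) := fun k => by
      induction k with
      | zero =>
        intro j _ p hp x _
        obtain rfl : p = [] := List.prefix_nil.1 hp
        exact le_rfl
      | succ k ih =>
        intro j hj p hp x hx
        rw [partialWord_succ] at hp
        obtain ⟨t, ht⟩ := hp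
        rcases List.append_eq_append_iff.1 ht with ⟨q, hq, -⟩ | ⟨q, rfl, hq⟩
        · exact ih (j + 1) (by omega) p ⟨q, hq.symm⟩ x hx
        · rw [List.count_append, List.count_append, count_partialWord lam T hx k _ (by omega),
            count_partialWord lam T (by omega) k _ (by omega)]
          have h1 := hm x hx (j + 1)
          by_cases hxq : x + 1 ∈ q
          · -- The entries `< x + 1` of the column have been read before `x + 1`.
            have h2 := hm x hx j
            rw [mult_succ, mult_succ lam T x j, ← count_colWord lam T hx,
              ← count_colWord lam T (by omega)] at h2
            have hp := h.colWord_pairwise j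
            rw [hq] at h2 hp
            have h3 : t.count x = 0 := List.count_eq_zero_of_not_mem fun hxr => by
              have := (List.pairwise_append.1 hp).2.2 _ hxq _ hxr
              omega
            rw [List.count_append, List.count_append, h3] at h2
            omega
          · rw [List.count_eq_zero_of_not_mem hxq]
            omega
    exact key _ 0 (by omega)

/-! ### Recording tableaux and chains of strips -/

/-- An initial segment of `ℕ` is given by its length. -/
theorem exists_lt_iff {p : ℕ → Prop} (hp : ∀ i, p (i + 1) → p i) {m : ℕ} (hm : ¬ p m) :
    ∃ l, ∀ i, i < l ↔ p i := by
  classical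
  have hex : ∃ i, ¬ p i := ⟨m, hm⟩
  refine ⟨Nat.find hex, fun i => ⟨fun h => not_not.1 (Nat.find_min hex h), fun h => ?_⟩⟩
  by_contra hc
  have : ∀ k, Nat.find hex ≤ k → ¬ p k := fun k hk => by
    induction k, hk using Nat.le_induction with
    | base => exact Nat.find_spec hex
    | succ k _ ih => exact fun h => ih (hp k h)
  exact this i (by omega) h

namespace IsStripChain

variable {n : ℕ} {L h : ℕ → ℕ → ℕ}

theorem tail_mono (hL : IsStripChain n L h) (k j : ℕ) : h k (j + 1) ≤ h k j := by
  have := (hL.tail k).step j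
  have := hL.le k j
  omega

theorem tail_anti (hL : IsStripChain n L h) (k : ℕ) {j j' : ℕ} (hj : j ≤ j') :
    h k j' ≤ h k j :=
  antitone_nat_of_succ_le (hL.tail_mono k) hj

theorem tail_succ_le (hL : IsStripChain n L h) {k l : ℕ} (hkl : k ≤ l) (j : ℕ) :
    h l j ≤ h k j :=
  antitone_nat_of_succ_le (f := fun k => h k j)
    (fun k => (hL.lattice k j).trans (hL.tail_mono k j)) hkl

theorem tail_le_length (hL : IsStripChain n L h) (k j : ℕ) : h k j ≤ L k j := by
  obtain ⟨m, hm⟩ := (hL.tail k).fin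
  have key : ∀ d j, m ≤ j + d → h k j ≤ L k j := fun d => by
    induction d with
    | zero => intro j hj; rw [hm j hj]; exact Nat.zero_le _
    | succ d ih =>
      intro j hj
      have := ih (j + 1) (by omega)
      have := (hL.tail k).step j
      have := hL.vert k j
      omega
  exact key m j (by omega)

end IsStripChain

/-- The Littlewood–Richardson tableau of a chain of strips: the entry of a cell is its position,
counted from the top, in the strip to which it belongs. -/
noncomputable def stripPos (L h : ℕ → ℕ → ℕ) : Filling := fun i j =>
  if stepFilling L i j = 0 then 0
  else h (stepFilling L i j - 1) (j + 1) + (i + 1 - L (stepFilling L i j) j)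

section

variable {n K : ℕ} {L h : ℕ → ℕ → ℕ} {lam mu : YoungDiagram}

theorem stripPos_eq (hL : IsStripChain n L h) {i j k : ℕ} (h1 : i < L k j)
    (h2 : L (k + 1) j ≤ i) :
    stripPos L h i j = h k (j + 1) + (i + 1 - L (k + 1) j) ∧ h k (j + 1) < stripPos L h i j ∧
      stripPos L h i j ≤ h k j := by
  have hs := stepFilling_eq hL.le h1 h2
  have h3 : stripPos L h i j = h k (j + 1) + (i + 1 - L (k + 1) j) := by
    rw [stripPos, hs, if_neg (by omega), Nat.add_sub_cancel]
  have := (hL.tail k).step j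
  exact ⟨h3, by omega, by omega⟩

theorem stripPos_cases (hL : IsStripChain n L h) (h0 : ∀ j, L 0 j = lam.colLen j)
    (hK : ∀ k ≥ K, ∀ j, L k j = mu.colLen j) (i j : ℕ) :
    (stripPos L h i j = 0 ∧ stepFilling L i j = 0 ∧ ¬ ((i, j) ∈ lam ∧ (i, j) ∉ mu)) ∨
      ((i, j) ∈ lam ∧ (i, j) ∉ mu) ∧ ∃ k < K, i < L k j ∧ L (k + 1) j ≤ i := by
  rw [YoungDiagram.mem_iff_lt_colLen, YoungDiagram.mem_iff_lt_colLen, ← h0, ← hK K le_rfl]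
  by_cases hc : i < L 0 j ∧ ¬ i < L K j
  · refine Or.inr ⟨hc, ?_⟩
    obtain ⟨k, h1, h2⟩ := exists_step (K := K) hc.1 (by omega)
    refine ⟨k, ?_, h1, h2⟩
    by_contra hkK
    rw [hK k (by omega), ← hK K le_rfl] at h1
    exact hc.2 h1
  · have hs : stepFilling L i j = 0 := stepFilling_eq_zero fun k hk => by
      have h3 := antitone_of_le hL.le (Nat.zero_le k) j
      have h4 : i < L K j := by
        by_contra h5
        exact hc ⟨by omega, h5⟩
      rcases le_total (k + 1) K with h6 | h6
      · exact h4.trans_le (antitone_of_le hL.le h6 j)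
      · rw [hK (k + 1) h6, ← hK K le_rfl]
        exact h4
    exact Or.inl ⟨by rw [stripPos, if_pos hs], hs, hc⟩

/-- The entries `x` of `stripPos` in the columns `≥ j` correspond to the strips with at least `x`
cells in these columns. -/
theorem mult_stripPos (hL : IsStripChain n L h) (h0 : ∀ j, L 0 j = lam.colLen j)
    (hK : ∀ k ≥ K, ∀ j, L k j = mu.colLen j) {x : ℕ} (hx : 1 ≤ x) (j : ℕ) :
    mult lam (stripPos L h) x j = ((Finset.range K).filter fun k => x ≤ h k j).card := by
  symm
  have hex : ∀ k, x ≤ h k j → ∃ j', j ≤ j' ∧ x ≤ h k j' ∧ h k (j' + 1) < x := fun k hk => by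
    by_contra hc
    have hall : ∀ j', j ≤ j' → x ≤ h k j' := fun j' hj' => by
      induction j', hj' using Nat.le_induction with
      | base => exact hk
      | succ j' h1 ih =>
        by_contra h2
        exact hc ⟨j', h1, ih, by omega⟩
    obtain ⟨m, hm⟩ := (hL.tail k).fin
    have := hall (max j m) (le_max_left _ _)
    rw [hm _ (le_max_right _ _)] at this
    omega
  -- `f k` is the column of the `x`-th cell, counted from the right, of strip `k`.
  choose! f hf1 hf2 hf3 using hex
  have hcell : ∀ k, x ≤ h k j → L (k + 1) (f k) ≤ L (k + 1) (f k) + (x - h k (f k + 1)) - 1 ∧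
      L (k + 1) (f k) + (x - h k (f k + 1)) - 1 < L k (f k) := fun k hk => by
    have := hf2 k hk
    have := hf3 k hk
    have := (hL.tail k).step (f k)
    omega
  refine Finset.card_bij (fun k _ => (L (k + 1) (f k) + (x - h k (f k + 1)) - 1, f k))
    (fun k hk => ?_) (fun k hk k' hk' he => ?_) (fun c hc => ?_)
  · simp only [Finset.mem_filter] at hk ⊢
    obtain ⟨h1, h2⟩ := hcell k hk.2
    have h3 := (stripPos_eq hL h2 h1).1
    have := hf3 k hk.2
    refine ⟨YoungDiagram.mem_iff_lt_colLen.2 ?_, ?_, hf1 k hk.2⟩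
    · rw [← h0]
      exact h2.trans_le (antitone_of_le hL.le (Nat.zero_le k) _)
    · rw [h3]; omega
  · simp only [Finset.mem_filter] at hk hk'
    obtain ⟨h1, h2⟩ := hcell k hk.2
    obtain ⟨h1', h2'⟩ := hcell k' hk'.2
    have h3 := stepFilling_eq hL.le h2 h1
    have h3' := stepFilling_eq hL.le h2' h1'
    rw [Prod.mk.injEq] at he
    rw [he.1, he.2] at h3
    omega
  · obtain ⟨i, j'⟩ := c
    simp only [Finset.mem_filter, YoungDiagram.mem_cells] at hc
    obtain ⟨hc1, hc2, hc3⟩ := hc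
    rcases stripPos_cases hL h0 hK i j' with ⟨h1, -, -⟩ | ⟨-, k, hkK, h1, h2⟩
    · omega
    · obtain ⟨h3, h4, h5⟩ := stripPos_eq hL h1 h2
      have hk : x ≤ h k j := by
        have := hL.tail_anti k hc3
        omega
      have hfj : f k = j' := by
        have a1 := hf2 k hk
        have a2 := hf3 k hk
        rcases lt_trichotomy (f k) j' with hlt | he | hlt
        · have := hL.tail_anti k (show f k + 1 ≤ j' by omega)
          omega
        · exact he
        · have := hL.tail_anti k (show j' + 1 ≤ f k by omega)
          omega
      refine ⟨k, by simpa using ⟨hkK, hk⟩, ?_⟩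
      rw [hfj, Prod.mk.injEq]
      exact ⟨by omega, rfl⟩

/-- Every chain of strips is the chain of a recording tableau. -/
theorem stepFilling_mem_Rec (hL : IsStripChain n L h) (h0 : ∀ j, L 0 j = lam.colLen j)
    (hK : ∀ k ≥ K, ∀ j, L k j = mu.colLen j) (hlam : lam.colLen 0 ≤ 2 * n)
    (hmu : mu.colLen 0 ≤ n) : stepFilling L ∈ Rec n lam mu := by
  have hmult := fun {x : ℕ} (hx : 1 ≤ x) j => mult_stripPos hL h0 hK hx j
  have hcases := stripPos_cases hL h0 hK
  have heq := fun {i j k : ℕ} (h1 : i < L k j) (h2 : L (k + 1) j ≤ i) => stripPos_eq hL h1 h2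
  set X := stripPos L h with hX
  -- A cell of strip `k` in column `j` has an entry in `(h k (j + 1), h k j]`. The right neighbour
  -- of a cell belongs to an earlier strip, and the cell below it to the same or an earlier strip,
  -- so that the lattice condition applies.
  have hsst : IsSST (2 * n) lam mu X := by
    refine ⟨fun i j => ?_, fun i j => ?_, fun i j hm hl => ?_, fun i j hm hl => ?_⟩
    · rcases hcases i j with ⟨h1, -, h2⟩ | ⟨h1, k, -, h2, h3⟩
      · rw [h1]
        exact ⟨fun h => absurd h (lt_irrefl 0), fun h => absurd h h2⟩
      · exact ⟨fun _ => h1, fun _ => by have := (heq h2 h3).2.1; omega⟩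
    · rcases hcases i j with ⟨h1, -, -⟩ | ⟨h1, k, -, h2, h3⟩
      · rw [h1]; exact Nat.zero_le _
      · have a1 := (heq h2 h3).2.2
        have a2 := hL.tail_succ_le (Nat.zero_le k) j
        have a3 := hL.tail_anti 0 (Nat.zero_le j)
        have a4 := hL.tail_le_length 0 0
        rw [h0] at a4
        omega
    · have hl' : (i, j) ∈ lam := lam.up_left_mem le_rfl (Nat.le_succ j) hl
      have hm' : (i, j + 1) ∉ mu := fun h => hm (mu.up_left_mem le_rfl (Nat.le_succ j) h)
      rcases hcases i j with ⟨-, -, h1⟩ | ⟨-, k, -, h2, h3⟩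
      · exact absurd ⟨hl', hm⟩ h1
      rcases hcases i (j + 1) with ⟨-, -, h1⟩ | ⟨-, k', -, h2', h3'⟩
      · exact absurd ⟨hl, hm'⟩ h1
      have e := heq h2 h3
      have e' := heq h2' h3'
      have hv := hL.vert k' j
      have hkk : k' < k := by
        by_contra hc
        have := antitone_of_le hL.le (show k + 1 ≤ k' + 1 by omega) j
        omega
      rcases (show k' + 1 ≤ k from hkk).lt_or_eq with hlt | rfl
      · have a1 := hL.tail_succ_le (show k' + 2 ≤ k by omega) j
        have a2 := hL.lattice (k' + 1) j
        have a3 := hL.lattice k' (j + 1)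
        simp only [Nat.add_assoc, Nat.reduceAdd] at *
        omega
      · have a1 := hL.lattice k' (j + 1)
        have a2 := hL.vert (k' + 1) j
        omega
    · have hl' : (i, j) ∈ lam := lam.up_left_mem (Nat.le_succ i) le_rfl hl
      have hm' : (i + 1, j) ∉ mu := fun h => hm (mu.up_left_mem (Nat.le_succ i) le_rfl h)
      rcases hcases i j with ⟨-, -, h1⟩ | ⟨-, k, -, h2, h3⟩
      · exact absurd ⟨hl', hm⟩ h1
      rcases hcases (i + 1) j with ⟨-, -, h1⟩ | ⟨-, k', -, h2', h3'⟩
      · exact absurd ⟨hl, hm'⟩ h1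
      have e := heq h2 h3
      have e' := heq h2' h3'
      have hkk : k' ≤ k := by
        by_contra hc
        have := antitone_of_le hL.le (show k + 1 ≤ k' by omega) j
        omega
      rcases hkk.lt_or_eq with hlt | rfl
      · have a1 := hL.tail_succ_le (show k' + 1 ≤ k by omega) j
        have a2 := hL.lattice k' j
        omega
      · omega
  have hanti : ∀ x, 1 ≤ x → ∀ j, mult lam X (x + 1) j ≤ mult lam X x j := fun x hx j => by
    rw [hmult hx, hmult (by omega)]
    refine Finset.card_le_card fun k hk => ?_
    simp only [Finset.mem_filter] at hk ⊢
    exact ⟨hk.1, by omega⟩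
  refine ⟨X, ⟨hsst, (isYamanouchi_iff hsst).2 hanti, fun x hx => ?_, fun x hx => ?_,
    fun i hi => ?_⟩, ?_⟩
  · rw [← mult_zero, ← mult_zero]
    exact hanti x hx 0
  · -- As `h k 0` is even, it is at least `2x - 1` if and only if it is at least `2x`.
    rw [← mult_zero, ← mult_zero, hmult (by omega), hmult (by omega)]
    congr 1
    refine Finset.filter_congr fun k _ => ?_
    obtain ⟨r, hr⟩ := hL.even k
    omega
  · have hm : (n + i, 0) ∉ mu := fun h => by
      rw [YoungDiagram.mem_iff_lt_colLen] at h
      omega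
    rcases hcases (n + i) 0 with ⟨-, -, h1⟩ | ⟨-, k, -, h2, h3⟩
    · exact absurd ⟨hi, hm⟩ h1
    · have a1 := (heq h2 h3).1
      have a2 := (hL.tail k).step 0
      have a3 := hL.len k
      rw [Nat.zero_add] at *
      omega
  · funext i j
    rcases hcases i j with ⟨h1, h2, -⟩ | ⟨-, k, hkK, h2, h3⟩
    · rw [diamond, if_pos h1, h2]
    · have e := heq h2 h3
      rw [stepFilling_eq hL.le h2 h3, diamond, if_neg (by omega)]
      change mult lam X (X i j) j = _
      rw [hmult (by omega)]
      have : (Finset.range K).filter (fun l => X i j ≤ h l j) = Finset.range (k + 1) := by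
        ext l
        simp only [Finset.mem_filter, Finset.mem_range]
        constructor
        · rintro ⟨-, hl⟩
          by_contra hc
          have a1 := hL.tail_succ_le (show k + 1 ≤ l by omega) j
          have a2 := hL.lattice k j
          omega
        · intro hl
          have := hL.tail_succ_le (show l ≤ k by omega) j
          exact ⟨by omega, by omega⟩
      rw [this, Finset.card_range]

end

/-- Every recording tableau is the filling of a chain of strips. -/
theorem exists_chain_of_mem_Rec {n : ℕ} {lam mu : YoungDiagram} {D : Filling}
    (hD : D ∈ Rec n lam mu) (hmu : mu.colLen 0 ≤ n) (hle : mu ≤ lam) :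
    ∃ L h, IsStripChain n L h ∧ (∀ j, L 0 j = lam.colLen j) ∧
      (∀ k ≥ lam.card, ∀ j, L k j = mu.colLen j) ∧ D = stepFilling L := by
  obtain ⟨X, hX, rfl⟩ := hD
  have hle' := le_iff_colLen.1 hle
  have hpos := fun {i j : ℕ} => hX.sst.pos_iff_colLen (i := i) (j := j)
  have hanti := (isYamanouchi_iff hX.sst).1 hX.yamanouchi
  set m := mult lam X with hm
  have hanti' : ∀ x y j, 1 ≤ x → x ≤ y → m y j ≤ m x j := fun x y j hx hxy => by
    induction y, hxy using Nat.le_induction with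
    | base => exact le_rfl
    | succ y h1 ih => exact (hanti y (by omega) j).trans ih
  have hstep : ∀ x j, 1 ≤ x → m x j ≤ m x (j + 1) + 1 := fun x j hx => by
    rw [hm, mult_succ]
    have := hX.sst.colMult_le_one hx j
    omega
  have hcell : ∀ {i j}, 0 < X i j → m (X i j) j = m (X i j) (j + 1) + 1 := fun {i j} h => by
    have h1 := hX.sst.colMult_le_one (x := X i j) h j
    have h2 : 0 < colMult lam X (X i j) j := by
      rw [colMult, Finset.card_pos]
      exact ⟨i, by simpa using (hpos.1 h).1⟩
    have h3 := mult_succ lam X (X i j) j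
    rw [← hm] at h3
    omega
  have hd : ∀ {i j}, 0 < X i j → diamond lam X i j = m (X i j) j := fun {i j} h => by
    rw [diamond, if_neg (by omega)]
    rfl
  have hd0 : ∀ {i j}, X i j = 0 → diamond lam X i j = 0 := fun {i j} h => by
    rw [diamond, if_pos h]
  have hcard : ∀ x j, m x j ≤ lam.card := fun x j => Finset.card_filter_le _ _
  -- The `k`-th shape consists of `mu` and the cells of `diamond lam X` with an entry `> k`.
  have hLex : ∀ k j, ∃ l, ∀ i, i < l ↔
      i < lam.colLen j ∧ (i < mu.colLen j ∨ k < diamond lam X i j) := fun k j => by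
    refine exists_lt_iff (m := lam.colLen j) (fun i hi => ⟨by omega, ?_⟩) fun hc => by omega
    rcases hi with ⟨h1, h2⟩
    by_cases hmi : i < mu.colLen j
    · exact Or.inl hmi
    · right
      have p1 : 0 < X i j := hpos.2 ⟨by omega, by omega⟩
      have p2 : 0 < X (i + 1) j := hpos.2 ⟨by omega, by omega⟩
      have h3 : k < diamond lam X (i + 1) j := by omega
      rw [hd p2] at h3
      rw [hd p1]
      exact h3.trans_le (hanti' _ _ _ p1 (hX.sst.lt_of_lt (Nat.lt_succ_self i) (by omega) h1).le)
  -- The sizes `h k j` form the partition conjugate to `m 1 j, m 2 j, …`.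
  have hhex : ∀ k j, ∃ l, ∀ x, x < l ↔ k + 1 ≤ m (x + 1) j := fun k j => by
    refine exists_lt_iff (m := 2 * n) (fun x hx => hx.trans (hanti _ (by omega) j)) fun hc => ?_
    have : m (2 * n + 1) j = 0 := by
      rw [hm, mult, Finset.card_eq_zero, Finset.filter_eq_empty_iff]
      rintro ⟨i, j'⟩ - ⟨h1, -⟩
      have := hX.sst.le_max i j'
      simp only at h1
      omega
    omega
  choose L hL using hLex
  choose h hh' using hhex
  have hh : ∀ k j x, 1 ≤ x → (x ≤ h k j ↔ k + 1 ≤ m x j) := fun k j x hx => by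
    have := hh' k j (x - 1)
    rw [Nat.sub_add_cancel hx] at this
    rw [← this]
    omega
  have hLle : ∀ k j, L (k + 1) j ≤ L k j := fun k j => by
    by_contra hc
    have h1 := (hL (k + 1) j (L k j)).1 (by omega)
    have h2 := mt (hL k j (L k j)).2 (lt_irrefl _)
    exact h2 ⟨h1.1, h1.2.imp_right fun h => by omega⟩
  have hL0 : ∀ j, L 0 j = lam.colLen j := fun j => by
    refine eq_of_forall_lt_iff fun i => ?_
    rw [hL]
    refine ⟨fun h => h.1, fun hi => ⟨hi, ?_⟩⟩
    by_cases hmi : i < mu.colLen j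
    · exact Or.inl hmi
    · right
      have p1 : 0 < X i j := hpos.2 ⟨by omega, by omega⟩
      have := hcell p1
      rw [hd p1]
      omega
  have hLK : ∀ k ≥ lam.card, ∀ j, L k j = mu.colLen j := fun k hk j => by
    refine eq_of_forall_lt_iff fun i => ?_
    rw [hL]
    constructor
    · rintro ⟨h1, h2 | h2⟩
      · exact h2
      · rcases Nat.eq_zero_or_pos (X i j) with h3 | h3
        · rw [hd0 h3] at h2
          omega
        · rw [hd h3] at h2
          have := hcard (X i j) j
          omega
    · exact fun h => ⟨h.trans_le (hle' j), Or.inl h⟩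
  have hstrip : ∀ k i j, i < L k j → L (k + 1) j ≤ i →
      0 < X i j ∧ m (X i j) j = k + 1 := fun k i j h1 h2 => by
    have h3 := (hL k j i).1 h1
    have h4 := mt (hL (k + 1) j i).2 (by omega)
    have h5 : ¬ i < mu.colLen j := fun h => h4 ⟨h3.1, Or.inl h⟩
    have p1 : 0 < X i j := hpos.2 ⟨h3.1, by omega⟩
    have h6 : ¬ k + 1 < diamond lam X i j := fun h => h4 ⟨h3.1, Or.inr h⟩
    have h7 := h3.2.resolve_left h5
    rw [hd p1] at h6 h7
    exact ⟨p1, by omega⟩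
  have hhle : ∀ k j, h k (j + 1) ≤ h k j := fun k j => by
    rcases Nat.eq_zero_or_pos (h k (j + 1)) with h1 | h1
    · omega
    · exact (hh k j _ h1).2 (((hh k (j + 1) _ h1).1 le_rfl).trans
        (mult_anti lam X _ (Nat.le_succ j)))
  refine ⟨L, h, ⟨hLle, fun k j => ?_, fun k => ⟨fun j => ?_, lam.rowLen 0, fun j hj => ?_⟩,
    fun k j => ?_, fun k => ?_, fun k => ?_⟩, hL0, hLK, ?_⟩
  · -- The rows of `diamond lam X` are strictly decreasing.
    by_contra hc
    have h1 := (hL k (j + 1) (L (k + 1) j)).1 (by omega)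
    have h2 := mt (hL (k + 1) j (L (k + 1) j)).2 (lt_irrefl _)
    set i := L (k + 1) j
    have hl := lam.colLen_anti _ _ (Nat.le_succ j)
    have hm' := mu.colLen_anti _ _ (Nat.le_succ j)
    simp only [Nat.succ_eq_add_one] at hl hm'
    refine h2 ⟨by omega, ?_⟩
    by_cases hmi : i < mu.colLen j
    · exact Or.inl hmi
    · right
      have p1 : 0 < X i j := hpos.2 ⟨by omega, by omega⟩
      have p2 : 0 < X i (j + 1) := hpos.2 ⟨by omega, by omega⟩
      have h3 : k < diamond lam X i (j + 1) := by omega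
      have h4 := hX.sst.row_weak i j (by rwa [YoungDiagram.mem_iff_lt_colLen])
        (YoungDiagram.mem_iff_lt_colLen.2 h1.1)
      have h5 := hanti' _ _ (j + 1) p1 h4
      have h6 := hcell p1
      rw [hd p2] at h3
      rw [hd p1]
      omega
  · -- The entries of `X` in column `j` of strip `k` are the numbers in `(h k (j + 1), h k j]`.
    have h1 := hLle k j
    have h2 := hhle k j
    have hc : (Finset.Ico (L (k + 1) j) (L k j)).card =
        (Finset.Ioc (h k (j + 1)) (h k j)).card := by
      refine Finset.card_bij (fun i _ => X i j) (fun i hi => ?_) (fun i hi i' hi' he => ?_)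
        (fun x hx => ?_)
      · rw [Finset.mem_Ico] at hi
        obtain ⟨p1, p2⟩ := hstrip k i j hi.2 hi.1
        have p3 := hcell p1
        rw [Finset.mem_Ioc, hh k j _ p1, ← not_le, hh k (j + 1) _ p1]
        omega
      · rw [Finset.mem_Ico] at hi hi'
        obtain ⟨p1, -⟩ := hstrip k i j hi.2 hi.1
        obtain ⟨p1', -⟩ := hstrip k i' j hi'.2 hi'.1
        by_contra hne
        rcases lt_or_gt_of_ne hne with hlt | hlt
        · have := hX.sst.lt_of_lt hlt (hpos.1 p1).2 (hpos.1 p1').1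
          omega
        · have := hX.sst.lt_of_lt hlt (hpos.1 p1').2 (hpos.1 p1).1
          omega
      · rw [Finset.mem_Ioc] at hx
        have hx1 : 1 ≤ x := by omega
        have a1 := (hh k j x hx1).1 hx.2
        have a2 := mt (hh k (j + 1) x hx1).2 (by omega)
        have a3 := mult_succ lam X x j
        have a4 : 0 < colMult lam X x j := by
          rw [← hm] at a3
          omega
        rw [colMult, Finset.card_pos] at a4
        obtain ⟨i, hi⟩ := a4
        simp only [Finset.mem_filter, Finset.mem_range] at hi
        obtain ⟨hi1, hi2⟩ := hi
        have p1 : 0 < X i j := by omega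
        have p2 := hcell p1
        have p3 := hd p1
        rw [hi2] at p2 p3
        refine ⟨i, ?_, hi2⟩
        rw [Finset.mem_Ico, hL, ← not_lt, hL]
        have := (hpos.1 p1).2
        omega
    rw [Nat.card_Ico, Nat.card_Ioc] at hc
    omega
  · rcases Nat.eq_zero_or_pos (h k j) with h1 | h1
    · exact h1
    · have := (hh k j _ h1).1 le_rfl
      rw [hm, mult_eq_zero X _ hj] at this
      omega
  · rcases Nat.eq_zero_or_pos (h (k + 1) j) with h1 | h1
    · omega
    · -- A column contains every number at most once.
      have a1 := (hh (k + 1) j _ h1).1 le_rfl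
      have a2 := hstep (h (k + 1) j) j h1
      exact (hh k (j + 1) _ h1).2 (by omega)
  · by_contra hodd
    rw [Nat.not_even_iff_odd] at hodd
    obtain ⟨y, hy⟩ := hodd
    have a1 := (hh k 0 (2 * y + 1) (by omega)).1 hy.ge
    have a2 := hX.weight_even (y + 1) (by omega)
    rw [← mult_zero, ← mult_zero, show 2 * (y + 1) - 1 = 2 * y + 1 by omega, ← hm] at a2
    have a3 := (hh k 0 (2 * (y + 1)) (by omega)).2 (by omega)
    omega
  · rcases le_or_gt (L k 0) n with h1 | h1
    · omega
    · -- The entry at the bottom of the first column of the `k`-th shape.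
      have h2 := (hL k 0 (L k 0 - 1)).1 (by omega)
      have h3 := h2.2.resolve_left (by omega)
      have p1 : 0 < X (L k 0 - 1) 0 := hpos.2 ⟨h2.1, by omega⟩
      rw [hd p1] at h3
      have h4 := (hh k 0 _ p1).2 (by omega)
      have h5 := hX.symplectic (L k 0 - 1 - n) (by
        rw [YoungDiagram.mem_iff_lt_colLen]
        omega)
      rw [show n + (L k 0 - 1 - n) = L k 0 - 1 by omega] at h5
      omega
  · funext i j
    rcases Nat.eq_zero_or_pos (X i j) with h1 | h1
    · rw [hd0 h1, stepFilling_eq_zero]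
      intro k hk
      have := (hL k j i).1 hk
      rw [hL]
      refine ⟨this.1, Or.inl ?_⟩
      rcases this.2 with h2 | h2
      · exact h2
      · rw [hd0 h1] at h2
        omega
    · have p2 := hcell h1
      have p3 := hd h1
      have p4 := hpos.1 h1
      rw [stepFilling_eq hLle (k := m (X i j) j - 1) ((hL _ _ _).2 ⟨p4.1, Or.inr (by omega)⟩)]
      · omega
      · rw [← not_lt, hL]
        omega

/-! ### The quantum Littlewood–Richardson map is a bijection -/

theorem QAII_eq {n : ℕ} {lam : YoungDiagram} {T : Filling} (hT : T ∈ SST n lam) :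
    QAII lam T = stepFilling (chain n (toCols lam T)) := by
  have hC : IsTab (2 * n) (toCols lam T) := isTab_toCols hT
  funext i j
  have hcell : ∀ k, IsCell (suc^[k] (toCols lam T)) i j ↔ i < chain n (toCols lam T) k j :=
    fun k => by rw [chain, counts_last (isTab_iterate hC k).col, IsCell]
  simp only [QAII, stepFilling, hcell]

theorem chain_zero {n : ℕ} {lam : YoungDiagram} {T : Filling} (hT : T ∈ SST n lam) (j : ℕ) :
    chain n (toCols lam T) 0 j = lam.colLen j := by
  rw [chain, Function.iterate_zero_apply, counts_last (isTab_toCols hT).col, length_toCols]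

theorem chain_of_ge {n : ℕ} {lam : YoungDiagram} {T : Filling} (hT : T ∈ SST n lam) {k : ℕ}
    (hk : lam.card ≤ k) (j : ℕ) :
    chain n (toCols lam T) k j = chain n (toCols lam T) lam.card j := by
  rw [chain, suc_iterate_of_ge hT hk, chain]

/-- The shape of `P^{AII}(T)`. -/
theorem exists_shape {n : ℕ} {lam : YoungDiagram} {T : Filling} (hT : T ∈ SST n lam) :
    ∃ mu ∈ subPar n lam, ∀ j, mu.colLen j = chain n (toCols lam T) lam.card j := by
  have hS := (isTab_iterate (isTab_toCols hT) lam.card).isTableau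
  obtain ⟨h, hh⟩ := chain_isStripChain (isTab_toCols hT)
  obtain ⟨m, hm⟩ := hS.fin
  obtain ⟨mu, hmu⟩ := exists_diagram (L := chain n (toCols lam T) lam.card)
    (fun j => hS.anti j (2 * n)) ⟨m, fun j hj => by rw [chain, hm j hj]; rfl⟩
  refine ⟨mu, ⟨?_, le_iff_colLen.2 fun j => ?_⟩, hmu⟩
  · rw [hmu]
    exact symplectic_iterate hT n
  · rw [hmu, ← chain_zero hT]
    exact antitone_of_le hh.le (Nat.zero_le _) j

theorem length_final {n : ℕ} {lam mu : YoungDiagram} {T : Filling} (hT : T ∈ SST n lam)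
    (hmu : ∀ j, mu.colLen j = chain n (toCols lam T) lam.card j) (j : ℕ) :
    ((suc^[lam.card] (toCols lam T)).getD j []).length = mu.colLen j := by
  rw [hmu, chain, counts_last (isTab_iterate (isTab_toCols hT) _).col]

theorem PAII_mem_SpT {n : ℕ} {lam mu : YoungDiagram} {T : Filling} (hT : T ∈ SST n lam)
    (hmu : ∀ j, mu.colLen j = chain n (toCols lam T) lam.card j) :
    PAII lam T ∈ SpT n mu ∧ toCols mu (PAII lam T) = suc^[lam.card] (toCols lam T) := by
  have hS := isTab_iterate (isTab_toCols hT) lam.card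
  have hlen := length_final hT hmu
  obtain ⟨h1, h2⟩ := toCols_ofCols hS hlen
  refine ⟨⟨h1, fun i hi => ?_⟩, h2⟩
  by_contra hc
  rw [YoungDiagram.mem_iff_lt_colLen] at hi
  have h3 := ((isCol_getD hS.col 0).getD_le_iff (i := i) (by rwa [hlen]) (2 * i)).1
    (by change PAII lam T i 0 ≤ 2 * i; omega)
  have h4 := symplectic_iterate hT i
  rw [counts] at h4
  omega

theorem QAII_mem_Rec {n : ℕ} {lam mu : YoungDiagram} {T : Filling} (hlam : lam.colLen 0 ≤ 2 * n)
    (hT : T ∈ SST n lam) (hmun : mu.colLen 0 ≤ n)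
    (hmu : ∀ j, mu.colLen j = chain n (toCols lam T) lam.card j) : QAII lam T ∈ Rec n lam mu := by
  obtain ⟨h, hh⟩ := chain_isStripChain (isTab_toCols hT)
  rw [QAII_eq hT]
  exact stepFilling_mem_Rec (K := lam.card) hh (chain_zero hT)
    (fun k hk j => by rw [hmu, chain_of_ge hT hk]) hlam hmun

theorem counts_symplectic {n : ℕ} {mu : YoungDiagram} {P : Filling} (hP : P ∈ SpT n mu) (y : ℕ) :
    counts (toCols mu P) 0 (2 * y) ≤ y := by
  by_contra hc
  have hC : IsTab (2 * n) (toCols mu P) := isTab_toCols hP.1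
  have h1 : y < mu.colLen 0 := by
    have hle : counts (toCols mu P) 0 (2 * y) ≤ ((toCols mu P).getD 0 []).length :=
      List.countP_le_length
    rw [length_toCols] at hle
    omega
  have h2 := ((isCol_getD hC.col 0).getD_le_iff (i := y) (by rwa [length_toCols]) (2 * y)).2
    (by rw [counts] at hc; omega)
  rw [getD_toCols_getD P h1] at h2
  have := hP.2 y (YoungDiagram.mem_iff_lt_colLen.2 h1)
  omega

theorem LRAII_mapsTo {n : ℕ} {lam : YoungDiagram} (hlam : lam.colLen 0 ≤ 2 * n) :
    Set.MapsTo (LRAII lam) (SST n lam) (LRPairs n lam) := by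
  intro T hT
  obtain ⟨mu, hmu, hlen⟩ := exists_shape hT
  exact Set.mem_biUnion hmu ⟨(PAII_mem_SpT hT hlen).1, QAII_mem_Rec hlam hT hmu.1 hlen⟩

theorem LRAII_injOn {n : ℕ} {lam : YoungDiagram} : Set.InjOn (LRAII lam) (SST n lam) := by
  intro T hT T' hT' he
  obtain ⟨hP, hQ⟩ := Prod.mk.inj he
  have hC : IsTab (2 * n) (toCols lam T) := isTab_toCols hT
  have hC' : IsTab (2 * n) (toCols lam T') := isTab_toCols hT'
  rw [QAII_eq hT, QAII_eq hT'] at hQ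
  obtain ⟨h, hh⟩ := chain_isStripChain hC
  obtain ⟨h', hh'⟩ := chain_isStripChain hC'
  have hch : chain n (toCols lam T) = chain n (toCols lam T') := by
    funext k j
    refine eq_of_forall_lt_iff fun i => ?_
    rw [lt_chain_iff hh.le, lt_chain_iff hh'.le, hQ, chain_zero hT, chain_zero hT']
  obtain ⟨mu, -, hlen⟩ := exists_shape hT
  have h1 := (PAII_mem_SpT hT hlen).2
  have h2 := (PAII_mem_SpT hT' (hch ▸ hlen)).2
  have hfin : suc^[lam.card] (toCols lam T) = suc^[lam.card] (toCols lam T') := by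
    rw [← h1, ← h2, hP]
  rw [← ofCols_toCols hT, ← ofCols_toCols hT', eq_of_chain_eq hC hC' hch hfin]

theorem LRAII_surjOn {n : ℕ} {lam : YoungDiagram} :
    Set.SurjOn (LRAII lam) (SST n lam) (LRPairs n lam) := by
  rintro ⟨P, D⟩ h
  obtain ⟨mu, ⟨hmun, hmule⟩, hP, hD⟩ := Set.mem_iUnion₂.1 h
  simp only at hP hD
  obtain ⟨L, t, hL, hL0, hLK, rfl⟩ := exists_chain_of_mem_Rec hD hmun hmule
  have hS : IsTab (2 * n) (toCols mu P) := isTab_toCols hP.1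
  obtain ⟨C, hC, hCK, hch⟩ := exists_chain hL hS (counts_symplectic hP) (K := lam.card)
    fun k hk j => by rw [counts_last hS.col, length_toCols, hLK k hk]
  have hlen : ∀ j, (C.getD j []).length = lam.colLen j := fun j => by
    rw [← counts_last hC.col, ← hL0]
    exact hch 0 j
  obtain ⟨h1, h2⟩ := toCols_ofCols hC hlen
  refine ⟨ofCols C, h1, ?_⟩
  have hQ : QAII lam (ofCols C) = stepFilling L := by
    rw [QAII_eq h1, h2]
    congr 1
    funext k j
    exact hch k j
  rw [LRAII, hQ, PAII, h2, hCK, ofCols_toCols hP.1]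

/-! ### Weights -/

theorem content_eq_sum {lam : YoungDiagram} (T : Filling) (x : ℕ) {M : ℕ}
    (hM : lam.rowLen 0 ≤ M) : content lam T x = ∑ j ∈ Finset.range M, colMult lam T x j := by
  have key : ∀ M, content lam T x =
      mult lam T x M + ∑ j ∈ Finset.range M, colMult lam T x j := fun M => by
    induction M with
    | zero => simp [mult_zero]
    | succ M ih => rw [ih, mult_succ, Finset.sum_range_succ]; ring
  rw [key M, mult_eq_zero T x hM, Nat.zero_add]

/-- The number of entries `≤ y` of the first `M` columns of a tableau. -/
def total (M : ℕ) (C : ℕ → ℕ → ℕ) (y : ℕ) : ℕ := ∑ j ∈ Finset.range M, C j y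

theorem total_succ {lam : YoungDiagram} (T : Filling) {M : ℕ} (hM : lam.rowLen 0 ≤ M) (y : ℕ) :
    total M (counts (toCols lam T)) (y + 1) =
      total M (counts (toCols lam T)) y + content lam T (y + 1) := by
  rw [content_eq_sum T _ hM, total, total, ← Finset.sum_add_distrib]
  refine Finset.sum_congr rfl fun j _ => ?_
  rw [counts, cnt_succ, getD_toCols, colMult, List.count, List.countP_map,
    List.countP_eq_length_filter]
  rfl

theorem IsSuc.total_add {n M : ℕ} {C S β : ℕ → ℕ → ℕ} (h : IsSuc n C S β)
    (hC : IsTableau (2 * n) C) (hM : ∀ j ≥ M, C j = 0) (y : ℕ) :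
    total M S y + C 0 y = β 0 y + total M C y := by
  have h1 : total M S y + total M (fun j => β (j + 1)) y =
      total M β y + total M (fun j => C (j + 1)) y := by
    simp only [total]
    rw [← Finset.sum_add_distrib, ← Finset.sum_add_distrib]
    exact Finset.sum_congr rfl fun j _ => (h.mul.bump j).sum y
  have shift : ∀ f : ℕ → ℕ → ℕ, total M (fun j => f (j + 1)) y + f 0 y = total M f y + f M y :=
    fun f => by
      simp only [total]
      rw [← Finset.sum_range_succ' (fun j => f j y), Finset.sum_range_succ]
  have h2 : β M y = 0 := by
    have a1 := (h.mul.bump M).le_left (h.mul.count M) (hC.count (M + 1)) y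
    have a2 := h.le hC M y
    rw [hM M le_rfl] at a2
    simp only [Pi.zero_apply] at a2
    omega
  have h3 : C M y = 0 := by rw [hM M le_rfl]; rfl
  have := shift β
  have := shift C
  omega

/-- A step removes as many entries `2k + 1` as entries `2k + 2`. -/
theorem IsSuc.total_eq {n M : ℕ} {C S β : ℕ → ℕ → ℕ} (h : IsSuc n C S β)
    (hC : IsTableau (2 * n) C) (hM : ∀ j ≥ M, C j = 0) (k : ℕ) :
    2 * total M S (2 * k + 1) + (total M C (2 * k) + total M C (2 * k + 2)) =
      2 * total M C (2 * k + 1) + (total M S (2 * k) + total M S (2 * k + 2)) := by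
  have h0 := h.total_add hC hM (2 * k)
  have h1 := h.total_add hC hM (2 * k + 1)
  have h2 := h.total_add hC hM (2 * k + 2)
  have r0 := h.red k
  have r1 := (h.red (k + 1)).1
  rw [show 2 * (k + 1) = 2 * k + 2 by ring] at r1
  omega

theorem counts_toCols_eq_zero {lam : YoungDiagram} (T : Filling) {j : ℕ} (h : lam.rowLen 0 ≤ j) :
    counts (toCols lam T) j = 0 :=
  counts_eq_zero (by simpa [toCols] using h)

/-- `P^{AII}` preserves the differences of the numbers of entries `2k + 1` and `2k + 2`. -/
theorem content_PAII {n : ℕ} {lam mu : YoungDiagram} {T : Filling} (hT : T ∈ SST n lam)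
    (hle : mu ≤ lam) (hmu : ∀ j, mu.colLen j = chain n (toCols lam T) lam.card j) (k : ℕ) :
    content lam T (2 * k + 1) + content mu (PAII lam T) (2 * k + 2) =
      content mu (PAII lam T) (2 * k + 1) + content lam T (2 * k + 2) := by
  have hC : IsTab (2 * n) (toCols lam T) := isTab_toCols hT
  set M := lam.rowLen 0 with hM
  have hMmu : mu.rowLen 0 ≤ M := by
    by_contra hc
    have h1 : (0, M) ∈ mu := YoungDiagram.mem_iff_lt_rowLen.2 (by omega)
    have h2 := YoungDiagram.mem_iff_lt_rowLen.1 (hle h1)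
    omega
  have key : ∀ l, (∀ j ≥ M, counts (suc^[l] (toCols lam T)) j = 0) ∧
      2 * total M (counts (suc^[l] (toCols lam T))) (2 * k + 1) +
        (total M (counts (toCols lam T)) (2 * k) + total M (counts (toCols lam T)) (2 * k + 2)) =
      2 * total M (counts (toCols lam T)) (2 * k + 1) +
        (total M (counts (suc^[l] (toCols lam T))) (2 * k) +
          total M (counts (suc^[l] (toCols lam T))) (2 * k + 2)) := fun l => by
    induction l with
    | zero => exact ⟨fun j hj => counts_toCols_eq_zero T hj, rfl⟩
    | succ l ih =>
      obtain ⟨ih1, ih2⟩ := ih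
      have ht := (isTab_iterate hC l).isTableau
      obtain ⟨-, β, hβ⟩ := isSuc_suc (isTab_iterate hC l)
      rw [Function.iterate_succ_apply']
      refine ⟨fun j hj => ?_, ?_⟩
      · funext y
        have := hβ.le ht j y
        rw [ih1 j hj] at this
        simpa using this
      · have := hβ.total_eq ht ih1 k
        omega
  have h1 := (key lam.card).2
  rw [← (PAII_mem_SpT hT hmu).2] at h1
  have a1 := total_succ T hM.ge (2 * k)
  have a2 := total_succ T hM.ge (2 * k + 1)
  have a3 := total_succ (PAII lam T) hMmu (2 * k)
  have a4 := total_succ (PAII lam T) hMmu (2 * k + 1)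
  simp only [Nat.add_assoc, Nat.reduceAdd] at a2 a4
  omega

theorem u_bounds {k : ℕ} : 2 * k - 1 ≤ u k ∧ u k ≤ 2 * k := by
  unfold u; split_ifs <;> omega

theorem v_bounds {k : ℕ} : 2 * k - 1 ≤ v k ∧ v k ≤ 2 * k := by
  unfold v; split_ifs <;> omega

theorem u_lt_succ (k : ℕ) : u k < u (k + 1) := by
  unfold u
  by_cases h : Even k
  · rw [if_pos h, if_neg (by rwa [Nat.even_add_one, not_not])]
    omega
  · rw [if_neg h, if_pos (by rwa [Nat.even_add_one])]
    omega

theorem v_lt_succ (k : ℕ) : v k < v (k + 1) := by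
  unfold v
  by_cases h : Even k
  · rw [if_pos h, if_neg (by rwa [Nat.even_add_one, not_not])]
    omega
  · rw [if_neg h, if_pos (by rwa [Nat.even_add_one])]
    omega

theorem u_ne_v {k l : ℕ} (hk : 1 ≤ k) (hl : 1 ≤ l) : u k ≠ v l := by
  intro h
  have a1 := u_bounds (k := k)
  have a2 := v_bounds (k := l)
  obtain rfl : k = l := by omega
  unfold u v at h
  split_ifs at h <;> omega

theorem kWeight_PAII {n : ℕ} {lam mu : YoungDiagram} {T : Filling} (hT : T ∈ SST n lam)
    (hle : mu ≤ lam) (hmu : ∀ j, mu.colLen j = chain n (toCols lam T) lam.card j) :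
    kWeight n lam T = kWeight n mu (PAII lam T) := by
  funext k
  have h := content_PAII hT hle hmu k
  have e1 : 2 * ((k : ℕ) + 1) - 1 = 2 * k + 1 := by omega
  have e2 : 2 * ((k : ℕ) + 1) = 2 * k + 2 := by omega
  simp only [kWeight, u, v]
  split_ifs
  · rw [e1, e2]; omega
  · rw [e1, e2]; omega

/-- The tableau whose `k`-th row is filled with `w k`. -/
def rowFilling (w : ℕ → ℕ) (mu : YoungDiagram) : Filling :=
  fun i j => if (i, j) ∈ mu then w (i + 1) else 0

section rowFilling

variable {w : ℕ → ℕ} {mu : YoungDiagram}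

theorem rowFilling_pos_iff (hw : ∀ k, 2 * k - 1 ≤ w k) {i j : ℕ} :
    0 < rowFilling w mu i j ↔ (i, j) ∈ mu := by
  have := hw (i + 1)
  unfold rowFilling
  split_ifs with h
  · simp only [h, iff_true]; omega
  · simp [h]

theorem rowFilling_mem_SpT {n : ℕ} (hmu : mu.colLen 0 ≤ n)
    (hw : ∀ k, 2 * k - 1 ≤ w k) (hw2 : ∀ k, w k ≤ 2 * k) (hlt : ∀ k, w k < w (k + 1)) :
    rowFilling w mu ∈ SpT n mu := by
  have hrow : ∀ {i j}, (i, j) ∈ mu → i < n := fun {i j} h => by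
    have := mu.up_left_mem le_rfl (Nat.zero_le j) h
    rw [YoungDiagram.mem_iff_lt_colLen] at this
    omega
  refine ⟨⟨fun i j => ?_, fun i j => ?_, fun i j _ h => ?_, fun i j _ h => ?_⟩, fun i h => ?_⟩
  · rw [rowFilling_pos_iff hw]
    exact ⟨fun h => ⟨h, YoungDiagram.notMem_bot _⟩, fun h => h.1⟩
  · unfold rowFilling
    split_ifs with h
    · have := hrow h
      have := hw2 (i + 1)
      omega
    · exact Nat.zero_le _
  · rw [rowFilling, rowFilling, if_pos h, if_pos (mu.up_left_mem le_rfl (Nat.le_succ j) h)]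
  · rw [rowFilling, rowFilling, if_pos h, if_pos (mu.up_left_mem (Nat.le_succ i) le_rfl h)]
    exact hlt _
  · rw [rowFilling, if_pos h]
    have := hw (i + 1)
    omega

theorem rowFilling_injective (hw : ∀ k, 2 * k - 1 ≤ w k) :
    Function.Injective (rowFilling w) := by
  intro mu mu' h
  ext ⟨i, j⟩
  rw [YoungDiagram.mem_cells, YoungDiagram.mem_cells, ← rowFilling_pos_iff hw, h,
    rowFilling_pos_iff hw]

theorem content_rowFilling (hw : ∀ k, 2 * k - 1 ≤ w k) (hw2 : ∀ k, w k ≤ 2 * k) (k : ℕ) :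
    content mu (rowFilling w mu) (w (k + 1)) = mu.rowLen k := by
  rw [content, YoungDiagram.rowLen_eq_card]
  congr 1
  ext ⟨i, j⟩
  simp only [Finset.mem_filter, YoungDiagram.mem_cells, YoungDiagram.mem_row_iff]
  refine and_congr_right fun h => ?_
  rw [rowFilling, if_pos h]
  refine ⟨fun he => ?_, fun he => by rw [he]⟩
  have a1 := hw (i + 1); have a2 := hw2 (i + 1); have a3 := hw (k + 1); have a4 := hw2 (k + 1)
  omega

theorem content_rowFilling_of_ne {x : ℕ} (hx : ∀ k, w (k + 1) ≠ x) :
    content mu (rowFilling w mu) x = 0 := by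
  rw [content, Finset.card_eq_zero, Finset.filter_eq_empty_iff]
  rintro ⟨i, j⟩ h
  rw [YoungDiagram.mem_cells] at h
  rw [rowFilling, if_pos h]
  exact hx i

end rowFilling

theorem kWeight_SH (n : ℕ) (mu : YoungDiagram) : kWeight n mu (SH mu) = parVec n mu := by
  funext k
  have h1 : content mu (SH mu) (u (k + 1)) = mu.rowLen k :=
    content_rowFilling (fun _ => u_bounds.1) (fun _ => u_bounds.2) k
  have h2 : content mu (SH mu) (v (k + 1)) = 0 :=
    content_rowFilling_of_ne fun l => u_ne_v (by omega) (by omega)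
  rw [kWeight, parVec, h1, h2]
  simp

theorem kWeight_SL (n : ℕ) (mu : YoungDiagram) : kWeight n mu (SL mu) = -parVec n mu := by
  funext k
  have h1 : content mu (SL mu) (v (k + 1)) = mu.rowLen k :=
    content_rowFilling (fun _ => v_bounds.1) (fun _ => v_bounds.2) k
  have h2 : content mu (SL mu) (u (k + 1)) = 0 :=
    content_rowFilling_of_ne fun l => (u_ne_v (by omega) (by omega)).symm
  rw [kWeight, Pi.neg_apply, parVec, h1, h2]
  simp

theorem parVec_injOn {n : ℕ} {mu mu' : YoungDiagram} (h : mu.colLen 0 ≤ n)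
    (h' : mu'.colLen 0 ≤ n) (he : parVec n mu = parVec n mu') : mu = mu' := by
  have hzero : ∀ {mu : YoungDiagram}, mu.colLen 0 ≤ n → ∀ i, n ≤ i → mu.rowLen i = 0 :=
    fun {mu} h i hi => by
      by_contra hc
      have h1 : (i, 0) ∈ mu := YoungDiagram.mem_iff_lt_rowLen.2 (by omega)
      rw [YoungDiagram.mem_iff_lt_colLen] at h1
      omega
  have hrow : ∀ i, mu.rowLen i = mu'.rowLen i := fun i => by
    rcases lt_or_ge i n with hi | hi
    · have := congrFun he ⟨i, hi⟩
      simpa [parVec] using this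
    · rw [hzero h i hi, hzero h' i hi]
  ext ⟨i, j⟩
  rw [YoungDiagram.mem_cells, YoungDiagram.mem_cells, YoungDiagram.mem_iff_lt_rowLen,
    YoungDiagram.mem_iff_lt_rowLen, hrow]

/-! ### Highest and lowest weight tableaux -/

theorem eq_of_mem_SpT {n : ℕ} {mu mu' : YoungDiagram} {P : Filling} (h : P ∈ SpT n mu)
    (h' : P ∈ SpT n mu') : mu = mu' := by
  ext ⟨i, j⟩
  have h1 := h.1.pos_iff i j
  have h2 := h'.1.pos_iff i j
  simp only [YoungDiagram.notMem_bot, not_false_eq_true, and_true] at h1 h2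
  rw [YoungDiagram.mem_cells, YoungDiagram.mem_cells, ← h1, h2]

theorem LRAII_bijOn {n : ℕ} {lam : YoungDiagram} (hlam : lam.colLen 0 ≤ 2 * n) :
    Set.BijOn (LRAII lam) (SST n lam) (LRPairs n lam) :=
  ⟨LRAII_mapsTo hlam, LRAII_injOn, LRAII_surjOn⟩

/-- The fibre of `P^{AII}` over a symplectic tableau. -/
theorem LRAIIInv_image {n : ℕ} {lam mu : YoungDiagram} (hlam : lam.colLen 0 ≤ 2 * n)
    (hmu : mu ∈ subPar n lam) {A : Filling} (hA : A ∈ SpT n mu) :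
    LRAIIInv n lam '' ({A} ×ˢ Rec n lam mu) = {T | T ∈ SST n lam ∧ PAII lam T = A} := by
  have hb := LRAII_bijOn hlam
  ext T
  constructor
  · rintro ⟨⟨B, R⟩, ⟨rfl, hR⟩, rfl⟩
    have hp : (B, R) ∈ LRPairs n lam := Set.mem_biUnion hmu ⟨hA, hR⟩
    have h1 := hb.invOn_invFunOn.2 hp
    exact ⟨Function.invFunOn_mem (hb.surjOn hp), congrArg Prod.fst h1⟩
  · rintro ⟨hT, rfl⟩
    refine ⟨LRAII lam T, ⟨rfl, ?_⟩, hb.invOn_invFunOn.1 hT⟩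
    obtain ⟨mu', hmu', hlen⟩ := exists_shape hT
    obtain rfl := eq_of_mem_SpT hA (PAII_mem_SpT hT hlen).1
    exact QAII_mem_Rec hlam hT hmu'.1 hlen

/-- If `P^{AII}(T)` is a symplectic tableau of shape `mu`, then `mu ⊆ lam`, and `T` has the same
`𝔨`-weight as `P^{AII}(T)`. -/
theorem kWeight_eq {n : ℕ} {lam mu : YoungDiagram} {T : Filling} (hT : T ∈ SST n lam)
    (hP : PAII lam T ∈ SpT n mu) :
    mu ∈ subPar n lam ∧ kWeight n lam T = kWeight n mu (PAII lam T) := by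
  obtain ⟨mu', hmu', hlen⟩ := exists_shape hT
  obtain rfl := eq_of_mem_SpT hP (PAII_mem_SpT hT hlen).1
  exact ⟨hmu', kWeight_PAII hT hmu'.2 hlen⟩

theorem SH_mem_SpT {n : ℕ} {mu : YoungDiagram} (hmu : mu.colLen 0 ≤ n) : SH mu ∈ SpT n mu :=
  rowFilling_mem_SpT hmu (fun _ => u_bounds.1) (fun _ => u_bounds.2) u_lt_succ

theorem SL_mem_SpT {n : ℕ} {mu : YoungDiagram} (hmu : mu.colLen 0 ≤ n) : SL mu ∈ SpT n mu :=
  rowFilling_mem_SpT hmu (fun _ => v_bounds.1) (fun _ => v_bounds.2) v_lt_succ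

theorem SH_injective : Function.Injective SH :=
  rowFilling_injective (w := u) fun _ => u_bounds.1

theorem SL_injective : Function.Injective SL :=
  rowFilling_injective (w := v) fun _ => v_bounds.1

end QuantumLR

theorem mainTheorem4 (n : ℕ) (lam : YoungDiagram) (hlam : lam.colLen 0 ≤ 2 * n) :
    Set.BijOn (QuantumLR.LRAII lam) (QuantumLR.SST n lam) (QuantumLR.LRPairs n lam) ∧
    (∀ mu : YoungDiagram, mu.colLen 0 ≤ n → mu ≤ lam →
      QuantumLR.SH mu ∈ QuantumLR.SpT n mu ∧
      QuantumLR.SL mu ∈ QuantumLR.SpT n mu ∧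
      QuantumLR.LRAIIInv n lam '' ({QuantumLR.SH mu} ×ˢ QuantumLR.Rec n lam mu) =
        {S | S ∈ QuantumLR.SSThw n lam ∧
          QuantumLR.kWeight n lam S = QuantumLR.parVec n mu} ∧
      QuantumLR.LRAIIInv n lam '' ({QuantumLR.SL mu} ×ˢ QuantumLR.Rec n lam mu) =
        {S | S ∈ QuantumLR.SSTlw n lam ∧
          QuantumLR.kWeight n lam S = -QuantumLR.parVec n mu}) ∧
    (QuantumLR.SSThw n lam = ⋃ mu ∈ QuantumLR.subPar n lam,
        QuantumLR.LRAIIInv n lam '' ({QuantumLR.SH mu} ×ˢ QuantumLR.Rec n lam mu)) ∧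
    (QuantumLR.subPar n lam).PairwiseDisjoint (fun mu =>
        QuantumLR.LRAIIInv n lam '' ({QuantumLR.SH mu} ×ˢ QuantumLR.Rec n lam mu)) ∧
    (QuantumLR.SSTlw n lam = ⋃ mu ∈ QuantumLR.subPar n lam,
        QuantumLR.LRAIIInv n lam '' ({QuantumLR.SL mu} ×ˢ QuantumLR.Rec n lam mu)) ∧
    (QuantumLR.subPar n lam).PairwiseDisjoint (fun mu =>
        QuantumLR.LRAIIInv n lam '' ({QuantumLR.SL mu} ×ˢ QuantumLR.Rec n lam mu)) := by
  open QuantumLR in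
  have hH := fun {mu} (hmu : mu ∈ subPar n lam) => LRAIIInv_image hlam hmu (SH_mem_SpT hmu.1)
  have hL := fun {mu} (hmu : mu ∈ subPar n lam) => LRAIIInv_image hlam hmu (SL_mem_SpT hmu.1)
  refine ⟨LRAII_bijOn hlam, fun mu hmu hle => ⟨SH_mem_SpT hmu, SL_mem_SpT hmu, ?_, ?_⟩,
    ?_, ?_, ?_, ?_⟩
  · rw [hH ⟨hmu, hle⟩]
    ext T
    constructor
    · rintro ⟨hT, hP⟩
      refine ⟨⟨hT, mu, hmu, hP⟩, ?_⟩
      rw [(kWeight_eq hT (hP ▸ SH_mem_SpT hmu)).2, hP, kWeight_SH]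
    · rintro ⟨⟨hT, mu', hmu', hP⟩, hw⟩
      rw [(kWeight_eq hT (hP ▸ SH_mem_SpT hmu')).2, hP, kWeight_SH] at hw
      obtain rfl := parVec_injOn hmu' hmu hw
      exact ⟨hT, hP⟩
  · rw [hL ⟨hmu, hle⟩]
    ext T
    constructor
    · rintro ⟨hT, hP⟩
      refine ⟨⟨hT, mu, hmu, hP⟩, ?_⟩
      rw [(kWeight_eq hT (hP ▸ SL_mem_SpT hmu)).2, hP, kWeight_SL]
    · rintro ⟨⟨hT, mu', hmu', hP⟩, hw⟩
      rw [(kWeight_eq hT (hP ▸ SL_mem_SpT hmu')).2, hP, kWeight_SL] at hw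
      obtain rfl := parVec_injOn hmu' hmu (neg_injective hw)
      exact ⟨hT, hP⟩
  · ext T
    simp only [Set.mem_iUnion₂]
    constructor
    · rintro ⟨hT, mu, hmu, hP⟩
      have hsub := (kWeight_eq hT (hP ▸ SH_mem_SpT hmu)).1
      exact ⟨mu, hsub, by rw [hH hsub]; exact ⟨hT, hP⟩⟩
    · rintro ⟨mu, hmu, h⟩
      rw [hH hmu] at h
      exact ⟨h.1, mu, hmu.1, h.2⟩
  · intro mu hmu mu' hmu' hne
    simp only [Function.onFun]
    rw [hH hmu, hH hmu', Set.disjoint_left]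
    rintro T ⟨-, h⟩ ⟨-, h'⟩
    exact hne (SH_injective (h.symm.trans h'))
  · ext T
    simp only [Set.mem_iUnion₂]
    constructor
    · rintro ⟨hT, mu, hmu, hP⟩
      have hsub := (kWeight_eq hT (hP ▸ SL_mem_SpT hmu)).1
      exact ⟨mu, hsub, by rw [hL hsub]; exact ⟨hT, hP⟩⟩
    · rintro ⟨mu, hmu, h⟩
      rw [hL hmu] at h
      exact ⟨h.1, mu, hmu.1, h.2⟩
  · intro mu hmu mu' hmu' hne
    simp only [Function.onFun]
    rw [hL hmu, hL hmu', Set.disjoint_left]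
    rintro T ⟨-, h⟩ ⟨-, h'⟩
    exact hne (SL_injective (h.symm.trans h'))
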